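/- Let $p\in C^2((0,\infty);(0,\infty))$ with $p'\ge 0$ and $p''\ge 0$, and let $\kappa\in C^1(\mathbb R;[0,\infty))$ be even with $\kappa(0)=0$. Fix $f>0$, an angle $\theta\in(-\pi,\pi)$ and put $c=f\,\kappa(2|\sin(\theta/2)|)\ge 0$. Write $u=(\rho,q)$, $$P(\rho,q)=\frac{q^2}{\rho}+p(\rho),\quad E(\rho,q)=\frac{q^2}{2\rho}+\rho\int_{\bar\rho}^{\rho}\frac{p(r)}{r^2}\,dr,\quad F=\frac q\rho\,(E+p)$$ with a fixed $\bar\rho>0$, and $\Omega=\{(\rho,q):\rho>0,\ |q/\rho|<\sqrt{p'(\rho)}\}$ (the subsonic region). Consider the isentropic Euler system in a pipe with a single kink at $x=0$, $$\partial_t\rho+\partial_x q=0,\qquad \partial_t q+\partial_x P(\rho,q)=-c\,q\,\delta_{x=0},$$ that is, the system with zero right-hand side for $x\neq0$ and, at $x=0$, the kink conditions $$q(t,0+)=q(t,0-),\qquad P(t,0+)-P(t,0-)=-c\,q(t,0+).$$ A weak entropy solution with datum $u_o$ is a bounded function $u$ on $[0,\infty)\times\mathbb R$ with $u-u_o\in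 C^0([0,\infty);L^1(\mathbb R))$, $u(0,\cdot)=u_o$ and $u(t,\cdot)$ of bounded variation for each $t$, which satisfies the system in the sense of distributions on $(0,\infty)\times\mathbb R$, satisfies the kink conditions in the sense of one-sided traces of $q$ and $P$ at $x=0$, and satisfies $$\int_0^\infty\!\!\int_{\mathbb R}\big(E(u)\,\partial_t\varphi+F(u)\,\partial_x\varphi\big)\,dx\,dt\ge0$$ for all $\varphi\in C^1_c((0,\infty)\times\mathbb R;[0,\infty))$. Let $\bar u$ be a subsonic stationary solution: $\bar u(x)=(\rho^\ell,\bar q)\in\Omega$ for $x<0$, $\bar u(x)=(\rho^r,\bar q)\in\Omega$ for $x>0$, with $P(\rho^r,\bar q)-P(\rho^\ell,\bar q)=-c\,\bar q$. Then there is $\delta>0$ such that for all $u^\ell,u^r\in\Omega$ for which $u_o=u^\ell$ on $x<0$, $u_o=u^r$ on $x>0$ satisfies $\|u_o-\bar u\|_{L^\infty}<\delta$, there is a weak entropy solution with datum $u_o$ that is self-similar (a function of $x/t$) and attains values in $\Omega$, and it is unique (up to null sets) among all weak entropy solutions with datum $u_o$ that are self-similar and attain values in $\Omega$. Moreover there are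 states $u^-,u^+\in\Omega$ satisfying the kink conditions such that this solution consists of a $1$-wave (trivial, Lax shock or centered rarefaction) from $u^\ell$ to $u^-$ supported in $x<0$, the stationary jump from $u^-$ to $u^+$ at $x=0$, and a $2$-wave (trivial, Lax shock or centered rarefaction) from $u^+$ to $u^r$ supported in $x>0$. -/

import Mathlib

open MeasureTheory Filter Topology Set

noncomputable section

namespace KinkedPipe

/-- The pressure law: `p` is of class `C²` from `(0, ∞)` to `(0, ∞)`, nondecreasing and convex.
Values of `p` outside `(0, ∞)` play no role. -/
structure PressureLaw (p : ℝ → ℝ) : Prop where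
  contDiffOn : ContDiffOn ℝ 2 p (Ioi 0)
  pos : ∀ ρ, 0 < ρ → 0 < p ρ
  deriv_nonneg : ∀ ρ, 0 < ρ → 0 ≤ deriv p ρ
  deriv_deriv_nonneg : ∀ ρ, 0 < ρ → 0 ≤ deriv (deriv p) ρ

/-- The hypothesis on `κ`: an even `C¹` function from `ℝ` to `[0, ∞)` vanishing at `0`. -/
structure KinkLaw (κ : ℝ → ℝ) : Prop where
  contDiff : ContDiff ℝ 1 κ
  nonneg : ∀ x, 0 ≤ κ x
  zero : κ 0 = 0
  even : ∀ x, κ (-x) = κ x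

/-- The strength `f κ(2 |sin (θ / 2)|)` of a kink of angle `θ`. -/
def kinkCoeff (f : ℝ) (κ : ℝ → ℝ) (θ : ℝ) : ℝ := f * κ (2 * |Real.sin (θ / 2)|)

/-- The dynamic pressure `P(ρ, q) = q² / ρ + p(ρ)` of the state `u = (ρ, q)`. -/
def dynPressure (p : ℝ → ℝ) (u : ℝ × ℝ) : ℝ := u.2 ^ 2 / u.1 + p u.1

/-- The flux `(q, P(ρ, q))` of the isentropic Euler system. -/
def flux (p : ℝ → ℝ) (u : ℝ × ℝ) : ℝ × ℝ := (u.2, dynPressure p u)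

/-- The mathematical entropy
`E(ρ, q) = q² / (2ρ) + ρ ∫_{ρref}^ρ p(r) / r² dr` with reference density `ρref`. -/
def entropy (p : ℝ → ℝ) (ρref : ℝ) (u : ℝ × ℝ) : ℝ :=
  u.2 ^ 2 / (2 * u.1) + u.1 * ∫ r in ρref..u.1, p r / r ^ 2

/-- The entropy flow `(q / ρ) (E + p)`. -/
def entropyFlux (p : ℝ → ℝ) (ρref : ℝ) (u : ℝ × ℝ) : ℝ :=
  u.2 / u.1 * (entropy p ρref u + p u.1)

/-- The subsonic region `Ω`: `ρ > 0` and `|q / ρ| < √(p'(ρ))`. -/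
def subsonic (p : ℝ → ℝ) : Set (ℝ × ℝ) :=
  {u | 0 < u.1 ∧ |u.2 / u.1| < Real.sqrt (deriv p u.1)}

/-- The conditions at the kink on the left state `um` and the right state `up`: conservation of
`q`, and the jump `P(up) - P(um) = -c q` of the dynamic pressure. -/
def KinkCondition (p : ℝ → ℝ) (c : ℝ) (um up : ℝ × ℝ) : Prop :=
  up.2 = um.2 ∧ dynPressure p up - dynPressure p um = -(c * up.2)

/-- Stationary solutions of the single-kink problem: one state of positive density on each side of
the kink, joined by the kink conditions. -/
def IsStationary (p : ℝ → ℝ) (c : ℝ) (ubar : ℝ → ℝ × ℝ) : Prop :=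
  ∃ um up : ℝ × ℝ, 0 < um.1 ∧ 0 < up.1 ∧ KinkCondition p c um up ∧
    (∀ x, x < 0 → ubar x = um) ∧ ∀ x, 0 < x → ubar x = up

/-- The Riemann datum with left state `ul` and right state `ur`. -/
def riemannDatum (ul ur : ℝ × ℝ) (x : ℝ) : ℝ × ℝ := if x < 0 then ul else ur

/-- Test functions of class `C¹` with compact support in `(0, ∞) × ℝ`. -/
def IsTest (φ : ℝ × ℝ → ℝ) : Prop :=
  ContDiff ℝ 1 φ ∧ HasCompactSupport φ ∧ tsupport φ ⊆ Ioi 0 ×ˢ univ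

/-- The partial derivative in time. -/
def dt (φ : ℝ × ℝ → ℝ) (t x : ℝ) : ℝ := deriv (fun s => φ (s, x)) t

/-- The partial derivative in space. -/
def dx (φ : ℝ × ℝ → ℝ) (t x : ℝ) : ℝ := deriv (fun y => φ (t, y)) x

/-- Limit of `g` at `0` from the left, null sets being ignored. -/
def LeftTrace (g : ℝ → ℝ) (a : ℝ) : Prop := Tendsto g (𝓝[<] 0 ⊓ ae volume) (𝓝 a)

/-- Limit of `g` at `0` from the right, null sets being ignored. -/
def RightTrace (g : ℝ → ℝ) (a : ℝ) : Prop := Tendsto g (𝓝[>] 0 ⊓ ae volume) (𝓝 a)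

/-- Weak entropy solutions `u = u t x` on `[0, ∞) × ℝ` of
`∂ₜ ρ + ∂ₓ q = 0`, `∂ₜ q + ∂ₓ P(ρ, q) = -c q δ_{x = 0}` with initial datum `uo`:
bounded, continuous in time with values in `uo + L¹(ℝ)`, of bounded variation in space,
with traces at the kink satisfying the kink conditions. -/
structure IsWeakEntropySolution (p : ℝ → ℝ) (ρref c : ℝ) (uo : ℝ → ℝ × ℝ)
    (u : ℝ → ℝ → ℝ × ℝ) : Prop where
  measurable : AEStronglyMeasurable (fun z : ℝ × ℝ => u z.1 z.2)
    (volume.restrict (Ioi (0 : ℝ) ×ˢ (univ : Set ℝ)))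
  bounded : ∃ M : ℝ, ∀ t, 0 < t → ∀ᵐ x, ‖u t x‖ ≤ M
  boundedVariation : ∀ t, 0 ≤ t → ∃ g : ℝ → ℝ × ℝ, BoundedVariationOn g univ ∧ u t =ᵐ[volume] g
  initial : u 0 =ᵐ[volume] uo
  integrable : ∀ t, 0 ≤ t → Integrable (fun x => u t x - uo x)
  continuous : ∀ t₀, 0 ≤ t₀ →
    Tendsto (fun t => ∫ x, ‖u t x - u t₀ x‖) (𝓝[Ici 0] t₀) (𝓝 0)
  mass : ∀ φ, IsTest φ →
    ∫ t in Ioi (0 : ℝ), ∫ x, ((u t x).1 * dt φ t x + (u t x).2 * dx φ t x) = 0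
  momentum : ∃ q₀ : ℝ → ℝ,
    (∀ t, 0 < t →
      LeftTrace (fun x => (u t x).2) (q₀ t) ∧ RightTrace (fun x => (u t x).2) (q₀ t) ∧
      ∃ Pm Pp : ℝ, LeftTrace (fun x => dynPressure p (u t x)) Pm ∧
        RightTrace (fun x => dynPressure p (u t x)) Pp ∧ Pp - Pm = -(c * q₀ t)) ∧
    ∀ φ, IsTest φ →
      ∫ t in Ioi (0 : ℝ), ∫ x, ((u t x).2 * dt φ t x + dynPressure p (u t x) * dx φ t x)
        = ∫ t in Ioi (0 : ℝ), c * q₀ t * φ (t, 0)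
  entropy_ineq : ∀ φ, IsTest φ → (∀ z, 0 ≤ φ z) →
    0 ≤ ∫ t in Ioi (0 : ℝ), ∫ x,
      (entropy p ρref (u t x) * dt φ t x + entropyFlux p ρref (u t x) * dx φ t x)

/-- Self-similarity: `u` is a function of `x / t`. -/
def IsSelfSimilar (u : ℝ → ℝ → ℝ × ℝ) : Prop :=
  ∃ U : ℝ → ℝ × ℝ, ∀ t, 0 < t → u t =ᵐ[volume] fun x => U (x / t)

/-- `u` attains values in the subsonic region. -/
def IsSubsonicValued (p : ℝ → ℝ) (u : ℝ → ℝ → ℝ × ℝ) : Prop :=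
  ∀ t, 0 < t → ∀ᵐ x, u t x ∈ subsonic p

/-- The characteristic speeds `q / ρ ∓ √(p'(ρ))`; the index `0` is the first family, the index `1`
the second one. -/
def charSpeed (p : ℝ → ℝ) (i : Fin 2) (u : ℝ × ℝ) : ℝ :=
  if i = 0 then u.2 / u.1 - Real.sqrt (deriv p u.1) else u.2 / u.1 + Real.sqrt (deriv p u.1)

/-- `W`, a function of `ξ = x / t`, is a wave of family `i` from the left state `uL` to the right
state `uR`, with slowest speed `a` and fastest speed `b`: the trivial wave, a Lax shock, or a
centered rarefaction. -/
def IsWave (p : ℝ → ℝ) (i : Fin 2) (uL uR : ℝ × ℝ) (a b : ℝ) (W : ℝ → ℝ × ℝ) : Prop :=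
  (∀ ξ, ξ < a → W ξ = uL) ∧ (∀ ξ, b < ξ → W ξ = uR) ∧
    ((uL = uR ∧ a = charSpeed p i uL ∧ b = a) ∨
      (b = a ∧ flux p uR - flux p uL = a • (uR - uL) ∧
        charSpeed p i uR < a ∧ a < charSpeed p i uL) ∨
      (a < b ∧ a = charSpeed p i uL ∧ b = charSpeed p i uR ∧
        ContinuousOn W (Icc a b) ∧ W a = uL ∧ W b = uR ∧
        ∀ ξ ∈ Ioo a b, charSpeed p i (W ξ) = ξ ∧
          ∃ V, HasDerivAt W V ξ ∧ fderiv ℝ (flux p) (W ξ) V = ξ • V))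

/-- `u` consists of a wave of the first family in `x < 0`, a stationary jump at `x = 0` between
subsonic states satisfying the kink conditions, and a wave of the second family in `x > 0`. -/
def HasKinkStructure (p : ℝ → ℝ) (c : ℝ) (ul ur : ℝ × ℝ) (u : ℝ → ℝ → ℝ × ℝ) : Prop :=
  ∃ um ∈ subsonic p, ∃ up ∈ subsonic p, ∃ (a₁ b₁ a₂ b₂ : ℝ) (W₁ W₂ : ℝ → ℝ × ℝ),
    IsWave p 0 ul um a₁ b₁ W₁ ∧ b₁ < 0 ∧
    KinkCondition p c um up ∧
    IsWave p 1 up ur a₂ b₂ W₂ ∧ 0 < a₂ ∧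
    ∀ t, 0 < t → (∀ x, x < 0 → u t x = W₁ (x / t)) ∧ ∀ x, 0 < x → u t x = W₂ (x / t)

end KinkedPipe

end

noncomputable section

namespace KinkedPipe

/-! ### The pressure law -/

namespace PressureLaw

variable {p : ℝ → ℝ}

/-! In the subsonic region the first characteristic speed is negative and the second positive, so a
self-similar solution can carry only first-family waves in `x < 0` and only second-family waves in
`x > 0`. The reflection `x ↦ -x`, `q ↦ -q` exchanges the families, and all the analysis is done on
the left half line.

The decisive fact is a monotonicity. Among the states which can be reached at `ξ = x / t = 0` from a
fixed left state, the dynamic pressure `P` is a strictly decreasing function of the momentum `q`: on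
rarefactions `dP = λ dq` with the speed `λ < 0`, and across shocks `[P] = s [q]` with `s < 0`. By
reflection, `P` increases with `q` along the states which can be joined to a fixed right state.
Hence the kink condition `P₊(q) - P₋(q) + c q = 0` with `c ≥ 0` asks for a zero of a strictly
increasing function of one variable. Existence near a stationary solution is then the intermediate
value theorem, with a slope bound `κ` that is uniform in the data (`exists_waveCurve`,
`eventually_exists_waves`); uniqueness comes from strictness and needs no smallness.

Uniqueness must first show that an arbitrary competitor consists of such waves. Its profile has
bounded variation and satisfies the equations in the variable `ξ` in the weak sense, so `flux - ξ U`
is a primitive of `-U`. Vacuum is excluded (`not_tendsto_density_zero`), so one-sided limits exist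
as nearly subsonic states and satisfy the Rankine-Hugoniot conditions; the entropy inequality and `ξ
< 0` turn every jump into a Lax shock of the first family (`eq_or_lax`). Where the profile is
continuous and not sonic it is locally constant. Consequently a half-line profile is a single shock
or a single rarefaction, possibly trivial (`IsFan.classification`), two of them with the same left
state coincide or have oppositely ordered traces of `q` and `P` (`IsFan.eq_or_trace_lt`), and the
kink condition excludes the latter (`IsProfile.ae_eq`).

That the constructed function is a solution is checked wave by wave: integration by parts leaves
only point contributions at shocks and at the kink. Those of mass vanish, those of momentum give the
source, and those of entropy have the right sign, at the kink because `c ≥ 0`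
(`KinkCondition.entropyFlux_le`). -/

theorem contDiffAt (hp : PressureLaw p) {ρ : ℝ} (hρ : 0 < ρ) : ContDiffAt ℝ 2 p ρ :=
  hp.contDiffOn.contDiffAt (Ioi_mem_nhds hρ)

theorem hasDerivAt (hp : PressureLaw p) {ρ : ℝ} (hρ : 0 < ρ) : HasDerivAt p (deriv p ρ) ρ :=
  ((hp.contDiffAt hρ).differentiableAt (by norm_num)).hasDerivAt

theorem continuousAt (hp : PressureLaw p) {ρ : ℝ} (hρ : 0 < ρ) : ContinuousAt p ρ :=
  (hp.hasDerivAt hρ).continuousAt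

theorem contDiffOn_deriv (hp : PressureLaw p) : ContDiffOn ℝ 1 (deriv p) (Ioi 0) :=
  ((contDiffOn_succ_iff_deriv_of_isOpen (n := 1) isOpen_Ioi).1
    (by simpa [one_add_one_eq_two] using hp.contDiffOn)).2.2

theorem hasDerivAt_deriv (hp : PressureLaw p) {ρ : ℝ} (hρ : 0 < ρ) :
    HasDerivAt (deriv p) (deriv (deriv p) ρ) ρ :=
  (((hp.contDiffOn_deriv).contDiffAt (Ioi_mem_nhds hρ)).differentiableAt (by norm_num)).hasDerivAt

theorem continuousAt_deriv (hp : PressureLaw p) {ρ : ℝ} (hρ : 0 < ρ) :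
    ContinuousAt (deriv p) ρ :=
  (hp.hasDerivAt_deriv hρ).continuousAt

theorem continuousOn (hp : PressureLaw p) : ContinuousOn p (Ioi 0) := hp.contDiffOn.continuousOn

theorem continuousOn_deriv (hp : PressureLaw p) : ContinuousOn (deriv p) (Ioi 0) :=
  hp.contDiffOn_deriv.continuousOn

theorem monotoneOn (hp : PressureLaw p) : MonotoneOn p (Ioi 0) :=
  monotoneOn_of_deriv_nonneg (convex_Ioi 0) hp.continuousOn
    (fun x hx => by
      rw [interior_Ioi] at hx
      exact (hp.hasDerivAt hx).differentiableAt.differentiableWithinAt)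
    (fun x hx => by rw [interior_Ioi] at hx; exact hp.deriv_nonneg x hx)

theorem monotoneOn_deriv (hp : PressureLaw p) : MonotoneOn (deriv p) (Ioi 0) :=
  monotoneOn_of_deriv_nonneg (convex_Ioi 0) hp.continuousOn_deriv
    (fun x hx => by
      rw [interior_Ioi] at hx
      exact (hp.hasDerivAt_deriv hx).differentiableAt.differentiableWithinAt)
    (fun x hx => by rw [interior_Ioi] at hx; exact hp.deriv_deriv_nonneg x hx)

theorem deriv_le_deriv (hp : PressureLaw p) {a b : ℝ} (ha : 0 < a) (hab : a ≤ b) :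
    deriv p a ≤ deriv p b :=
  hp.monotoneOn_deriv ha (ha.trans_le hab) hab

theorem sqrt_deriv_le (hp : PressureLaw p) {a b : ℝ} (ha : 0 < a) (hab : a ≤ b) :
    √(deriv p a) ≤ √(deriv p b) :=
  Real.sqrt_le_sqrt (hp.deriv_le_deriv ha hab)

theorem sq_sqrt_deriv (hp : PressureLaw p) {a : ℝ} (ha : 0 < a) :
    √(deriv p a) ^ 2 = deriv p a :=
  Real.sq_sqrt (hp.deriv_nonneg a ha)

theorem continuousOn_sqrt_deriv (hp : PressureLaw p) :
    ContinuousOn (fun ρ => √(deriv p ρ)) (Ioi 0) :=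
  hp.continuousOn_deriv.sqrt

theorem strictMonoOn_of_forall_deriv_pos (hp : PressureLaw p) {a : ℝ} (ha : 0 < a)
    (h : ∀ r, a < r → 0 < deriv p r) : StrictMonoOn p (Ici a) :=
  strictMonoOn_of_deriv_pos (convex_Ici a)
    (hp.continuousOn.mono fun _ hx => ha.trans_le hx)
    (fun x hx => h x (by simpa using hx))

end PressureLaw

/-! ### States, characteristic speeds and jumps -/

/-- States of positive density in the closure of the subsonic region. -/
def weaklySubsonic (p : ℝ → ℝ) : Set (ℝ × ℝ) :=
  -- In a limit of subsonic states `p'` may vanish at the density itself, but not above it. The last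
  -- clause keeps this remnant of strict monotonicity of `p`.
  {u | 0 < u.1 ∧ |u.2| ≤ u.1 * √(deriv p u.1) ∧ ∀ r, u.1 < r → 0 < deriv p r}

theorem mem_subsonic_iff {p : ℝ → ℝ} {u : ℝ × ℝ} :
    u ∈ subsonic p ↔ 0 < u.1 ∧ |u.2| < u.1 * √(deriv p u.1) := by
  refine and_congr_right fun h => ?_
  rw [abs_div, abs_of_pos h, div_lt_iff₀ h, mul_comm]

theorem deriv_pos_of_mem_subsonic {p : ℝ → ℝ} {u : ℝ × ℝ} (hu : u ∈ subsonic p) :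
    0 < deriv p u.1 :=
  Real.sqrt_pos.1 ((abs_nonneg _).trans_lt hu.2)

theorem subsonic_subset_weaklySubsonic {p : ℝ → ℝ} (hp : PressureLaw p) :
    subsonic p ⊆ weaklySubsonic p := fun _ hu =>
  ⟨hu.1, (mem_subsonic_iff.1 hu).2.le, fun _ hr =>
    (deriv_pos_of_mem_subsonic hu).trans_le (hp.deriv_le_deriv hu.1 hr.le)⟩

theorem abs_velocity_le {p : ℝ → ℝ} {u : ℝ × ℝ} (hu : u ∈ weaklySubsonic p) :
    |u.2 / u.1| ≤ √(deriv p u.1) := by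
  rw [abs_div, abs_of_pos hu.1, div_le_iff₀ hu.1, mul_comm]
  exact hu.2.1

theorem charSpeed_zero_neg {p : ℝ → ℝ} {u : ℝ × ℝ} (hu : u ∈ subsonic p) :
    charSpeed p 0 u < 0 := by
  have := (abs_lt.1 hu.2).2
  simp only [charSpeed, if_true]
  linarith

theorem continuousAt_charSpeed {p : ℝ → ℝ} (hp : PressureLaw p) {u : ℝ × ℝ} (hu : 0 < u.1) :
    ContinuousAt (charSpeed p 0) u := by
  have h1 : ContinuousAt (fun u : ℝ × ℝ => √(deriv p u.1)) u :=
    ((hp.continuousAt_deriv hu).comp continuousAt_fst).sqrt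
  have h2 : ContinuousAt (fun u : ℝ × ℝ => u.2 / u.1) u :=
    continuousAt_snd.div continuousAt_fst hu.ne'
  exact (h2.sub h1).congr (Eventually.of_forall fun _ => by simp [charSpeed])

/-- `½ m² / ρ² + ∫ p / r² + p / ρ`, the Bernoulli function of relative mass flux `m`. -/
def bernoulli (p : ℝ → ℝ) (ρref m ρ : ℝ) : ℝ :=
  m ^ 2 / (2 * ρ ^ 2) + (∫ r in ρref..ρ, p r / r ^ 2) + p ρ / ρ

theorem hasDerivAt_integral_pressure {p : ℝ → ℝ} (hp : PressureLaw p) {ρref ρ : ℝ}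
    (hr : 0 < ρref) (hρ : 0 < ρ) :
    HasDerivAt (fun ρ => ∫ r in ρref..ρ, p r / r ^ 2) (p ρ / ρ ^ 2) ρ := by
  have hc : ContinuousOn (fun r => p r / r ^ 2) (Ioi 0) :=
    hp.continuousOn.div (by fun_prop) fun x hx => pow_ne_zero _ (ne_of_gt hx)
  refine intervalIntegral.integral_hasDerivAt_right ?_ ?_ (hc.continuousAt (Ioi_mem_nhds hρ))
  · refine (hc.mono fun x hx => ?_).intervalIntegrable
    exact (lt_min hr hρ).trans_le hx.1
  · exact hc.stronglyMeasurableAtFilter isOpen_Ioi _ hρ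

theorem hasDerivAt_bernoulli {p : ℝ → ℝ} (hp : PressureLaw p) {ρref ρ : ℝ}
    (hr : 0 < ρref) (hρ : 0 < ρ) (m : ℝ) :
    HasDerivAt (bernoulli p ρref m) ((deriv p ρ - m ^ 2 / ρ ^ 2) / ρ) ρ := by
  have h1 : HasDerivAt (fun x : ℝ => m ^ 2 / (2 * x ^ 2))
      ((0 * (2 * ρ ^ 2) - m ^ 2 * (2 * (2 * ρ ^ (2 - 1)))) / (2 * ρ ^ 2) ^ 2) ρ := by
    refine (hasDerivAt_const ρ _).fun_div ?_ (by positivity)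
    simpa using (hasDerivAt_pow 2 ρ).const_mul 2
  have h3 := (hp.hasDerivAt hρ).fun_div (hasDerivAt_id' ρ) hρ.ne'
  refine ((h1.add (hasDerivAt_integral_pressure hp hr hρ)).add h3).congr_deriv ?_
  field_simp
  ring

/-- With `h(ρ) = m² / ρ + p(ρ)`, the Bernoulli function has derivative `h' / ρ`. Since `h'` is
strictly increasing, equal values of `h` enclose a zero `ρ₀` of `h'`, with `h' < 0` before and `h' >
0` after it; the weight `1 / ρ` then favours the decreasing part. This is the sign of the entropy
production of a shock, together with the fact that the relative flow is supersonic at the thin side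
and subsonic at the dense side. -/
theorem bernoulli_lt {p : ℝ → ℝ} (hp : PressureLaw p) {ρref m ρ₁ ρ₂ : ℝ} (hr : 0 < ρref)
    (h₁ : 0 < ρ₁) (h₁₂ : ρ₁ < ρ₂) (hm : m ≠ 0)
    (h : m ^ 2 / ρ₁ + p ρ₁ = m ^ 2 / ρ₂ + p ρ₂) :
    bernoulli p ρref m ρ₂ < bernoulli p ρref m ρ₁ ∧ deriv p ρ₁ < m ^ 2 / ρ₁ ^ 2 ∧
      m ^ 2 / ρ₂ ^ 2 < deriv p ρ₂ := by
  have hm2 : 0 < m ^ 2 := by positivity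
  have hd : ∀ ρ, 0 < ρ → HasDerivAt (fun ρ => m ^ 2 / ρ + p ρ) (deriv p ρ - m ^ 2 / ρ ^ 2) ρ := by
    intro ρ hρ
    refine (((hasDerivAt_inv hρ.ne').const_mul (m ^ 2)).add (hp.hasDerivAt hρ)).congr_deriv ?_
    field_simp
    ring
  have hmono : ∀ a b, 0 < a → a < b →
      deriv p a - m ^ 2 / a ^ 2 < deriv p b - m ^ 2 / b ^ 2 := by
    intro a b ha hab
    have := hp.deriv_le_deriv ha hab.le
    have : m ^ 2 / b ^ 2 < m ^ 2 / a ^ 2 := by gcongr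
    linarith
  obtain ⟨ρ₀, hρ₀, hz⟩ := exists_hasDerivAt_eq_zero (f := fun ρ => m ^ 2 / ρ + p ρ) h₁₂
    (fun x hx => (hd x (h₁.trans_le hx.1)).continuousAt.continuousWithinAt) h
    (fun x hx => hd x (h₁.trans hx.1))
  have h0 : 0 < ρ₀ := h₁.trans hρ₀.1
  -- Subtracting `h / ρ₀`, which has equal values at both ends, changes the derivative to `h' (1 / ρ
  -- - 1 / ρ₀)`, whose factors have opposite signs on either side of `ρ₀`.
  set F : ℝ → ℝ := fun ρ => bernoulli p ρref m ρ - (m ^ 2 / ρ + p ρ) / ρ₀ with hF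
  have hFd : ∀ ρ, 0 < ρ → HasDerivAt F ((deriv p ρ - m ^ 2 / ρ ^ 2) * (1 / ρ - 1 / ρ₀)) ρ := by
    intro ρ hρ
    refine ((hasDerivAt_bernoulli hp hr hρ m).sub ((hd ρ hρ).div_const ρ₀)).congr_deriv ?_
    ring
  have ha : StrictAntiOn F (Icc ρ₁ ρ₀) := by
    refine strictAntiOn_of_deriv_neg (convex_Icc _ _)
      (fun x hx => (hFd x (h₁.trans_le hx.1)).continuousAt.continuousWithinAt) fun x hx => ?_
    rw [interior_Icc] at hx
    have hx0 := h₁.trans hx.1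
    rw [(hFd x hx0).deriv]
    have := hmono x ρ₀ hx0 hx.2
    exact mul_neg_of_neg_of_pos (by linarith) (sub_pos.2 (one_div_lt_one_div_of_lt hx0 hx.2))
  have hb : StrictAntiOn F (Icc ρ₀ ρ₂) := by
    refine strictAntiOn_of_deriv_neg (convex_Icc _ _)
      (fun x hx => (hFd x (h0.trans_le hx.1)).continuousAt.continuousWithinAt) fun x hx => ?_
    rw [interior_Icc] at hx
    have hx0 := h0.trans hx.1
    rw [(hFd x hx0).deriv]
    have := hmono ρ₀ x h0 hx.1
    exact mul_neg_of_pos_of_neg (by linarith) (sub_neg.2 (one_div_lt_one_div_of_lt h0 hx.1))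
  refine ⟨?_, ?_, ?_⟩
  · have e1 := ha (left_mem_Icc.2 hρ₀.1.le) (right_mem_Icc.2 hρ₀.1.le) hρ₀.1
    have e2 := hb (left_mem_Icc.2 hρ₀.2.le) (right_mem_Icc.2 hρ₀.2.le) hρ₀.2
    have := e2.trans e1
    simp only [hF] at this
    rw [h] at this
    linarith
  · have := hmono ρ₁ ρ₀ h₁ hρ₀.1
    linarith
  · have := hmono ρ₀ ρ₂ h0 hρ₀.2
    linarith

/-- In the frame moving with speed `ξ` the relative mass flux `m = q - ξ ρ` and `m² / ρ + p` are
continuous across a jump of speed `ξ`. Only the first summand on the right jumps, so the entropy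
production is governed by the Bernoulli function alone. -/
theorem entropyFlux_sub_mul_entropy {p : ℝ → ℝ} {ρref : ℝ} {u : ℝ × ℝ} (hu : 0 < u.1) (ξ : ℝ) :
    entropyFlux p ρref u - ξ * entropy p ρref u =
      (u.2 - ξ * u.1) * bernoulli p ρref (u.2 - ξ * u.1) u.1 + (u.2 - ξ * u.1) * ξ ^ 2 / 2 +
        ξ * ((u.2 - ξ * u.1) ^ 2 / u.1 + p u.1) := by
  simp only [entropyFlux, entropy, bernoulli]
  field_simp
  ring

theorem relative_of_rankineHugoniot {p : ℝ → ℝ} {uL uR : ℝ × ℝ} {ξ : ℝ} (hL : 0 < uL.1)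
    (hR : 0 < uR.1) (h : flux p uR - flux p uL = ξ • (uR - uL)) :
    uR.2 - ξ * uR.1 = uL.2 - ξ * uL.1 ∧
      (uR.2 - ξ * uR.1) ^ 2 / uR.1 + p uR.1 = (uL.2 - ξ * uL.1) ^ 2 / uL.1 + p uL.1 := by
  have h1 : uR.2 - uL.2 = ξ * (uR.1 - uL.1) := congrArg Prod.fst h
  have h2 : dynPressure p uR - dynPressure p uL = ξ * (uR.2 - uL.2) := congrArg Prod.snd h
  have e : ∀ u : ℝ × ℝ, 0 < u.1 → (u.2 - ξ * u.1) ^ 2 / u.1 + p u.1 =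
      dynPressure p u - 2 * ξ * u.2 + ξ ^ 2 * u.1 := by
    intro u hu
    simp only [dynPressure]
    field_simp
    ring
  refine ⟨by linarith, ?_⟩
  rw [e _ hL, e _ hR]
  linear_combination h2 - ξ * h1

/-- A jump of negative speed between weakly subsonic states which dissipates the entropy is a Lax
shock of the first family. -/
theorem eq_or_lax {p : ℝ → ℝ} (hp : PressureLaw p) {ρref : ℝ} (hr : 0 < ρref) {uL uR : ℝ × ℝ}
    {ξ : ℝ} (hξ : ξ < 0) (hL : uL ∈ weaklySubsonic p) (hR : uR ∈ weaklySubsonic p)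
    (h : flux p uR - flux p uL = ξ • (uR - uL))
    (hE : entropyFlux p ρref uR - entropyFlux p ρref uL ≤
      ξ * (entropy p ρref uR - entropy p ρref uL)) :
    uL = uR ∨ uL.1 < uR.1 ∧ charSpeed p 0 uR < ξ ∧ ξ < charSpeed p 0 uL := by
  obtain ⟨hm, hh⟩ := relative_of_rankineHugoniot hL.1 hR.1 h
  have eL := entropyFlux_sub_mul_entropy (p := p) (ρref := ρref) hL.1 ξ
  have eR := entropyFlux_sub_mul_entropy (p := p) (ρref := ρref) hR.1 ξ
  rw [hh, hm] at eR
  rw [hm] at hh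
  set m := uL.2 - ξ * uL.1 with hmdef
  have hD : m * (bernoulli p ρref m uR.1 - bernoulli p ρref m uL.1) ≤ 0 := by linarith
  have hvL := abs_velocity_le hL
  have hvR := abs_velocity_le hR
  have wL : uL.2 / uL.1 - ξ = m / uL.1 := by
    have := hL.1.ne'
    rw [hmdef]; field_simp
  have wR : uR.2 / uR.1 - ξ = m / uR.1 := by
    have := hR.1.ne'
    rw [← hm]; field_simp
  rcases eq_or_ne uL.1 uR.1 with heq | hne
  · left
    refine Prod.ext heq ?_
    rw [heq] at hmdef
    linarith
  right
  have key : ∀ {u : ℝ × ℝ}, 0 < u.1 → 0 ≤ √(deriv p u.1) ∧ √(deriv p u.1) ^ 2 = deriv p u.1 :=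
    fun hu => ⟨Real.sqrt_nonneg _, hp.sq_sqrt_deriv hu⟩
  obtain ⟨cL0, cL⟩ := key hL.1
  obtain ⟨cR0, cR⟩ := key hR.1
  simp only [charSpeed, if_true]
  -- The sign of `m` tells the family. If `m < 0`, dissipation makes the right state the thinner
  -- one; it is then supersonic relative to the jump, which with `v ≥ -√p'` forces `ξ > 0`. If `m =
  -- 0`, the pressures agree, against strict monotonicity of `p` above the smaller density. Only `m
  -- > 0`, the first family, remains.
  rcases lt_trichotomy m 0 with hneg | hz | hpos
  · exfalso
    have hb : bernoulli p ρref m uL.1 ≤ bernoulli p ρref m uR.1 := by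
      by_contra hcon
      nlinarith
    have hlt : uR.1 < uL.1 := by
      by_contra hcon
      have := (bernoulli_lt hp hr hL.1 (lt_of_le_of_ne (not_lt.1 hcon) hne) hneg.ne hh.symm).1
      linarith
    have h2 := (bernoulli_lt hp hr hR.1 hlt hneg.ne hh).2.1
    rw [← div_pow, ← cR] at h2
    have hw : m / uR.1 < 0 := div_neg_of_neg_of_pos hneg hR.1
    have := (abs_le.1 hvR).1
    have : √(deriv p uR.1) < -(m / uR.1) :=
      lt_of_pow_lt_pow_left₀ 2 (by linarith) (by rwa [neg_sq])
    linarith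
  · exfalso
    rw [hz] at hh
    simp only [ne_eq, OfNat.ofNat_ne_zero, not_false_eq_true, zero_pow, zero_div, zero_add] at hh
    rcases lt_or_gt_of_ne hne with hlt | hlt
    · exact (hp.strictMonoOn_of_forall_deriv_pos hL.1 hL.2.2 self_mem_Ici hlt.le hlt).ne' hh
    · exact (hp.strictMonoOn_of_forall_deriv_pos hR.1 hR.2.2 self_mem_Ici hlt.le hlt).ne hh
  · have hb : bernoulli p ρref m uR.1 ≤ bernoulli p ρref m uL.1 := by
      by_contra hcon
      nlinarith
    have hlt : uL.1 < uR.1 := by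
      by_contra hcon
      have := (bernoulli_lt hp hr hR.1 (lt_of_le_of_ne (not_lt.1 hcon) hne.symm) hpos.ne' hh).1
      linarith
    obtain ⟨-, h1, h2⟩ := bernoulli_lt hp hr hL.1 hlt hpos.ne' hh.symm
    rw [← div_pow, ← cL] at h1
    rw [← div_pow, ← cR] at h2
    have hwL : 0 < m / uL.1 := div_pos hpos hL.1
    have hwR : 0 < m / uR.1 := div_pos hpos hR.1
    refine ⟨hlt, ?_, ?_⟩
    · have : m / uR.1 < √(deriv p uR.1) := lt_of_pow_lt_pow_left₀ 2 cR0 h2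
      linarith
    · have : √(deriv p uL.1) < m / uL.1 := lt_of_pow_lt_pow_left₀ 2 hwL.le h1
      linarith

/-! ### The flux and its derivative -/

/-- The derivative of the flux. -/
def fluxDeriv (p : ℝ → ℝ) (u : ℝ × ℝ) : ℝ × ℝ →L[ℝ] ℝ × ℝ :=
  (ContinuousLinearMap.snd ℝ ℝ ℝ).prod
    ((deriv p u.1 - (u.2 / u.1) ^ 2) • ContinuousLinearMap.fst ℝ ℝ ℝ +
      (2 * (u.2 / u.1)) • ContinuousLinearMap.snd ℝ ℝ ℝ)

theorem fluxDeriv_apply (p : ℝ → ℝ) (u V : ℝ × ℝ) :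
    fluxDeriv p u V =
      (V.2, (deriv p u.1 - (u.2 / u.1) ^ 2) * V.1 + 2 * (u.2 / u.1) * V.2) := by
  simp [fluxDeriv]

theorem hasFDerivAt_dynPressure {p : ℝ → ℝ} (hp : PressureLaw p) {u : ℝ × ℝ} (hu : 0 < u.1) :
    HasFDerivAt (dynPressure p)
      ((deriv p u.1 - (u.2 / u.1) ^ 2) • ContinuousLinearMap.fst ℝ ℝ ℝ +
        (2 * (u.2 / u.1)) • ContinuousLinearMap.snd ℝ ℝ ℝ) u := by
  have h1 : HasFDerivAt (fun u : ℝ × ℝ => u.1) (ContinuousLinearMap.fst ℝ ℝ ℝ) u := hasFDerivAt_fst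
  have h2 : HasFDerivAt (fun u : ℝ × ℝ => u.2) (ContinuousLinearMap.snd ℝ ℝ ℝ) u := hasFDerivAt_snd
  have h3 := ((h2.pow 2).mul ((hasDerivAt_inv hu.ne').comp_hasFDerivAt u h1)).add
    ((hp.hasDerivAt hu).comp_hasFDerivAt u h1)
  refine h3.congr_fderiv ?_
  ext <;> simp <;> field_simp
  ring

theorem hasFDerivAt_flux {p : ℝ → ℝ} (hp : PressureLaw p) {u : ℝ × ℝ} (hu : 0 < u.1) :
    HasFDerivAt (flux p) (fluxDeriv p u) u :=
  hasFDerivAt_snd.prodMk (hasFDerivAt_dynPressure hp hu)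

theorem continuousAt_dynPressure {p : ℝ → ℝ} (hp : PressureLaw p) {u : ℝ × ℝ} (hu : 0 < u.1) :
    ContinuousAt (dynPressure p) u :=
  (hasFDerivAt_dynPressure hp hu).continuousAt

/-- `(v - ξ)² - p'(ρ)`, with the velocity `v = q / ρ`, is the characteristic polynomial of the
derivative of the flux at `ξ`. -/
theorem fluxDeriv_injective {p : ℝ → ℝ} {u : ℝ × ℝ} {ξ : ℝ}
    (h : (u.2 / u.1 - ξ) ^ 2 ≠ deriv p u.1) {V : ℝ × ℝ} (hV : fluxDeriv p u V = ξ • V) :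
    V = 0 := by
  rw [fluxDeriv_apply] at hV
  have h1 : V.2 = ξ * V.1 := congrArg Prod.fst hV
  have h2 : (deriv p u.1 - (u.2 / u.1) ^ 2) * V.1 + 2 * (u.2 / u.1) * V.2 = ξ * V.2 :=
    congrArg Prod.snd hV
  have h3 : ((u.2 / u.1 - ξ) ^ 2 - deriv p u.1) * V.1 = 0 := by
    rw [h1] at h2
    linear_combination -h2
  have h4 : V.1 = 0 := (mul_eq_zero.1 h3).resolve_left (sub_ne_zero.2 h)
  exact Prod.ext h4 (by rw [h1, h4]; simp)

/-! ### Self-similar solutions on a half line -/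

/-- `U`, with right limits `R`, is a left-continuous self-similar solution in `ξ < 0` with weakly
subsonic states, all of whose jumps are Lax shocks of the first family, and `ul` is its state at
`-∞`. -/
structure IsFan (p : ℝ → ℝ) (ul : ℝ × ℝ) (U R : ℝ → ℝ × ℝ) : Prop where
  left_lim : ∀ ξ < 0, Tendsto U (𝓝[<] ξ) (𝓝 (U ξ))
  right_lim : ∀ ξ < 0, Tendsto U (𝓝[>] ξ) (𝓝 (R ξ))
  left_mem : ∀ ξ < 0, U ξ ∈ weaklySubsonic p
  right_mem : ∀ ξ < 0, R ξ ∈ weaklySubsonic p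
  rankineHugoniot : ∀ ξ < 0, flux p (R ξ) - flux p (U ξ) = ξ • (R ξ - U ξ)
  jump : ∀ ξ < 0, U ξ = R ξ ∨
    (U ξ).1 < (R ξ).1 ∧ charSpeed p 0 (R ξ) < ξ ∧ ξ < charSpeed p 0 (U ξ)
  -- The self-similar equation, in a form which does not presuppose that `U` is differentiable.
  hasDerivAt : ∀ ξ < 0, U ξ = R ξ → HasDerivAt (fun η => flux p (U η) - η • U η) (-U ξ) ξ
  bounded : ∃ M, ∀ ξ < 0, ‖U ξ‖ ≤ M
  integrable : IntegrableOn (fun ξ => U ξ - ul) (Iio 0)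

namespace IsFan

variable {p : ℝ → ℝ} {ul : ℝ × ℝ} {U R : ℝ → ℝ × ℝ}

theorem continuousAt (hU : IsFan p ul U R) {ξ : ℝ} (hξ : ξ < 0) (h : U ξ = R ξ) :
    ContinuousAt U ξ := by
  refine continuousAt_iff_continuous_left'_right'.2 ⟨hU.left_lim ξ hξ, ?_⟩
  have := hU.right_lim ξ hξ
  rwa [← h] at this

/-- The second characteristic speed is nonnegative at weakly subsonic states, so it cannot equal a
negative `ξ`. Only the first family can make the equation degenerate. -/
theorem sq_ne (hp : PressureLaw p) (hU : IsFan p ul U R) {ξ : ℝ} (hξ : ξ < 0)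
    (hc : charSpeed p 0 (U ξ) ≠ ξ) : ((U ξ).2 / (U ξ).1 - ξ) ^ 2 ≠ deriv p (U ξ).1 := by
  intro h
  have hm := hU.left_mem ξ hξ
  have hv := (abs_le.1 (abs_velocity_le hm)).1
  have h2 : (U ξ).2 / (U ξ).1 - ξ = √(deriv p (U ξ).1) ∨
      (U ξ).2 / (U ξ).1 - ξ = -√(deriv p (U ξ).1) := by
    rw [← hp.sq_sqrt_deriv hm.1] at h
    exact sq_eq_sq_iff_eq_or_eq_neg.1 h
  rcases h2 with h2 | h2
  · exact hc (by simp only [charSpeed, if_true]; linarith)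
  · linarith

/-- With `ξ` frozen, `Φ = flux - ξ` has an injective derivative at `U ξ`, hence `Φ (U η) - Φ (U ξ)`
has the same order of magnitude as `U η - U ξ`. The equation says that the former is `o(η - ξ)`. -/
theorem hasDerivAt_zero (hp : PressureLaw p) (hU : IsFan p ul U R) {ξ : ℝ} (hξ : ξ < 0)
    (h : U ξ = R ξ) (hc : charSpeed p 0 (U ξ) ≠ ξ) : HasDerivAt U 0 ξ := by
  have hcont := hU.continuousAt hξ h
  have hm := hU.left_mem ξ hξ
  set Φ : ℝ × ℝ → ℝ × ℝ := fun u => flux p u - ξ • u with hΦ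
  set A : ℝ × ℝ →L[ℝ] ℝ × ℝ := fluxDeriv p (U ξ) - ξ • ContinuousLinearMap.id ℝ (ℝ × ℝ) with hA
  have hΦd : HasFDerivAt Φ A (U ξ) :=
    (hasFDerivAt_flux hp hm.1).sub ((hasFDerivAt_id (U ξ)).const_smul ξ)
  have hker : (A : ℝ × ℝ →ₗ[ℝ] ℝ × ℝ).ker = ⊥ := by
    rw [LinearMap.ker_eq_bot']
    intro V hV
    have hV' : fluxDeriv p (U ξ) V - ξ • V = 0 := by simpa [hA] using hV
    exact fluxDeriv_injective (hU.sq_ne hp hξ hc) (sub_eq_zero.1 hV')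
  obtain ⟨K, -, hK⟩ := LinearMap.exists_antilipschitzWith _ hker
  have hrev := ((HasFDerivAt.isTheta_sub hΦd (hK.isInducing A.continuous)).2).comp_tendsto hcont
  -- The factor `η - ξ` vanishes at `ξ`, so continuity of `U` suffices for this derivative.
  have hslope : HasDerivAt (fun η => (η - ξ) • U η) (U ξ) ξ := by
    rw [hasDerivAt_iff_tendsto_slope]
    refine (hcont.tendsto.mono_left nhdsWithin_le_nhds).congr' ?_
    filter_upwards [self_mem_nhdsWithin] with η hη
    have : η - ξ ≠ 0 := sub_ne_zero.2 hη
    simp [slope, smul_smul, this]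
  have hcomp : HasDerivAt (fun η => Φ (U η)) 0 ξ := by
    refine (((hU.hasDerivAt ξ hξ h).add hslope).congr_deriv (by simp)).congr_of_eventuallyEq ?_
    refine Eventually.of_forall fun η => ?_
    simp only [hΦ, Pi.add_apply]
    module
  rw [hasDerivAt_iff_isLittleO] at hcomp ⊢
  simp only [smul_zero, sub_zero] at hcomp ⊢
  exact hrev.trans_isLittleO hcomp

theorem eqOn_of_noncharacteristic (hp : PressureLaw p) (hU : IsFan p ul U R) {α β : ℝ}
    (hβ : β ≤ 0) (h : ∀ ξ ∈ Ioo α β, U ξ = R ξ ∧ charSpeed p 0 (U ξ) ≠ ξ) {ξ η : ℝ}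
    (hξ : ξ ∈ Ioo α β) (hη : η ∈ Ioo α β) : U ξ = U η := by
  have hd : ∀ ζ ∈ Ioo α β, HasDerivAt U 0 ζ := fun ζ hζ =>
    hU.hasDerivAt_zero hp (hζ.2.trans_le hβ) (h ζ hζ).1 (h ζ hζ).2
  exact isOpen_Ioo.is_const_of_deriv_eq_zero isPreconnected_Ioo
    (fun ζ hζ => (hd ζ hζ).differentiableAt.differentiableWithinAt)
    (fun ζ hζ => (hd ζ hζ).deriv) hξ hη

theorem right_eq_of_eventually (hU : IsFan p ul U R) {ξ : ℝ} {u : ℝ × ℝ} (hξ : ξ < 0)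
    (h : ∀ᶠ η in 𝓝[>] ξ, U η = u) : R ξ = u :=
  tendsto_nhds_unique (hU.right_lim ξ hξ) (tendsto_const_nhds.congr' (h.mono fun _ h => h.symm))

theorem left_eq_of_eventually (hU : IsFan p ul U R) {ξ : ℝ} {u : ℝ × ℝ} (hξ : ξ < 0)
    (h : ∀ᶠ η in 𝓝[<] ξ, U η = u) : U ξ = u :=
  tendsto_nhds_unique (hU.left_lim ξ hξ) (tendsto_const_nhds.congr' (h.mono fun _ h => h.symm))

theorem right_le_charSpeed (hp : PressureLaw p) (hU : IsFan p ul U R) {ξ : ℝ} (hξ : ξ < 0)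
    (h : ∃ᶠ η in 𝓝[>] ξ, η ≤ charSpeed p 0 (U η)) : ξ ≤ charSpeed p 0 (R ξ) := by
  by_contra hcon
  rw [not_le] at hcon
  have h1 := ((continuousAt_charSpeed hp (hU.right_mem ξ hξ).1).tendsto.comp
    (hU.right_lim ξ hξ)).eventually (eventually_lt_nhds hcon)
  refine h ?_
  filter_upwards [h1, self_mem_nhdsWithin] with η h1 h2
  simp only [mem_Ioi, Function.comp_apply] at h1 h2
  linarith

/-- By continuity the speeds slightly to the left of `ξ` still exceed `ξ`. So there are no sonic
points there, and no Lax shocks either, since the right state of a shock is slower than the shock.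
-/
theorem eventually_left_eq (hp : PressureLaw p) (hU : IsFan p ul U R) {ξ : ℝ} (hξ : ξ < 0)
    (h : ξ < charSpeed p 0 (U ξ)) : ∀ᶠ η in 𝓝[<] ξ, U η = U ξ := by
  have h1 : ∀ᶠ η in 𝓝[<] ξ, ξ < charSpeed p 0 (U η) :=
    ((continuousAt_charSpeed hp (hU.left_mem ξ hξ).1).tendsto.comp (hU.left_lim ξ hξ)).eventually
      (eventually_gt_nhds h)
  obtain ⟨α, hα, hs⟩ := mem_nhdsLT_iff_exists_Ioo_subset.1 h1
  have hs' : ∀ η ∈ Ioo α ξ, ξ < charSpeed p 0 (U η) := fun η hη => hs hη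
  have hno : ∀ η ∈ Ioo α ξ, U η = R η ∧ charSpeed p 0 (U η) ≠ η := by
    intro η hη
    refine ⟨(hU.jump η (hη.2.trans hξ)).resolve_right fun hj => ?_, ?_⟩
    · refine not_lt.2 (hU.right_le_charSpeed hp (hη.2.trans hξ) ?_) hj.2.1
      refine Eventually.frequently ?_
      filter_upwards [Ioo_mem_nhdsGT hη.2] with ζ hζ
      exact (hζ.2.trans (hs' ζ ⟨hη.1.trans hζ.1, hζ.2⟩)).le
    · exact (hη.2.trans (hs' η hη)).ne'
  have hc : ∀ η ∈ Ioo α ξ, U ξ = U η := fun η hη =>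
    hU.left_eq_of_eventually hξ (by
      filter_upwards [Ioo_mem_nhdsLT hα] with ζ hζ
      exact hU.eqOn_of_noncharacteristic hp hξ.le hno hζ hη)
  filter_upwards [Ioo_mem_nhdsLT hα] with η hη
  exact (hc η hη).symm

/-- The mirror image of `eventually_left_eq`: slightly to the right of `ξ` all states are too slow
to be sonic or to be the left state of a Lax shock. -/
theorem eventually_right_eq (hp : PressureLaw p) (hU : IsFan p ul U R) {ξ : ℝ} (hξ : ξ < 0)
    (h : charSpeed p 0 (R ξ) < ξ) : ∀ᶠ η in 𝓝[>] ξ, U η = R ξ := by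
  have h1 : ∀ᶠ η in 𝓝[>] ξ, charSpeed p 0 (U η) < ξ :=
    ((continuousAt_charSpeed hp (hU.right_mem ξ hξ).1).tendsto.comp
      (hU.right_lim ξ hξ)).eventually (eventually_lt_nhds h)
  obtain ⟨β, hβ, hs⟩ := mem_nhdsGT_iff_exists_Ioo_subset.1
    (inter_mem h1 (Ioo_mem_nhdsGT hξ))
  have hs' : ∀ η ∈ Ioo ξ β, charSpeed p 0 (U η) < ξ ∧ η < 0 := fun η hη =>
    ⟨(hs hη).1, (hs hη).2.2⟩
  have hβ0 : β ≤ 0 := by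
    by_contra hcon
    have := (hs' 0 ⟨hξ, not_le.1 hcon⟩).2
    exact lt_irrefl _ this
  have hno : ∀ η ∈ Ioo ξ β, U η = R η ∧ charSpeed p 0 (U η) ≠ η := by
    intro η hη
    have := (hs' η hη).1.trans hη.1
    exact ⟨(hU.jump η (hs' η hη).2).resolve_right fun hj => lt_asymm this hj.2.2, this.ne⟩
  have hc : ∀ η ∈ Ioo ξ β, R ξ = U η := fun η hη =>
    hU.right_eq_of_eventually hξ (by
      filter_upwards [Ioo_mem_nhdsGT hβ] with ζ hζ
      exact hU.eqOn_of_noncharacteristic hp hβ0 hno hζ hη)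
  filter_upwards [Ioo_mem_nhdsGT hβ] with η hη
  exact (hc η hη).symm

/-- A state which is faster than its position persists to the left. -/
theorem eq_left (hp : PressureLaw p) (hU : IsFan p ul U R) {ξ : ℝ} (hξ : ξ < 0)
    (h : ξ < charSpeed p 0 (U ξ)) {η : ℝ} (hη : η < ξ) : U η = U ξ := by
  set S : Set ℝ := {η | η < ξ ∧ ∀ ζ ∈ Ioo η ξ, U ζ = U ξ} with hS
  obtain ⟨α, hα, hs⟩ := mem_nhdsLT_iff_exists_Ioo_subset.1 (hU.eventually_left_eq hp hξ h)
  have hαS : α ∈ S := ⟨hα, fun ζ hζ => hs hζ⟩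
  by_contra hcon
  have hbdd : BddBelow S := ⟨η, fun s hsS => by
    by_contra hlt
    exact hcon (hsS.2 η ⟨not_le.1 hlt, hη⟩)⟩
  set a := sInf S with ha
  have haα : a ≤ α := csInf_le hbdd hαS
  have haξ : a < ξ := haα.trans_lt hα
  have hconst : ∀ ζ ∈ Ioo a ξ, U ζ = U ξ := by
    intro ζ hζ
    obtain ⟨s, hsS, hsζ⟩ := exists_lt_of_csInf_lt ⟨α, hαS⟩ hζ.1
    exact hsS.2 ζ ⟨hsζ, hζ.2⟩
  have ha0 := haξ.trans hξ
  have hRa : R a = U ξ := hU.right_eq_of_eventually ha0 (by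
    filter_upwards [Ioo_mem_nhdsGT haξ] with ζ hζ using hconst ζ hζ)
  -- At the end of the interval of constancy the right limit is faster than its position, which no
  -- right state of a Lax shock is. So there is no jump, and constancy extends beyond `a`.
  have hLa : U a = U ξ := by
    rcases hU.jump a ha0 with hj | hj
    · rw [hj, hRa]
    · rw [hRa] at hj
      linarith [hj.2.1]
  obtain ⟨α', hα', hs'⟩ := mem_nhdsLT_iff_exists_Ioo_subset.1
    (hU.eventually_left_eq hp ha0 (by rw [hLa]; linarith))
  have : α' ∈ S := by
    refine ⟨lt_trans hα' haξ, fun ζ hζ => ?_⟩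
    rcases lt_trichotomy ζ a with hlt | heq | hgt
    · have : U ζ = U a := hs' ⟨hζ.1, hlt⟩
      rw [this, hLa]
    · rw [heq, hLa]
    · exact hconst ζ ⟨hgt, hζ.2⟩
  exact absurd (csInf_le hbdd this) (not_le.2 hα')

/-- A state which is slower than its position persists to the right. -/
theorem eq_right (hp : PressureLaw p) (hU : IsFan p ul U R) {ξ : ℝ} (hξ : ξ < 0)
    (h : charSpeed p 0 (R ξ) < ξ) {η : ℝ} (hη : ξ < η) (hη0 : η < 0) : U η = R ξ := by
  set S : Set ℝ := {η | ξ < η ∧ η ≤ 0 ∧ ∀ ζ ∈ Ioo ξ η, U ζ = R ξ} with hS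
  obtain ⟨α₀, hα₀, hs₀⟩ := mem_nhdsGT_iff_exists_Ioo_subset.1 (hU.eventually_right_eq hp hξ h)
  by_contra hcon
  have hbdd' : ∀ s ∈ S, s ≤ η := fun s hsS => by
    by_contra hlt
    exact hcon (hsS.2.2 η ⟨hη, not_le.1 hlt⟩)
  have hbdd : BddAbove S := ⟨η, hbdd'⟩
  have hαS : min α₀ 0 ∈ S := ⟨lt_min hα₀ hξ, min_le_right _ _, fun ζ hζ =>
    hs₀ ⟨hζ.1, hζ.2.trans_le (min_le_left _ _)⟩⟩
  set a := sSup S with ha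
  have haη : a ≤ η := csSup_le ⟨_, hαS⟩ hbdd'
  have haξ : ξ < a := hαS.1.trans_le (le_csSup hbdd hαS)
  have hconst : ∀ ζ ∈ Ioo ξ a, U ζ = R ξ := by
    intro ζ hζ
    obtain ⟨s, hsS, hsζ⟩ := exists_lt_of_lt_csSup ⟨_, hαS⟩ hζ.2
    exact hsS.2.2 ζ ⟨hζ.1, hsζ⟩
  have ha0 := haη.trans_lt hη0
  have hLa : U a = R ξ := hU.left_eq_of_eventually ha0 (by
    filter_upwards [Ioo_mem_nhdsLT haξ] with ζ hζ using hconst ζ hζ)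
  have hRa : R a = R ξ := by
    rcases hU.jump a ha0 with hj | hj
    · rw [← hj, hLa]
    · rw [hLa] at hj
      linarith [hj.2.2]
  obtain ⟨α', hα', hs'⟩ := mem_nhdsGT_iff_exists_Ioo_subset.1
    (hU.eventually_right_eq hp ha0 (by rw [hRa]; linarith))
  have : min α' 0 ∈ S := by
    refine ⟨haξ.trans (lt_min hα' ha0), min_le_right _ _, fun ζ hζ => ?_⟩
    rcases lt_trichotomy ζ a with hlt | heq | hgt
    · exact hconst ζ ⟨hζ.1, hlt⟩
    · rw [heq, hLa]
    · have : U ζ = R a := hs' ⟨hgt, hζ.2.trans_le (min_le_left _ _)⟩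
      rw [this, hRa]
  exact absurd (le_csSup hbdd this) (not_le.2 (lt_min hα' ha0))

end IsFan

/-! ### Fans are single shocks or single rarefactions -/

theorem PressureLaw.convexOn {p : ℝ → ℝ} (hp : PressureLaw p) : ConvexOn ℝ (Ioi 0) p := by
  refine MonotoneOn.convexOn_of_deriv (convex_Ioi 0) hp.continuousOn ?_ ?_
  · intro x hx
    rw [interior_Ioi] at hx
    exact (hp.hasDerivAt hx).differentiableAt.differentiableWithinAt
  · rw [interior_Ioi]
    exact hp.monotoneOn_deriv

theorem PressureLaw.secant_le {p : ℝ → ℝ} (hp : PressureLaw p) {a b c : ℝ} (ha : 0 < a)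
    (hab : a < b) (hbc : b ≤ c) : (p b - p a) / (b - a) ≤ (p c - p a) / (c - a) :=
  hp.convexOn.secant_mono (mem_Ioi.2 ha) (mem_Ioi.2 (ha.trans hab))
    (mem_Ioi.2 (ha.trans (hab.trans_le hbc))) hab.ne' (hab.trans_le hbc).ne' hbc

/-- A fan consisting of a single shock of speed `s` with right state `um`. -/
structure IsShockFan (p : ℝ → ℝ) (ul : ℝ × ℝ) (U : ℝ → ℝ × ℝ) (um : ℝ × ℝ) (s : ℝ) : Prop where
  speed_neg : s < 0
  speed_lt : s < charSpeed p 0 ul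
  density_lt : ul.1 < um.1
  rankineHugoniot : flux p um - flux p ul = s • (um - ul)
  left_eq : ∀ ξ ≤ s, U ξ = ul
  right_eq : ∀ ξ, s < ξ → ξ < 0 → U ξ = um

/-- A fan consisting of a continuous wave, sonic in `[a, b]` and constant elsewhere. -/
structure IsRarefactionFan (p : ℝ → ℝ) (ul : ℝ × ℝ) (U R : ℝ → ℝ × ℝ) (a b : ℝ) : Prop where
  speed_eq : a = charSpeed p 0 ul
  speed_neg : a < 0
  le : a ≤ b
  end_nonpos : b ≤ 0
  left_eq : ∀ ξ ≤ a, U ξ = ul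
  continuous : ∀ ξ ∈ Icc a b, ξ < 0 → U ξ = R ξ
  sonic : ∀ ξ ∈ Icc a b, ξ < 0 → charSpeed p 0 (U ξ) = ξ
  right_eq : ∀ ξ, b < ξ → ξ < 0 → U ξ = U b

namespace IsFan

variable {p : ℝ → ℝ} {ul : ℝ × ℝ} {U R : ℝ → ℝ × ℝ}

/-- Bounded densities bound the characteristic speeds from below, so far to the left every state is
faster than its position and the fan is constant there. The constant is `ul` because the difference
is integrable on a half line of infinite length. -/
theorem exists_fast_eq (hp : PressureLaw p) (hU : IsFan p ul U R) :
    ∃ N < 0, N < charSpeed p 0 (U N) ∧ ∀ ξ ≤ N, U ξ = ul := by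
  obtain ⟨M, hM⟩ := hU.bounded
  -- A bound for the sound speed, and thereby for `|v|`; the maximum with `1` keeps the density
  -- positive.
  set Λ := √(deriv p (max M 1)) with hΛ
  have hΛ0 : 0 ≤ Λ := Real.sqrt_nonneg _
  have hspeed : ∀ ξ < 0, -2 * Λ ≤ charSpeed p 0 (U ξ) := by
    intro ξ hξ
    have hm := hU.left_mem ξ hξ
    have h1 := (abs_le.1 (abs_velocity_le hm)).1
    have h2 : (U ξ).1 ≤ max M 1 :=
      ((le_abs_self _).trans ((norm_fst_le (U ξ)).trans (hM ξ hξ))).trans (le_max_left _ _)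
    have h3 := hp.sqrt_deriv_le hm.1 h2
    simp only [charSpeed, if_true]
    linarith
  set N := -2 * Λ - 1 with hN
  have hN0 : N < 0 := by linarith
  have hNs : N < charSpeed p 0 (U N) := lt_of_lt_of_le (by linarith) (hspeed N hN0)
  have hconst : ∀ ξ ≤ N, U ξ = U N := fun ξ hξ => by
    rcases hξ.lt_or_eq with h | h
    · exact hU.eq_left hp hN0 hNs h
    · rw [h]
  have hint : IntegrableOn (fun _ : ℝ => U N - ul) (Iio N) := by
    refine (hU.integrable.mono_set (Iio_subset_Iio hN0.le)).congr_fun ?_ measurableSet_Iio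
    intro ξ hξ
    simp only [hconst ξ (le_of_lt hξ)]
  have : U N - ul = 0 := by
    rcases (integrableOn_const_iff (by finiteness)).1 hint with h | h
    · exact enorm_eq_zero.1 h
    · simp at h
  exact ⟨N, hN0, hNs, fun ξ hξ => by rw [hconst ξ hξ]; exact sub_eq_zero.1 this⟩

/-- Let `a` be the supremum of the positions at which the state is faster than its position; up to
`a` the fan equals `ul`. A jump at `a` is a Lax shock, whose right state is slower than its position
and persists up to `0`. Without a jump at `a` the fan becomes sonic, remains sonic up to some `b`,
and is constant afterwards. The trivial wave is the case `a = b`. -/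
theorem classification (hp : PressureLaw p) (hul : ul ∈ subsonic p) (hU : IsFan p ul U R) :
    (∃ um s, IsShockFan p ul U um s) ∨ ∃ b, IsRarefactionFan p ul U R (charSpeed p 0 ul) b := by
  obtain ⟨N, hN0, hNs, hN⟩ := hU.exists_fast_eq hp
  have hl0 := charSpeed_zero_neg hul
  set A : Set ℝ := {ξ | ξ < 0 ∧ ξ < charSpeed p 0 (U ξ)} with hA
  have hAul : ∀ ξ ∈ A, U ξ = ul := by
    intro ξ hξ
    have hlt : min N ξ - 1 < ξ := by linarith [min_le_right N ξ]
    rw [← hU.eq_left hp hξ.1 hξ.2 hlt]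
    exact hN _ (by linarith [min_le_left N ξ])
  have hAne : A.Nonempty := ⟨N, hN0, hNs⟩
  have hAle : ∀ ξ ∈ A, ξ ≤ charSpeed p 0 ul := fun ξ hξ => by
    have := hξ.2
    rw [hAul ξ hξ] at this
    exact this.le
  have hAb : BddAbove A := ⟨_, hAle⟩
  set a := sSup A with ha
  have hal : a ≤ charSpeed p 0 ul := csSup_le hAne hAle
  have ha0 : a < 0 := hal.trans_lt hl0
  have hlt : ∀ ξ < a, U ξ = ul := by
    intro ξ hξ
    obtain ⟨ζ, hζ, hξζ⟩ := exists_lt_of_lt_csSup hAne hξ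
    rw [hU.eq_left hp hζ.1 hζ.2 hξζ, hAul ζ hζ]
  have hUa : U a = ul := hU.left_eq_of_eventually ha0 (by
    filter_upwards [self_mem_nhdsWithin] with ζ hζ using hlt ζ hζ)
  have hle : ∀ ξ ≤ a, U ξ = ul := fun ξ hξ => by
    rcases hξ.lt_or_eq with h | h
    · exact hlt ξ h
    · rw [h, hUa]
  have hnA : ∀ ξ, a < ξ → ξ < 0 → charSpeed p 0 (U ξ) ≤ ξ := fun ξ h1 h2 => by
    by_contra hcon
    exact absurd (le_csSup hAb (show ξ ∈ A from ⟨h2, not_le.1 hcon⟩)) (not_le.2 h1)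
  rcases hU.jump a ha0 with hj | hj
  swap
  · left
    refine ⟨R a, a, ha0, ?_, ?_, ?_, hle, fun ξ h1 h2 => hU.eq_right hp ha0 hj.2.1 h1 h2⟩
    · rw [← hUa]; exact hj.2.2
    · rw [← hUa]; exact hj.1
    · have := hU.rankineHugoniot a ha0
      rwa [hUa] at this
  right
  -- If `a` were smaller than the speed of `ul`, continuity from the right would produce positions
  -- beyond `a` at which the state is still faster than its position.
  have haeq : a = charSpeed p 0 ul := by
    refine hal.antisymm (not_lt.1 fun hcon => ?_)
    obtain ⟨c, hac, hc⟩ := exists_between hcon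
    have hRa : R a = ul := by rw [← hj, hUa]
    have h1 : ∀ᶠ η in 𝓝[>] a, c < charSpeed p 0 (U η) := by
      refine ((continuousAt_charSpeed hp (hU.right_mem a ha0).1).tendsto.comp
        (hU.right_lim a ha0)).eventually (eventually_gt_nhds ?_)
      rwa [hRa]
    obtain ⟨η, hη1, hη2⟩ := (h1.and (Ioo_mem_nhdsGT (lt_min hac ha0))).exists
    have := hnA η hη2.1 (hη2.2.trans_le (min_le_right _ _))
    linarith [hη2.2.trans_le (min_le_left c 0)]
  rw [← haeq]
  -- Adjoining `0` makes `b = 0` when the rarefaction extends up to the kink without ending before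
  -- it.
  set B : Set ℝ := {ξ | a ≤ ξ ∧ ξ < 0 ∧ charSpeed p 0 (R ξ) < ξ} ∪ {0} with hB
  have hBb : BddBelow B := ⟨a, by
    rintro ξ (h | h)
    · exact h.1
    · rw [mem_singleton_iff.1 h]; exact ha0.le⟩
  have hBne : B.Nonempty := ⟨0, Or.inr rfl⟩
  set b := sInf B with hb
  have hab : a ≤ b := le_csInf hBne (by
    rintro ξ (h | h)
    · exact h.1
    · rw [mem_singleton_iff.1 h]; exact ha0.le)
  have hb0 : b ≤ 0 := csInf_le hBb (Or.inr rfl)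
  have hIco : ∀ ξ, a ≤ ξ → ξ < b → U ξ = R ξ ∧ charSpeed p 0 (U ξ) = ξ := by
    intro ξ h1 h2
    have h0 := h2.trans_le hb0
    have hnB : ξ ≤ charSpeed p 0 (R ξ) := by
      by_contra hcon
      exact absurd (csInf_le hBb (show ξ ∈ B from Or.inl ⟨h1, h0, not_le.1 hcon⟩)) (not_le.2 h2)
    have heq : U ξ = R ξ := (hU.jump ξ h0).resolve_right fun h => not_lt.2 hnB h.2.1
    refine ⟨heq, le_antisymm ?_ (heq ▸ hnB)⟩
    rcases h1.eq_or_lt with h | h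
    · rw [← h, hUa, haeq]
    · exact hnA ξ h h0
  have hUb : b < 0 → U b = R b := fun h => by
    rcases hab.eq_or_lt with h1 | h1
    · rw [← h1]; exact hj
    · exact (hU.jump b h).resolve_right fun h' => not_lt.2 (hnA b h1 h) h'.2.2
  have hsb : b < 0 → charSpeed p 0 (U b) = b := fun h => by
    rcases hab.eq_or_lt with h1 | h1
    · rw [← h1, hUa, haeq]
    · refine le_antisymm (hnA b h1 h) (not_lt.1 fun hcon => ?_)
      obtain ⟨c, hc1, hc2⟩ := exists_between hcon
      have h2 : ∀ᶠ η in 𝓝[<] b, charSpeed p 0 (U η) < c :=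
        ((continuousAt_charSpeed hp (hU.left_mem b h).1).tendsto.comp
          (hU.left_lim b h)).eventually (eventually_lt_nhds hc1)
      obtain ⟨η, hη1, hη2⟩ := (h2.and (Ioo_mem_nhdsLT (max_lt h1 hc2))).exists
      have h3 := (hIco η ((le_max_left _ _).trans hη2.1.le) hη2.2).2
      linarith [(le_max_right a c).trans_lt hη2.1]
  have hIcc : ∀ ξ ∈ Icc a b, ξ < 0 → U ξ = R ξ ∧ charSpeed p 0 (U ξ) = ξ := by
    intro ξ h1 h2
    rcases h1.2.lt_or_eq with h | h
    · exact hIco ξ h1.1 h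
    · rw [h] at h2 ⊢
      exact ⟨hUb h2, hsb h2⟩
  refine ⟨b, haeq, ha0, hab, hb0, hle, fun ξ h1 h2 => (hIcc ξ h1 h2).1,
    fun ξ h1 h2 => (hIcc ξ h1 h2).2, fun ξ h1 h2 => ?_⟩
  have hb1 : b < 0 := h1.trans h2
  rw [hUb hb1]
  symm
  refine hU.right_eq_of_eventually hb1 ?_
  filter_upwards [Ioo_mem_nhdsGT h1] with η hη
  obtain ⟨ζ, hζ, hζη⟩ := exists_lt_of_csInf_lt hBne hη.1
  rcases hζ with hζ | hζ
  · rw [hU.eq_right hp hζ.2.1 hζ.2.2 hζη (hη.2.trans h2),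
      hU.eq_right hp hζ.2.1 hζ.2.2 (hζη.trans hη.2) h2]
  · rw [mem_singleton_iff.1 hζ] at hζη
    linarith [hη.2]

theorem hasDerivAt_relFlux (hU : IsFan p ul U R) {ξ : ℝ} (hξ : ξ < 0) (h : U ξ = R ξ) :
    HasDerivAt (fun η => (U η).2 - η * (U η).1) (-(U ξ).1) ξ ∧
      HasDerivAt (fun η => dynPressure p (U η) - η * (U η).2) (-(U ξ).2) ξ := by
  have := hU.hasDerivAt ξ hξ h
  exact ⟨(ContinuousLinearMap.fst ℝ ℝ ℝ).hasFDerivAt.comp_hasDerivAt ξ this,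
    (ContinuousLinearMap.snd ℝ ℝ ℝ).hasFDerivAt.comp_hasDerivAt ξ this⟩

end IsFan

/-! ### Order of the traces of fans at the kink -/

theorem mul_sqrt_deriv_lt {p : ℝ → ℝ} (hp : PressureLaw p) {u : ℝ × ℝ}
    (hu : u ∈ weaklySubsonic p) {r : ℝ} (hr : u.1 < r) :
    u.1 * √(deriv p u.1) < r * √(deriv p r) := by
  have h1 := hp.sqrt_deriv_le hu.1 hr.le
  have h2 : 0 < √(deriv p r) := Real.sqrt_pos.2 (hu.2.2 r hr)
  calc u.1 * √(deriv p u.1) ≤ u.1 * √(deriv p r) := mul_le_mul_of_nonneg_left h1 hu.1.le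
    _ < r * √(deriv p r) := mul_lt_mul_of_pos_right hr h2

theorem mul_sqrt_deriv_le {p : ℝ → ℝ} (hp : PressureLaw p) {a b : ℝ} (ha : 0 < a) (hab : a ≤ b) :
    a * √(deriv p a) ≤ b * √(deriv p b) :=
  mul_le_mul hab (hp.sqrt_deriv_le ha hab) (Real.sqrt_nonneg _) (ha.le.trans hab)

/-- At sonic states the relative mass flux is a nondecreasing function of the density alone. This
turns the equation for `q - ξ ρ` into information on `ρ` without differentiating the profile. -/
theorem relFlux_of_sonic {p : ℝ → ℝ} {u : ℝ × ℝ} {ξ : ℝ} (hu : 0 < u.1)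
    (h : charSpeed p 0 u = ξ) : u.2 - ξ * u.1 = u.1 * √(deriv p u.1) := by
  simp only [charSpeed, if_true] at h
  rw [← h]
  field_simp
  ring

namespace IsRarefactionFan

variable {p : ℝ → ℝ} {ul : ℝ × ℝ} {U R : ℝ → ℝ × ℝ} {a b : ℝ}

/-- The relative mass flux has derivative `-ρ < 0`, and on the sonic range it equals `ρ √p'(ρ)`,
which is nondecreasing in `ρ`. -/
theorem density_lt (hp : PressureLaw p) (hU : IsFan p ul U R) (hr : IsRarefactionFan p ul U R a b)
    {ξ η : ℝ} (hξ : a ≤ ξ) (hξη : ξ < η) (hη : η ≤ b) (hη0 : η < 0) : (U η).1 < (U ξ).1 := by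
  have hd : ∀ ζ ∈ Icc ξ η, HasDerivAt (fun η => (U η).2 - η * (U η).1) (-(U ζ).1) ζ := fun ζ hζ =>
    have h0 := hζ.2.trans_lt hη0
    (hU.hasDerivAt_relFlux h0 (hr.continuous ζ ⟨hξ.trans hζ.1, hζ.2.trans hη⟩ h0)).1
  have hm : StrictAntiOn (fun η => (U η).2 - η * (U η).1) (Icc ξ η) := by
    refine strictAntiOn_of_deriv_neg (convex_Icc _ _)
      (fun ζ hζ => (hd ζ hζ).continuousAt.continuousWithinAt) fun ζ hζ => ?_
    rw [interior_Icc] at hζ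
    rw [(hd ζ (Ioo_subset_Icc_self hζ)).deriv, neg_lt_zero]
    exact (hU.left_mem ζ (hζ.2.trans hη0)).1
  have hlt := hm (left_mem_Icc.2 hξη.le) (right_mem_Icc.2 hξη.le) hξη
  have h0 := hξη.trans hη0
  have mξ := hU.left_mem ξ h0
  have mη := hU.left_mem η hη0
  simp only at hlt
  rw [relFlux_of_sonic mη.1 (hr.sonic η ⟨hξ.trans hξη.le, hη⟩ hη0),
    relFlux_of_sonic mξ.1 (hr.sonic ξ ⟨hξ, hξη.le.trans hη⟩ h0)] at hlt
  by_contra hcon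
  exact absurd hlt (not_lt.2 (mul_sqrt_deriv_le hp mξ.1 (not_lt.1 hcon)))

/-- The mean value theorem for `q - ξ ρ` yields, with some `ζ` between, `q(η) - q(ξ) = (ρ(ξ) - ρ(ζ))
(η - ξ) + η (ρ(η) - ρ(ξ))`. Both terms are positive, because the density decreases and `η < 0`. -/
theorem momentum_lt (hp : PressureLaw p) (hU : IsFan p ul U R) (hr : IsRarefactionFan p ul U R a b)
    {ξ η : ℝ} (hξ : a ≤ ξ) (hξη : ξ < η) (hη : η ≤ b) (hη0 : η < 0) : (U ξ).2 < (U η).2 := by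
  have hd : ∀ ζ ∈ Icc ξ η, HasDerivAt (fun η => (U η).2 - η * (U η).1) (-(U ζ).1) ζ := fun ζ hζ =>
    have h0 := hζ.2.trans_lt hη0
    (hU.hasDerivAt_relFlux h0 (hr.continuous ζ ⟨hξ.trans hζ.1, hζ.2.trans hη⟩ h0)).1
  obtain ⟨ζ, hζ, he⟩ := exists_hasDerivAt_eq_slope (fun η => (U η).2 - η * (U η).1)
    (fun ζ => -(U ζ).1) hξη (fun ζ hζ => (hd ζ hζ).continuousAt.continuousWithinAt)
    fun ζ hζ => hd ζ (Ioo_subset_Icc_self hζ)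
  have h1 := hr.density_lt hp hU hξ hζ.1 (hζ.2.le.trans hη) (hζ.2.trans hη0)
  have h2 := hr.density_lt hp hU hξ hξη hη hη0
  rw [eq_div_iff (sub_pos.2 hξη).ne'] at he
  nlinarith [mul_pos (sub_pos.2 h1) (sub_pos.2 hξη), mul_pos (sub_pos.2 h2) (neg_pos.2 hη0)]

/-- The argument of `momentum_lt` one step up: the increase of `q` now plays the role of the
decrease of `ρ`. -/
theorem dynPressure_lt (hp : PressureLaw p) (hU : IsFan p ul U R)
    (hr : IsRarefactionFan p ul U R a b) {ξ η : ℝ} (hξ : a ≤ ξ) (hξη : ξ < η) (hη : η ≤ b)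
    (hη0 : η < 0) : dynPressure p (U η) < dynPressure p (U ξ) := by
  have hd : ∀ ζ ∈ Icc ξ η,
      HasDerivAt (fun η => dynPressure p (U η) - η * (U η).2) (-(U ζ).2) ζ := fun ζ hζ =>
    have h0 := hζ.2.trans_lt hη0
    (hU.hasDerivAt_relFlux h0 (hr.continuous ζ ⟨hξ.trans hζ.1, hζ.2.trans hη⟩ h0)).2
  obtain ⟨ζ, hζ, he⟩ := exists_hasDerivAt_eq_slope (fun η => dynPressure p (U η) - η * (U η).2)
    (fun ζ => -(U ζ).2) hξη (fun ζ hζ => (hd ζ hζ).continuousAt.continuousWithinAt)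
    fun ζ hζ => hd ζ (Ioo_subset_Icc_self hζ)
  have h1 := hr.momentum_lt hp hU hξ hζ.1 (hζ.2.le.trans hη) (hζ.2.trans hη0)
  have h2 := hr.momentum_lt hp hU hξ hξη hη hη0
  rw [eq_div_iff (sub_pos.2 hξη).ne'] at he
  nlinarith [mul_pos (sub_pos.2 h1) (sub_pos.2 hξη), mul_pos (sub_pos.2 h2) (neg_pos.2 hη0)]

/-- Two rarefaction fans with the same left state agree where both are sonic. -/
theorem eq_of_le {U' R' : ℝ → ℝ × ℝ} {b' : ℝ} (hp : PressureLaw p) (hU : IsFan p ul U R)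
    (hr : IsRarefactionFan p ul U R a b) (hU' : IsFan p ul U' R')
    (hr' : IsRarefactionFan p ul U' R' a b') {ξ : ℝ} (hb : ξ ≤ b) (hb' : ξ ≤ b') (h0 : ξ < 0) :
    U ξ = U' ξ := by
  rcases le_total ξ a with hξ | hξ
  · rw [hr.left_eq ξ hξ, hr'.left_eq ξ hξ]
  set D : ℝ → ℝ := fun η => ((U η).2 - η * (U η).1) - ((U' η).2 - η * (U' η).1) with hD
  have hd : ∀ ζ ∈ Icc a ξ, HasDerivAt D (-(U ζ).1 - -(U' ζ).1) ζ := fun ζ hζ =>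
    have hζ0 := hζ.2.trans_lt h0
    (hU.hasDerivAt_relFlux hζ0 (hr.continuous ζ ⟨hζ.1, hζ.2.trans hb⟩ hζ0)).1.sub
      (hU'.hasDerivAt_relFlux hζ0 (hr'.continuous ζ ⟨hζ.1, hζ.2.trans hb'⟩ hζ0)).1
  have hDe : ∀ ζ ∈ Icc a ξ, D ζ =
      (U ζ).1 * √(deriv p (U ζ).1) - (U' ζ).1 * √(deriv p (U' ζ).1) := fun ζ hζ => by
    have hζ0 := hζ.2.trans_lt h0
    simp only [hD]
    rw [relFlux_of_sonic (hU.left_mem ζ hζ0).1 (hr.sonic ζ ⟨hζ.1, hζ.2.trans hb⟩ hζ0),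
      relFlux_of_sonic (hU'.left_mem ζ hζ0).1 (hr'.sonic ζ ⟨hζ.1, hζ.2.trans hb'⟩ hζ0)]
  -- `D` is the difference of `ρ √p'(ρ)` for the two densities and `D'` is minus the difference of
  -- these densities. Since `ρ √p'(ρ)` is nondecreasing, `D D' ≤ 0`; as `D` vanishes at `a`, it
  -- vanishes throughout. This gives uniqueness without any Lipschitz condition.
  have hanti : AntitoneOn (fun ζ => D ζ ^ 2) (Icc a ξ) := by
    refine antitoneOn_of_deriv_nonpos (convex_Icc _ _)
      (fun ζ hζ => ((hd ζ hζ).pow 2).continuousAt.continuousWithinAt)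
      (fun ζ hζ => ((hd ζ (interior_subset hζ)).pow 2).differentiableAt.differentiableWithinAt)
      fun ζ hζ => ?_
    have hζ' := interior_subset hζ
    have hζ0 := hζ'.2.trans_lt h0
    have e : deriv (fun ζ => D ζ ^ 2) ζ = _ := ((hd ζ hζ').pow 2).deriv
    rw [e, hDe ζ hζ']
    simp only [Nat.cast_ofNat, Nat.add_one_sub_one, pow_one]
    rcases le_total (U ζ).1 (U' ζ).1 with h | h
    · have := mul_sqrt_deriv_le hp (hU.left_mem ζ hζ0).1 h
      nlinarith
    · have := mul_sqrt_deriv_le hp (hU'.left_mem ζ hζ0).1 h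
      nlinarith
  have hDa : D a = 0 := by
    simp only [hD, hr.left_eq a le_rfl, hr'.left_eq a le_rfl, sub_self]
  have hDξ : D ξ = 0 := by
    have := hanti (left_mem_Icc.2 hξ) (right_mem_Icc.2 hξ) hξ
    simp only [hDa] at this
    nlinarith [sq_nonneg (D ξ), sq_eq_zero_iff.1 (le_antisymm (by simpa using this) (sq_nonneg (D ξ)))]
  have h1 : (U ξ).1 = (U' ξ).1 := by
    have := hDe ξ (right_mem_Icc.2 hξ)
    rw [hDξ] at this
    rcases lt_trichotomy (U ξ).1 (U' ξ).1 with h | h | h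
    · linarith [mul_sqrt_deriv_lt hp (hU.left_mem ξ h0) h]
    · exact h
    · linarith [mul_sqrt_deriv_lt hp (hU'.left_mem ξ h0) h]
  refine Prod.ext h1 ?_
  simp only [hD, h1] at hDξ
  linarith

/-- Covers also `b = 0`, where no constant state precedes the kink and the traces are known only as
limits. An intermediate position `η` keeps the inequalities strict in the limit. -/
theorem trace_of_lt (hp : PressureLaw p) (hU : IsFan p ul U R) (hr : IsRarefactionFan p ul U R a b)
    {F : Filter ℝ} [F.NeBot] (hF : F ≤ 𝓝[<] 0) {q P : ℝ}
    (hq : Tendsto (fun ξ => (U ξ).2) F (𝓝 q)) (hP : Tendsto (fun ξ => dynPressure p (U ξ)) F (𝓝 P))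
    {ξ : ℝ} (hξ : a ≤ ξ) (hξb : ξ < b) : (U ξ).2 < q ∧ P < dynPressure p (U ξ) := by
  obtain ⟨η, h1, h2⟩ := exists_between hξb
  have hη0 : η < 0 := h2.trans_le hr.end_nonpos
  have hev : ∀ᶠ ζ in F, (U η).2 ≤ (U ζ).2 ∧ dynPressure p (U ζ) ≤ dynPressure p (U η) := by
    filter_upwards [hF (Ioo_mem_nhdsLT hη0)] with ζ hζ
    have key : ∀ θ, η < θ → θ ≤ b → θ < 0 →
        (U η).2 ≤ (U θ).2 ∧ dynPressure p (U θ) ≤ dynPressure p (U η) := fun θ h3 h4 h5 =>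
      ⟨(hr.momentum_lt hp hU (hξ.trans h1.le) h3 h4 h5).le,
        (hr.dynPressure_lt hp hU (hξ.trans h1.le) h3 h4 h5).le⟩
    rcases le_or_gt ζ b with h | h
    · exact key ζ hζ.1 h hζ.2
    · rw [hr.right_eq ζ h hζ.2]
      exact key b h2 le_rfl (h.trans hζ.2)
  exact ⟨(hr.momentum_lt hp hU hξ h1 h2.le hη0).trans_le
      (ge_of_tendsto hq (hev.mono fun _ h => h.1)),
    (le_of_tendsto hP (hev.mono fun _ h => h.2)).trans_lt
      (hr.dynPressure_lt hp hU hξ h1 h2.le hη0)⟩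

theorem trace_of_neg (hr : IsRarefactionFan p ul U R a b)
    {F : Filter ℝ} [F.NeBot] (hF : F ≤ 𝓝[<] 0) {q P : ℝ}
    (hq : Tendsto (fun ξ => (U ξ).2) F (𝓝 q)) (hP : Tendsto (fun ξ => dynPressure p (U ξ)) F (𝓝 P))
    (hb : b < 0) : q = (U b).2 ∧ P = dynPressure p (U b) := by
  have hev : ∀ᶠ ζ in F, U b = U ζ := by
    filter_upwards [hF (Ioo_mem_nhdsLT hb)] with ζ hζ using (hr.right_eq ζ hζ.1 hζ.2).symm
  exact ⟨tendsto_nhds_unique hq (tendsto_const_nhds.congr' (hev.mono fun _ h => by simp only [h])),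
    tendsto_nhds_unique hP (tendsto_const_nhds.congr' (hev.mono fun _ h => by simp only [h]))⟩

theorem le_trace (hp : PressureLaw p) (hU : IsFan p ul U R) (hr : IsRarefactionFan p ul U R a b)
    {F : Filter ℝ} [F.NeBot] (hF : F ≤ 𝓝[<] 0) {q P : ℝ}
    (hq : Tendsto (fun ξ => (U ξ).2) F (𝓝 q))
    (hP : Tendsto (fun ξ => dynPressure p (U ξ)) F (𝓝 P)) :
    ul.2 ≤ q ∧ P ≤ dynPressure p ul := by
  rcases hr.le.eq_or_lt with h | h
  · have := hr.trace_of_neg hF hq hP (h ▸ hr.speed_neg)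
    rw [← h, hr.left_eq a le_rfl] at this
    exact ⟨this.1.ge, this.2.le⟩
  · have := hr.trace_of_lt hp hU hF hq hP le_rfl h
    rw [hr.left_eq a le_rfl] at this
    exact ⟨this.1.le, this.2.le⟩

end IsRarefactionFan

namespace IsShockFan

variable {p : ℝ → ℝ} {ul um : ℝ × ℝ} {U : ℝ → ℝ × ℝ} {s : ℝ}

theorem trace (h : IsShockFan p ul U um s) {F : Filter ℝ} [F.NeBot] (hF : F ≤ 𝓝[<] 0) {q P : ℝ}
    (hq : Tendsto (fun ξ => (U ξ).2) F (𝓝 q))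
    (hP : Tendsto (fun ξ => dynPressure p (U ξ)) F (𝓝 P)) : q = um.2 ∧ P = dynPressure p um := by
  have hev : ∀ᶠ ζ in F, um = U ζ := by
    filter_upwards [hF (Ioo_mem_nhdsLT h.speed_neg)] with ζ hζ using (h.right_eq ζ hζ.1 hζ.2).symm
  exact ⟨tendsto_nhds_unique hq (tendsto_const_nhds.congr' (hev.mono fun _ h => by simp only [h])),
    tendsto_nhds_unique hP (tendsto_const_nhds.congr' (hev.mono fun _ h => by simp only [h]))⟩

theorem momentum_eq (h : IsShockFan p ul U um s) : um.2 - ul.2 = s * (um.1 - ul.1) :=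
  congrArg Prod.fst h.rankineHugoniot

theorem dynPressure_eq (h : IsShockFan p ul U um s) :
    dynPressure p um - dynPressure p ul = s * (um.2 - ul.2) :=
  congrArg Prod.snd h.rankineHugoniot

theorem relFlux_sq (h : IsShockFan p ul U um s) (hul : 0 < ul.1) :
    (p um.1 - p ul.1) / (um.1 - ul.1) * um.1 = (ul.2 - s * ul.1) ^ 2 / ul.1 := by
  have hm := hul.trans h.density_lt
  obtain ⟨h1, h2⟩ := relative_of_rankineHugoniot hul hm h.rankineHugoniot
  rw [h1] at h2
  have h3 : um.1 - ul.1 ≠ 0 := (sub_pos.2 h.density_lt).ne'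
  field_simp at h2 ⊢
  linear_combination h2

/-- The squared relative mass flux `(q - s ρ)²` at `ul` decreases in `s`, and it equals the product
of both densities and the secant slope of `p`, which increases with the density behind the shock. So
faster receding shocks are stronger. -/
theorem density_le {um' : ℝ × ℝ} {U' : ℝ → ℝ × ℝ} {s' : ℝ} (hp : PressureLaw p)
    (hul : ul ∈ subsonic p) (h : IsShockFan p ul U um s) (h' : IsShockFan p ul U' um' s')
    (hs : s ≤ s') : um'.1 ≤ um.1 := by
  by_contra hcon
  rw [not_le] at hcon
  have hsec := hp.secant_le hul.1 h.density_lt hcon.le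
  have e := h.relFlux_sq hul.1
  have e' := h'.relFlux_sq hul.1
  have hpos : 0 < ul.2 - s' * ul.1 := by
    have := h'.speed_lt
    simp only [charSpeed, if_true] at this
    have h2 : s' < ul.2 / ul.1 := by linarith [Real.sqrt_nonneg (deriv p ul.1)]
    rw [lt_div_iff₀ hul.1] at h2
    linarith
  have hle : (ul.2 - s' * ul.1) ^ 2 / ul.1 ≤ (ul.2 - s * ul.1) ^ 2 / ul.1 := by
    have : ul.2 - s' * ul.1 ≤ ul.2 - s * ul.1 := by nlinarith [hul.1]
    have := hul.1.le
    gcongr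
  have hpos' : 0 < (ul.2 - s' * ul.1) ^ 2 / ul.1 := div_pos (by positivity) hul.1
  have hum : 0 < um.1 := hul.1.trans h.density_lt
  rw [← e, ← e'] at hle
  rw [← e'] at hpos'
  have hum' : 0 < um'.1 := hum.trans hcon
  have hσ : 0 < (p um'.1 - p ul.1) / (um'.1 - ul.1) := (mul_pos_iff_of_pos_right hum').1 hpos'
  nlinarith

end IsShockFan

/-- Along the curve of the states which a fan with given left state may reach at `ξ = 0`, the
dynamic pressure is a strictly decreasing function of the momentum. -/
theorem IsFan.eq_or_trace_lt {p : ℝ → ℝ} {ul : ℝ × ℝ} {U R U' R' : ℝ → ℝ × ℝ}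
    (hp : PressureLaw p) (hul : ul ∈ subsonic p) (hU : IsFan p ul U R) (hU' : IsFan p ul U' R')
    {F : Filter ℝ} [F.NeBot] (hF : F ≤ 𝓝[<] 0) {q P q' P' : ℝ}
    (hq : Tendsto (fun ξ => (U ξ).2) F (𝓝 q)) (hP : Tendsto (fun ξ => dynPressure p (U ξ)) F (𝓝 P))
    (hq' : Tendsto (fun ξ => (U' ξ).2) F (𝓝 q'))
    (hP' : Tendsto (fun ξ => dynPressure p (U' ξ)) F (𝓝 P')) :
    (∀ ξ < 0, U ξ = U' ξ) ∨ (q < q' ∧ P' < P) ∨ (q' < q ∧ P < P') := by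
  -- A shock lowers `q` and raises `P`, a rarefaction does the opposite or nothing, so `ul`
  -- separates the two kinds of traces.
  have shock_rare : ∀ {U R U' R' : ℝ → ℝ × ℝ} {um : ℝ × ℝ} {s a b q P q' P' : ℝ},
      IsShockFan p ul U um s → IsFan p ul U' R' → IsRarefactionFan p ul U' R' a b →
      Tendsto (fun ξ => (U ξ).2) F (𝓝 q) → Tendsto (fun ξ => dynPressure p (U ξ)) F (𝓝 P) →
      Tendsto (fun ξ => (U' ξ).2) F (𝓝 q') → Tendsto (fun ξ => dynPressure p (U' ξ)) F (𝓝 P') →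
      q < q' ∧ P' < P := by
    intro U R U' R' um s a b q P q' P' h hU' h' hq hP hq' hP'
    obtain ⟨rfl, rfl⟩ := h.trace hF hq hP
    obtain ⟨h1, h2⟩ := h'.le_trace hp hU' hF hq' hP'
    have e1 := h.momentum_eq
    have e2 := h.dynPressure_eq
    have h3 := h.density_lt
    have h4 := h.speed_neg
    have h5 : s * (um.1 - ul.1) < 0 := mul_neg_of_neg_of_pos h4 (sub_pos.2 h3)
    have h6 : 0 < s * (um.2 - ul.2) := mul_pos_of_neg_of_neg h4 (by linarith)
    exact ⟨by linarith, by linarith⟩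
  have shock_shock : ∀ {U U' : ℝ → ℝ × ℝ} {um um' : ℝ × ℝ} {s s' q P q' P' : ℝ},
      IsShockFan p ul U um s → IsShockFan p ul U' um' s' → s < s' →
      Tendsto (fun ξ => (U ξ).2) F (𝓝 q) → Tendsto (fun ξ => dynPressure p (U ξ)) F (𝓝 P) →
      Tendsto (fun ξ => (U' ξ).2) F (𝓝 q') → Tendsto (fun ξ => dynPressure p (U' ξ)) F (𝓝 P') →
      q < q' ∧ P' < P := by
    intro U U' um um' s s' q P q' P' h h' hs hq hP hq' hP'
    obtain ⟨rfl, rfl⟩ := h.trace hF hq hP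
    obtain ⟨rfl, rfl⟩ := h'.trace hF hq' hP'
    have e1 := h.momentum_eq
    have e2 := h.dynPressure_eq
    have e1' := h'.momentum_eq
    have e2' := h'.dynPressure_eq
    have hd := h.density_le hp hul h' hs.le
    have h3 := h'.density_lt
    have h3' := h.density_lt
    have h4 := h'.speed_neg
    -- From the jump conditions, with `ρ` and `ρ'` the densities behind the two shocks, `q' - q =
    -- (s' - s) (ρ - ρₗ) + (-s') (ρ - ρ')`. In the same way `P - P' = (s' - s) (qₗ - q) + (-s') (q'
    -- - q)`.
    have h5 : um.2 < um'.2 := by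
      nlinarith [mul_pos (sub_pos.2 hs) (sub_pos.2 h3'), mul_nonneg (neg_pos.2 h4).le (sub_nonneg.2 hd)]
    have h6 : um'.2 < ul.2 := by nlinarith [mul_pos (neg_pos.2 h4) (sub_pos.2 h3)]
    have h7 := mul_pos (neg_pos.2 h4) (sub_pos.2 h5)
    have h8 := mul_pos (sub_pos.2 hs) (sub_pos.2 (h5.trans h6))
    exact ⟨h5, by nlinarith⟩
  have rare_rare : ∀ {U R U' R' : ℝ → ℝ × ℝ} {a b b' q P q' P' : ℝ},
      IsFan p ul U R → IsFan p ul U' R' →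
      IsRarefactionFan p ul U R a b → IsRarefactionFan p ul U' R' a b' → b < b' →
      Tendsto (fun ξ => (U ξ).2) F (𝓝 q) → Tendsto (fun ξ => dynPressure p (U ξ)) F (𝓝 P) →
      Tendsto (fun ξ => (U' ξ).2) F (𝓝 q') → Tendsto (fun ξ => dynPressure p (U' ξ)) F (𝓝 P') →
      q < q' ∧ P' < P := by
    intro U R U' R' a b b' q P q' P' hU hU' h h' hb hq hP hq' hP'
    have hb0 := hb.trans_le h'.end_nonpos
    obtain ⟨rfl, rfl⟩ := h.trace_of_neg hF hq hP hb0
    rw [h.eq_of_le hp hU hU' h' le_rfl hb.le hb0]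
    exact h'.trace_of_lt hp hU' hF hq' hP' h.le hb
  rcases hU.classification hp hul with ⟨um, s, h⟩ | ⟨b, h⟩ <;>
    rcases hU'.classification hp hul with ⟨um', s', h'⟩ | ⟨b', h'⟩
  · rcases lt_trichotomy s s' with hs | hs | hs
    · exact Or.inr (Or.inl (shock_shock h h' hs hq hP hq' hP'))
    · left
      subst hs
      have hd := le_antisymm (h'.density_le hp hul h le_rfl) (h.density_le hp hul h' le_rfl)
      have hum : um = um' := by
        refine Prod.ext hd ?_
        have e1 := h.momentum_eq
        have e1' := h'.momentum_eq
        rw [hd] at e1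
        linarith
      intro ξ hξ
      rcases le_or_gt ξ s with hs | hs
      · rw [h.left_eq ξ hs, h'.left_eq ξ hs]
      · rw [h.right_eq ξ hs hξ, h'.right_eq ξ hs hξ, hum]
    · exact Or.inr (Or.inr (shock_shock h' h hs hq' hP' hq hP))
  · exact Or.inr (Or.inl (shock_rare (R := R) h hU' h' hq hP hq' hP'))
  · exact Or.inr (Or.inr (shock_rare (R := R) h' hU h hq' hP' hq hP))
  · rcases lt_trichotomy b b' with hb | hb | hb
    · exact Or.inr (Or.inl (rare_rare hU hU' h h' hb hq hP hq' hP'))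
    · left
      subst hb
      intro ξ hξ
      rcases le_or_gt ξ b with hs | hs
      · exact h.eq_of_le hp hU hU' h' hs hs hξ
      · rw [h.right_eq ξ hs hξ, h'.right_eq ξ hs hξ,
          h.eq_of_le hp hU hU' h' le_rfl le_rfl (hs.trans hξ)]
    · exact Or.inr (Or.inr (rare_rare hU' hU h' h hb hq' hP' hq hP))

/-! ### The fundamental lemma on a half line -/

theorem exists_Icc_of_isCompact_subset_Iio {K : Set ℝ} (hK : IsCompact K) (h : K ⊆ Iio 0) :
    ∃ l r : ℝ, l < r ∧ r < 0 ∧ K ⊆ Ioo l r := by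
  rcases K.eq_empty_or_nonempty with rfl | hne
  · exact ⟨-2, -1, by norm_num, by norm_num, empty_subset _⟩
  obtain ⟨x, hx⟩ := hK.exists_isLeast hne
  obtain ⟨y, hy⟩ := hK.exists_isGreatest hne
  have hy0 : y < 0 := h hy.1
  have hxy := hx.2 hy.1
  exact ⟨x - 1, y / 2, by linarith, by linarith, fun z hz =>
    ⟨by linarith [hx.2 hz], by linarith [hy.2 hz]⟩⟩

theorem integrable_mul_of_tsupport_subset {f θ : ℝ → ℝ} (hf : LocallyIntegrableOn f (Iio 0))
    (hθ : Continuous θ) (hc : HasCompactSupport θ) (hs : tsupport θ ⊆ Iio 0) :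
    Integrable (fun x => f x * θ x) := by
  have h1 : IntegrableOn f (tsupport θ) :=
    (hf.mono_set hs).integrableOn_isCompact hc.isCompact
  refine (integrableOn_iff_integrable_of_support_subset (s := tsupport θ) ?_).1
    (h1.mul_continuousOn hθ.continuousOn hc.isCompact)
  intro x hx
  exact subset_tsupport θ (right_ne_zero_of_mul hx)

/-- Integration by parts with a factor `a` that is only locally integrable: its primitive is
absolutely continuous. The mean value zero of `θ` is what makes the primitive of `θ` vanish outside
the interval, so that there are no boundary terms. -/
theorem integral_mul_eq_neg_of_primitive {a θ : ℝ → ℝ} (ha : LocallyIntegrable a)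
    (hθ : Continuous θ) {l : ℝ} (hs : Function.support θ ⊆ Ioo l 0)
    (h0 : ∫ x, θ x = 0) :
    ∫ x, a x * (∫ y in (0 : ℝ)..x, θ y) = -∫ x, (∫ y in (-1 : ℝ)..x, a y) * θ x := by
  set ψ : ℝ → ℝ := fun x => ∫ y in (0 : ℝ)..x, θ y with hψ
  have hψd : ∀ x, HasDerivAt ψ (θ x) x := fun x => hθ.integral_hasStrictDerivAt 0 x |>.hasDerivAt
  have hψl : ψ l = 0 := by
    have : ∫ y in l..0, θ y = 0 := by
      rw [intervalIntegral.integral_eq_integral_of_support_subset (hs.trans Ioo_subset_Ioc_self), h0]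
    simp only [hψ]
    rw [intervalIntegral.integral_symm, this, neg_zero]
  have hψ0 : ψ 0 = 0 := by simp [hψ]
  have hψs : Function.support ψ ⊆ Ioc l 0 := by
    intro x hx
    by_contra hcon
    refine hx ?_
    rcases le_or_gt x l with h | h
    · have : ∫ y in l..x, θ y = 0 := by
        rw [intervalIntegral.integral_symm, intervalIntegral.integral_of_le h,
          setIntegral_eq_zero_of_forall_eq_zero, neg_zero]
        intro y hy
        by_contra hne
        exact absurd (hs hne).1 (not_lt.2 hy.2)
      have h2 : ψ x = ψ l + ∫ y in l..x, θ y :=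
        (intervalIntegral.integral_add_adjacent_intervals (hθ.intervalIntegrable _ _)
          (hθ.intervalIntegrable _ _)).symm
      rw [h2, hψl, this, add_zero]
    · have hx0 : 0 < x := by
        by_contra h'
        exact hcon ⟨h, not_lt.1 h'⟩
      simp only [hψ]
      rw [intervalIntegral.integral_of_le hx0.le, setIntegral_eq_zero_of_forall_eq_zero]
      intro y hy
      by_contra hne
      exact absurd (hs hne).2 (not_lt.2 hy.1.le)
  set A : ℝ → ℝ := fun x => ∫ y in (-1 : ℝ)..x, a y with hA
  have hai : ∀ x y, IntervalIntegrable a volume x y := fun x y =>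
    (ha.integrableOn_isCompact isCompact_uIcc).intervalIntegrable
  have hAeq : A = fun x => A l + ∫ y in l..x, a y := by
    ext x
    exact (intervalIntegral.integral_add_adjacent_intervals (hai _ _) (hai _ _)).symm
  have hAac : AbsolutelyContinuousOnInterval A l 0 := by
    rw [hAeq]
    exact (LipschitzOnWith.absolutelyContinuousOnInterval (K := 0)
      (LipschitzWith.const (A l)).lipschitzOnWith).add
      ((hai l 0).absolutelyContinuousOnInterval_intervalIntegral left_mem_uIcc)
  have hψac : AbsolutelyContinuousOnInterval ψ l 0 := by
    refine ContDiffOn.absolutelyContinuousOnInterval (ContDiff.contDiffOn ?_)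
    rw [contDiff_one_iff_deriv]
    exact ⟨fun x => (hψd x).differentiableAt, by
      rw [show deriv ψ = θ from funext fun x => (hψd x).deriv]; exact hθ⟩
  have hparts := hAac.integral_mul_deriv_eq_deriv_mul hψac
  rw [hψl, hψ0, mul_zero, mul_zero, sub_zero, zero_sub] at hparts
  have e1 : ∫ x in l..0, A x * deriv ψ x = ∫ x, A x * θ x := by
    rw [← intervalIntegral.integral_eq_integral_of_support_subset (a := l) (b := 0)]
    · simp only [(hψd _).deriv]
    · exact fun x hx => Ioo_subset_Ioc_self (hs (right_ne_zero_of_mul hx))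
  have e2 : ∫ x in l..0, deriv A x * ψ x = ∫ x, a x * ψ x := by
    rw [← intervalIntegral.integral_eq_integral_of_support_subset (a := l) (b := 0)]
    · refine intervalIntegral.integral_congr_ae ?_
      filter_upwards [(hai l 0).ae_hasDerivAt_integral] with x hx hxl
      have := hx (uIoc_subset_uIcc hxl) l left_mem_uIcc
      rw [hAeq, (this.const_add (A l)).deriv]
    · exact fun x hx => hψs (right_ne_zero_of_mul hx)
  rw [e1, e2] at hparts
  linarith

/-- If `G' = -a` in the sense of distributions on the half line, then `G` is a primitive
of `-a`. -/
theorem ae_eq_sub_integral_of_weak {a G : ℝ → ℝ} (ha : LocallyIntegrable a)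
    (hG : LocallyIntegrableOn G (Iio 0))
    (h : ∀ ψ : ℝ → ℝ, ContDiff ℝ 1 ψ → HasCompactSupport ψ → tsupport ψ ⊆ Iio 0 →
      ∫ ξ, (G ξ * deriv ψ ξ - a ξ * ψ ξ) = 0) :
    ∃ k, ∀ᵐ ξ, ξ < 0 → G ξ = k - ∫ η in (-1 : ℝ)..ξ, a η := by
  set A : ℝ → ℝ := fun x => ∫ y in (-1 : ℝ)..x, a y with hA
  have hAc : Continuous A := intervalIntegral.continuous_primitive
    (fun _ _ => (ha.integrableOn_isCompact isCompact_uIcc).intervalIntegrable) _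
  set K : ℝ → ℝ := fun x => G x + A x with hK
  have hKi : LocallyIntegrableOn K (Iio 0) :=
    hG.add (hAc.locallyIntegrable.locallyIntegrableOn _)
  -- Functions of mean zero are exactly the derivatives of admissible test functions, so `K = G + A`
  -- annihilates them.
  have key : ∀ θ : ℝ → ℝ, Continuous θ → HasCompactSupport θ → tsupport θ ⊆ Iio 0 →
      ∫ x, θ x = 0 → ∫ x, K x * θ x = 0 := by
    intro θ hθ hc hs h0
    obtain ⟨l, r, hlr, hr0, hsub⟩ := exists_Icc_of_isCompact_subset_Iio hc.isCompact hs
    have hsupp : Function.support θ ⊆ Ioo l r := (subset_tsupport θ).trans hsub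
    set ψ : ℝ → ℝ := fun x => ∫ y in (0 : ℝ)..x, θ y with hψ
    have hψd : ∀ x, HasDerivAt ψ (θ x) x := fun x =>
      hθ.integral_hasStrictDerivAt 0 x |>.hasDerivAt
    have hψs : Function.support ψ ⊆ Icc l r := by
      intro x hx
      by_contra hcon
      refine hx ?_
      rcases lt_or_ge x l with hxl | hxl
      · have h1 : ∫ y in x..0, θ y = 0 := by
          rw [intervalIntegral.integral_eq_integral_of_support_subset _, h0]
          exact hsupp.trans fun y hy => ⟨hxl.trans hy.1, (hy.2.trans hr0).le⟩
        simp only [hψ]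
        rw [intervalIntegral.integral_symm, h1, neg_zero]
      · have hxr : r < x := by
          by_contra h'
          exact hcon ⟨hxl, not_lt.1 h'⟩
        refine intervalIntegral.integral_zero_ae (Eventually.of_forall fun y hy => ?_)
        by_contra hne
        have := (hsupp hne).2
        rw [uIoc, mem_Ioc] at hy
        have := (lt_min hr0 hxr).trans hy.1
        linarith
    have hψt : tsupport ψ ⊆ Icc l r := closure_minimal hψs isClosed_Icc
    have hψ0 : tsupport ψ ⊆ Iio 0 := hψt.trans fun y hy => hy.2.trans_lt hr0
    have hψc : HasCompactSupport ψ := isCompact_Icc.of_isClosed_subset isClosed_closure hψt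
    have hde : deriv ψ = θ := funext fun x => (hψd x).deriv
    have hψ1 : ContDiff ℝ 1 ψ := by
      rw [contDiff_one_iff_deriv]
      exact ⟨fun x => (hψd x).differentiableAt, by rw [hde]; exact hθ⟩
    have hw := h ψ hψ1 hψc hψ0
    rw [hde, integral_sub (integrable_mul_of_tsupport_subset hG hθ hc hs)
      (integrable_mul_of_tsupport_subset (ha.locallyIntegrableOn _) hψ1.continuous hψc hψ0),
      integral_mul_eq_neg_of_primitive ha hθ
        (hsupp.trans fun y hy => ⟨hy.1, hy.2.trans hr0⟩) h0] at hw
    have : ∫ x, K x * θ x = (∫ x, G x * θ x) + ∫ x, A x * θ x := by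
      rw [← integral_add (integrable_mul_of_tsupport_subset hG hθ hc hs)
        (integrable_mul_of_tsupport_subset (hAc.locallyIntegrable.locallyIntegrableOn _) hθ hc hs)]
      simp only [hK, add_mul]
    rw [this]
    linarith
  -- A bump of unit mass in `[-3, -1]`, inside the half line. Subtracting a multiple of it gives any
  -- test function mean zero; the constant is the average of `K` against it.
  let β : ContDiffBump (-2 : ℝ) := ⟨1 / 2, 1, by norm_num, by norm_num⟩
  set θ₀ : ℝ → ℝ := β.normed volume with hθ₀
  have hθ₀c : Continuous θ₀ := β.continuous_normed
  have hθ₀s : HasCompactSupport θ₀ := β.hasCompactSupport_normed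
  have hθ₀t : tsupport θ₀ ⊆ Iio 0 := by
    rw [hθ₀, β.tsupport_normed_eq, Real.closedBall_eq_Icc]
    intro x hx
    have : x ≤ -2 + 1 := hx.2
    simp only [mem_Iio]
    linarith
  refine ⟨∫ x, K x * θ₀ x, ?_⟩
  set k := ∫ x, K x * θ₀ x with hk
  have := isOpen_Iio.ae_eq_zero_of_integral_contDiff_smul_eq_zero (U := Iio (0 : ℝ)) (μ := volume)
    (f := fun x => K x - k) (hKi.sub (continuous_const.locallyIntegrable.locallyIntegrableOn _)) ?_
  · filter_upwards [this] with x hx h0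
    have := hx h0
    simp only [hK] at this
    linarith
  intro θ hθ hc hs
  have hI : Integrable θ := hθ.continuous.integrable_of_hasCompactSupport hc
  have hI0 : Integrable θ₀ := hθ₀c.integrable_of_hasCompactSupport hθ₀s
  have hχ := key (fun x => θ x - (∫ y, θ y) * θ₀ x)
    (hθ.continuous.sub (continuous_const.mul hθ₀c))
    (hc.sub (hθ₀s.mul_left (f := fun _ => ∫ y, θ y)))
    ((tsupport_sub _ _).trans (union_subset hs
      (tsupport_mul_subset_right.trans hθ₀t)))
    (by rw [integral_sub hI (hI0.const_mul _), integral_const_mul, β.integral_normed, mul_one,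
      sub_self])
  have hKθ := integrable_mul_of_tsupport_subset hKi hθ.continuous hc hs
  have hKθ₀ := integrable_mul_of_tsupport_subset hKi hθ₀c hθ₀s hθ₀t
  have e1 : ∫ x, K x * (θ x - (∫ y, θ y) * θ₀ x) = (∫ x, K x * θ x) - (∫ y, θ y) * k := by
    rw [hk, ← integral_const_mul, ← integral_sub hKθ (hKθ₀.const_mul _)]
    congr 1
    ext x
    ring
  rw [e1] at hχ
  calc ∫ x, θ x • (K x - k) = ∫ x, (K x * θ x - k * θ x) := by
        congr 1; ext x; simp only [smul_eq_mul]; ring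
    _ = (∫ x, K x * θ x) - k * ∫ x, θ x := by
        rw [integral_sub hKθ (hI.const_mul _), integral_const_mul]
    _ = 0 := by linarith

/-! ### One-sided limits and the exclusion of vacuum -/

/-- A set of full measure meets every interval; hence limits that disregard null sets, and in
particular traces, are unique. -/
theorem neBot_inf_ae_of_forall_exists_Ioo {l : Filter ℝ}
    (h : ∀ s ∈ l, ∃ a b : ℝ, a < b ∧ Ioo a b ⊆ s) : (l ⊓ ae volume).NeBot := by
  rw [inf_neBot_iff]
  intro s hs t ht
  obtain ⟨a, b, hab, hsub⟩ := h s hs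
  by_contra hcon
  rw [not_nonempty_iff_eq_empty] at hcon
  have h1 : Ioo a b ⊆ tᶜ := fun x hx hxt =>
    (hcon ▸ (⟨hsub hx, hxt⟩ : x ∈ s ∩ t) : x ∈ (∅ : Set ℝ))
  have h2 : volume (Ioo a b) = 0 := measure_mono_null h1 (mem_ae_iff.1 ht)
  rw [Real.volume_Ioo, ENNReal.ofReal_eq_zero] at h2
  linarith

instance neBot_nhdsLT_inf_ae (ξ : ℝ) : (𝓝[<] ξ ⊓ ae (volume : Measure ℝ)).NeBot :=
  neBot_inf_ae_of_forall_exists_Ioo fun _ hs =>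
    let ⟨a, ha, hsub⟩ := mem_nhdsLT_iff_exists_Ioo_subset.1 hs
    ⟨a, ξ, ha, hsub⟩

instance neBot_nhdsGT_inf_ae (ξ : ℝ) : (𝓝[>] ξ ⊓ ae (volume : Measure ℝ)).NeBot :=
  neBot_inf_ae_of_forall_exists_Ioo fun _ hs =>
    let ⟨b, hb, hsub⟩ := mem_nhdsGT_iff_exists_Ioo_subset.1 hs
    ⟨ξ, b, hb, hsub⟩

/-- The limit of the pressure at vacuum. -/
def vacuumPressure (p : ℝ → ℝ) : ℝ := sInf (p '' Ioi 0)

theorem vacuumPressure_le {p : ℝ → ℝ} (hp : PressureLaw p) {ρ : ℝ} (hρ : 0 < ρ) :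
    vacuumPressure p ≤ p ρ :=
  csInf_le ⟨0, by rintro _ ⟨x, hx, rfl⟩; exact (hp.pos x hx).le⟩ (mem_image_of_mem _ hρ)

theorem tendsto_vacuumPressure {p : ℝ → ℝ} (hp : PressureLaw p) :
    Tendsto p (𝓝[>] 0) (𝓝 (vacuumPressure p)) :=
  hp.monotoneOn.tendsto_nhdsGT ⟨0, by rintro _ ⟨x, hx, rfl⟩; exact (hp.pos x hx).le⟩

/-- The mean value inequality on `[ε, ρ]`, with `ε → 0`. -/
theorem vacuumPressure_add_le {p : ℝ → ℝ} (hp : PressureLaw p) {k ρ : ℝ}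
    (hk : ∀ r, 0 < r → k ≤ deriv p r) (hρ : 0 < ρ) : vacuumPressure p + k * ρ ≤ p ρ := by
  have h1 : Tendsto (fun ε => p ε + k * (ρ - ε)) (𝓝[>] 0)
      (𝓝 (vacuumPressure p + k * (ρ - 0))) :=
    (tendsto_vacuumPressure hp).add
      (((continuous_const.mul (continuous_const.sub continuous_id)).tendsto (0 : ℝ)).mono_left
        nhdsWithin_le_nhds)
  rw [sub_zero] at h1
  refine le_of_tendsto h1 ?_
  filter_upwards [Ioo_mem_nhdsGT hρ] with ε hε
  have := (convex_Ioi (0 : ℝ)).mul_sub_le_image_sub_of_le_deriv hp.continuousOn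
    (fun x hx => by
      rw [interior_Ioi] at hx
      exact (hp.hasDerivAt hx).differentiableAt.differentiableWithinAt)
    (fun x hx => by rw [interior_Ioi] at hx; exact hk x hx) ε hε.1 ρ hρ hε.2.le
  linarith

/-- Near a vacuum point `ξ₁ < 0` the integrated equations force the velocity to be close to `ξ₁`.
Subsonicity then bounds the sound speed from below by a positive constant near vacuum, so the
pressure grows at least linearly there. This growth is more than the integrated momentum equation
permits. -/
theorem not_tendsto_density_zero {p : ℝ → ℝ} (hp : PressureLaw p) {U : ℝ → ℝ × ℝ}
    {M ξ₁ k₁ k₂ : ℝ} (hξ₁ : ξ₁ < 0) (hM : ∀ ξ, ‖U ξ‖ ≤ M)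
    (hi₁ : LocallyIntegrable fun ξ => (U ξ).1) (hi₂ : LocallyIntegrable fun ξ => (U ξ).2)
    (hmem : ∀ᵐ ξ, ξ < 0 → U ξ ∈ subsonic p)
    (hm : ∀ᵐ ξ, ξ < 0 → (U ξ).2 - ξ * (U ξ).1 = k₁ - ∫ η in (-1 : ℝ)..ξ, (U η).1)
    (hn : ∀ᵐ ξ, ξ < 0 →
      dynPressure p (U ξ) - ξ * (U ξ).2 = k₂ - ∫ η in (-1 : ℝ)..ξ, (U η).2)
    {F : Filter ℝ} [F.NeBot] (hF : F ≤ 𝓝[≠] ξ₁ ⊓ ae volume)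
    (h0 : Tendsto (fun ξ => (U ξ).1) F (𝓝 0)) : False := by
  have hFae : F ≤ ae volume := hF.trans inf_le_right
  have hFn : F ≤ 𝓝 ξ₁ := hF.trans (inf_le_left.trans nhdsWithin_le_nhds)
  have hii₁ : ∀ x y, IntervalIntegrable (fun ξ => (U ξ).1) volume x y := fun x y =>
    (hi₁.integrableOn_isCompact isCompact_uIcc).intervalIntegrable
  have hii₂ : ∀ x y, IntervalIntegrable (fun ξ => (U ξ).2) volume x y := fun x y =>
    (hi₂.integrableOn_isCompact isCompact_uIcc).intervalIntegrable
  set m : ℝ → ℝ := fun ξ => k₁ - ∫ η in (-1 : ℝ)..ξ, (U η).1 with hmd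
  set n : ℝ → ℝ := fun ξ => k₂ - ∫ η in (-1 : ℝ)..ξ, (U η).2 with hnd
  have hmc : Continuous m :=
    continuous_const.sub (intervalIntegral.continuous_primitive hii₁ _)
  have hnc : Continuous n :=
    continuous_const.sub (intervalIntegral.continuous_primitive hii₂ _)
  have hmsub : ∀ x y, m x - m y = ∫ η in x..y, (U η).1 := fun x y => by
    have := intervalIntegral.integral_add_adjacent_intervals (hii₁ (-1) x) (hii₁ x y)
    simp only [hmd]
    linarith
  have hnsub : ∀ x y, n x - n y = ∫ η in x..y, (U η).2 := fun x y => by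
    have := intervalIntegral.integral_add_adjacent_intervals (hii₂ (-1) x) (hii₂ x y)
    simp only [hnd]
    linarith
  set C := √(deriv p (max M 1)) with hC
  have hC0 : 0 ≤ C := Real.sqrt_nonneg _
  have hbound : ∀ ξ, U ξ ∈ subsonic p → |(U ξ).2| ≤ (U ξ).1 * C := by
    intro ξ h
    refine (mem_subsonic_iff.1 h).2.le.trans ?_
    refine mul_le_mul_of_nonneg_left (hp.sqrt_deriv_le h.1 ?_) h.1.le
    exact ((le_abs_self _).trans ((norm_fst_le (U ξ)).trans (hM ξ))).trans (le_max_left _ _)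
  have hneg : ∀ᶠ ξ in F, ξ < 0 := hFn (eventually_lt_nhds hξ₁)
  have hgood : ∀ᶠ ξ in F, ξ < 0 ∧ U ξ ∈ subsonic p ∧ (U ξ).2 - ξ * (U ξ).1 = m ξ ∧
      dynPressure p (U ξ) - ξ * (U ξ).2 = n ξ := by
    filter_upwards [hneg, hFae hmem, hFae hm, hFae hn] with ξ h1 h2 h3 h4
    exact ⟨h1, h2 h1, h3 h1, h4 h1⟩
  have hid : Tendsto (fun ξ : ℝ => ξ) F (𝓝 ξ₁) := hFn
  have hq : Tendsto (fun ξ => (U ξ).2) F (𝓝 0) := by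
    refine squeeze_zero_norm' (hgood.mono fun ξ h => hbound ξ h.2.1) ?_
    simpa using h0.mul_const C
  have hm1 : m ξ₁ = 0 := by
    have h1 : Tendsto (fun ξ => (U ξ).2 - ξ * (U ξ).1) F (𝓝 0) := by
      simpa using hq.sub (hid.mul h0)
    exact tendsto_nhds_unique ((hmc.tendsto ξ₁).mono_left hFn)
      (h1.congr' (hgood.mono fun ξ h => h.2.2.1))
  have hn1 : n ξ₁ = vacuumPressure p := by
    have h1 : Tendsto (fun ξ => p (U ξ).1) F (𝓝 (vacuumPressure p)) :=
      (tendsto_vacuumPressure hp).comp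
        (tendsto_nhdsWithin_iff.2 ⟨h0, hgood.mono fun ξ h => h.2.1.1⟩)
    have h2 : Tendsto (fun ξ => (U ξ).2 ^ 2 / (U ξ).1) F (𝓝 0) := by
      have h3 : Tendsto (fun ξ => (U ξ).1 * C ^ 2) F (𝓝 0) := by simpa using h0.mul_const (C ^ 2)
      refine squeeze_zero_norm' (hgood.mono fun ξ h => ?_) h3
      have hpos := h.2.1.1
      rw [Real.norm_eq_abs, abs_of_nonneg (by positivity), div_le_iff₀ hpos, ← sq_abs]
      have := hbound ξ h.2.1
      nlinarith [abs_nonneg (U ξ).2, mul_nonneg hpos.le hC0]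
    have h4 : Tendsto (fun ξ => dynPressure p (U ξ) - ξ * (U ξ).2) F (𝓝 (vacuumPressure p)) := by
      simpa [dynPressure] using (h2.add h1).sub (hid.mul hq)
    exact tendsto_nhds_unique ((hnc.tendsto ξ₁).mono_left hFn)
      (h4.congr' (hgood.mono fun ξ h => h.2.2.2))
  have hae : ∀ x y, x ≤ 0 → y ≤ 0 → ∀ᵐ η ∂volume.restrict (Ioo x y), U η ∈ subsonic p ∧
      (U η).2 = m η + η * (U η).1 := by
    intro x y hx hy
    rw [ae_restrict_iff' measurableSet_Ioo]
    filter_upwards [hmem, hm] with η h1 h2 hη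
    have h0 := hη.2.trans_le hy
    exact ⟨h1 h0, by linarith [h2 h0]⟩
  have hae' : ∀ x y, x ≤ 0 → y ≤ 0 → ∀ᵐ η ∂volume.restrict (Icc x y), U η ∈ subsonic p ∧
      (U η).2 = m η + η * (U η).1 := fun x y hx hy => by
    rw [restrict_Ioo_eq_restrict_Icc.symm]
    exact hae x y hx hy
  have hmono : ∀ x y, x ≤ y → y ≤ 0 → m y ≤ m x := fun x y hxy hy => by
    have := hmsub x y
    have h1 : 0 ≤ ∫ η in x..y, (U η).1 := by
      refine intervalIntegral.integral_nonneg_of_ae_restrict hxy ?_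
      filter_upwards [hae' x y (hxy.trans hy) hy] with η h using h.1.1.le
    linarith
  -- The difference of `n` is an integral of `q = m + η ρ`. As `m` is nonincreasing, it and the
  -- factor `η` may be replaced by their values at the unfavourable end points; the remaining
  -- integral of `ρ` is again a difference of `m`, and `m ξ₁ = 0`.
  have hest : ∀ ξ, ξ < 0 → n ξ - n ξ₁ - ξ * m ξ ≤ 2 * |m ξ| * |ξ - ξ₁| := by
    intro ξ hξ
    rcases le_total ξ ξ₁ with hle | hle
    · have hmξ : 0 ≤ m ξ := hm1 ▸ hmono ξ ξ₁ hle hξ₁.le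
      rw [abs_of_nonneg hmξ, abs_of_nonpos (sub_nonpos.2 hle)]
      have h1 : ∫ η in ξ..ξ₁, (U η).2 ≤ ∫ η in ξ..ξ₁, (m ξ + ξ₁ * (U η).1) := by
        refine intervalIntegral.integral_mono_ae_restrict hle (hii₂ _ _)
          (intervalIntegrable_const.add ((hii₁ _ _).const_mul _)) ?_
        filter_upwards [hae' ξ ξ₁ hξ.le hξ₁.le, ae_restrict_mem measurableSet_Icc] with η h hη
        rw [h.2]
        exact add_le_add (hmono ξ η hη.1 (hη.2.trans hξ₁.le))
          (mul_le_mul_of_nonneg_right hη.2 h.1.1.le)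
      rw [← hnsub, intervalIntegral.integral_add intervalIntegrable_const ((hii₁ _ _).const_mul _),
        intervalIntegral.integral_const, intervalIntegral.integral_const_mul, ← hmsub, hm1,
        smul_eq_mul] at h1
      linarith
    · have hmξ : m ξ ≤ 0 := hm1 ▸ hmono ξ₁ ξ hle hξ.le
      rw [abs_of_nonpos hmξ, abs_of_nonneg (sub_nonneg.2 hle)]
      have h1 : ∫ η in ξ₁..ξ, (m ξ + ξ₁ * (U η).1) ≤ ∫ η in ξ₁..ξ, (U η).2 := by
        refine intervalIntegral.integral_mono_ae_restrict hle
          (intervalIntegrable_const.add ((hii₁ _ _).const_mul _)) (hii₂ _ _) ?_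
        filter_upwards [hae' ξ₁ ξ hξ₁.le hξ.le, ae_restrict_mem measurableSet_Icc] with η h hη
        rw [h.2]
        exact add_le_add (hmono η ξ hη.2 hξ.le) (mul_le_mul_of_nonneg_right hη.1 h.1.1.le)
      rw [← hnsub, intervalIntegral.integral_add intervalIntegrable_const ((hii₁ _ _).const_mul _),
        intervalIntegral.integral_const, intervalIntegral.integral_const_mul, ← hmsub, hm1,
        smul_eq_mul] at h1
      linarith
  have hest' : ∀ᶠ ξ in F, ξ < 0 ∧ U ξ ∈ subsonic p ∧ (U ξ).2 - ξ * (U ξ).1 = m ξ ∧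
      m ξ ^ 2 / (U ξ).1 + p (U ξ).1 ≤ vacuumPressure p + 2 * |m ξ| * |ξ - ξ₁| := by
    filter_upwards [hgood] with ξ h
    refine ⟨h.1, h.2.1, h.2.2.1, ?_⟩
    have h1 := hest ξ h.1
    rw [hn1, ← h.2.2.2, ← h.2.2.1] at h1
    rw [← h.2.2.1]
    have hpos := h.2.1.1
    have e : ((U ξ).2 - ξ * (U ξ).1) ^ 2 / (U ξ).1 + p (U ξ).1 =
        dynPressure p (U ξ) - ξ * (U ξ).2 - ξ * ((U ξ).2 - ξ * (U ξ).1) := by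
      simp only [dynPressure]
      field_simp
      ring
    linarith
  set k := -ξ₁ / 2 with hk
  have hk0 : 0 < k := by linarith
  have hclose : ∀ᶠ ξ in F, |ξ - ξ₁| < k / 4 := by
    have : Tendsto (fun ξ => |ξ - ξ₁|) F (𝓝 |ξ₁ - ξ₁|) := (hid.sub_const ξ₁).abs
    rw [sub_self, abs_zero] at this
    exact this.eventually (eventually_lt_nhds (by linarith))
  -- As `p` is at least its vacuum limit, the estimate bounds `|m| / ρ = |v - ξ|` by `2 |ξ - ξ₁|`.
  -- Thus `v` is close to `ξ₁ = -2k`, and `|v| ≤ √p'` gives the claim.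
  have hsound : ∀ᶠ ξ in F, k ^ 2 ≤ deriv p (U ξ).1 := by
    filter_upwards [hest', hclose] with ξ h hξ
    have hpos := h.2.1.1
    have h1 := vacuumPressure_le hp hpos
    have h2 : m ξ ^ 2 / (U ξ).1 ≤ 2 * |m ξ| * |ξ - ξ₁| := by linarith [h.2.2.2]
    rw [div_le_iff₀ hpos, ← sq_abs] at h2
    have h3 : |m ξ| ≤ 2 * |ξ - ξ₁| * (U ξ).1 := by
      rcases (abs_nonneg (m ξ)).eq_or_lt with h0 | h0
      · rw [← h0]; positivity
      · by_contra hcon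
        rw [not_le] at hcon
        nlinarith
    have h4 : |(U ξ).2 / (U ξ).1| ≤ √(deriv p (U ξ).1) :=
      abs_velocity_le (subsonic_subset_weaklySubsonic hp h.2.1)
    have h5 : |(U ξ).2 / (U ξ).1 - ξ| ≤ 2 * |ξ - ξ₁| := by
      have : (U ξ).2 / (U ξ).1 - ξ = m ξ / (U ξ).1 := by
        rw [← h.2.2.1]; field_simp
      rw [this, abs_div, abs_of_pos hpos, div_le_iff₀ hpos]
      exact h3
    have h6 : k ≤ √(deriv p (U ξ).1) := by
      have := (abs_le.1 h4).1
      have := (abs_le.1 h5).2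
      have := (abs_lt.1 hξ).2
      linarith
    rw [← hp.sq_sqrt_deriv hpos]
    exact pow_le_pow_left₀ hk0.le h6 2
  have hall : ∀ r, 0 < r → k ^ 2 ≤ deriv p r := by
    intro r hr
    obtain ⟨ξ, h1, h2, h3⟩ :=
      (hsound.and ((hgood.mono fun ξ h => h.2.1.1).and (h0.eventually (eventually_lt_nhds hr)))).exists
    exact h1.trans (hp.deriv_le_deriv h2 h3.le)
  -- With the linear growth of `p`, the estimate becomes `m² + k² ρ² ≤ 2 |m| |ξ - ξ₁| ρ ≤ |m| k ρ /
  -- 2`, which contradicts `2 |m| k ρ ≤ m² + k² ρ²` since `k ρ > 0`.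
  obtain ⟨ξ, h, hξ⟩ := (hest'.and hclose).exists
  have hpos := h.2.1.1
  have h1 := vacuumPressure_add_le hp hall hpos
  have h2 : m ξ ^ 2 / (U ξ).1 + k ^ 2 * (U ξ).1 ≤ 2 * |m ξ| * |ξ - ξ₁| := by linarith [h.2.2.2]
  rw [div_add' _ _ _ hpos.ne', div_le_iff₀ hpos, ← sq_abs] at h2
  have h4 : 0 ≤ |m ξ| := abs_nonneg _
  have h5 : |m ξ| * |ξ - ξ₁| ≤ |m ξ| * (k / 4) := mul_le_mul_of_nonneg_left hξ.le h4
  have h6 : 0 < k * (U ξ).1 := mul_pos hk0 hpos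
  nlinarith [sq_nonneg (|m ξ| - k * (U ξ).1), mul_le_mul_of_nonneg_right h5 hpos.le, mul_nonneg h4 h6.le]

/-! ### From weak formulations to fans -/

theorem aestronglyMeasurable_comp_of_continuousOn {α : Type*} [MeasurableSpace α] {μ : Measure α}
    {f : ℝ × ℝ → ℝ} (hf : ContinuousOn f {u | 0 < u.1}) {g : α → ℝ × ℝ}
    (hg : AEStronglyMeasurable g μ) (hpos : ∀ᵐ x ∂μ, 0 < (g x).1) :
    AEStronglyMeasurable (fun x => f (g x)) μ := by
  classical
  have hS : MeasurableSet {u : ℝ × ℝ | 0 < u.1} :=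
    (isOpen_Ioi.preimage continuous_fst).measurableSet
  have hm : Measurable ({u : ℝ × ℝ | 0 < u.1}.piecewise f fun _ => 0) :=
    hf.measurable_piecewise continuousOn_const hS
  refine (hm.comp_aemeasurable hg.aemeasurable).aestronglyMeasurable.congr ?_
  filter_upwards [hpos] with x hx
  exact piecewise_eq_of_mem _ _ _ hx

theorem continuousOn_dynPressure {p : ℝ → ℝ} (hp : PressureLaw p) :
    ContinuousOn (dynPressure p) {u | 0 < u.1} := fun _ hu =>
  (continuousAt_dynPressure hp hu).continuousWithinAt

theorem continuousAt_entropy {p : ℝ → ℝ} (hp : PressureLaw p) {ρref : ℝ} (hr : 0 < ρref)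
    {u : ℝ × ℝ} (hu : 0 < u.1) : ContinuousAt (entropy p ρref) u := by
  have h1 : ContinuousAt (fun u : ℝ × ℝ => u.2 ^ 2 / (2 * u.1)) u :=
    (continuousAt_snd.pow 2).div (continuousAt_const.mul continuousAt_fst) (by positivity)
  exact h1.add (continuousAt_fst.mul
    (((hasDerivAt_integral_pressure hp hr hu).continuousAt).comp continuousAt_fst))

theorem continuousAt_entropyFlux {p : ℝ → ℝ} (hp : PressureLaw p) {ρref : ℝ} (hr : 0 < ρref)
    {u : ℝ × ℝ} (hu : 0 < u.1) : ContinuousAt (entropyFlux p ρref) u :=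
  (continuousAt_snd.div continuousAt_fst hu.ne').mul
    ((continuousAt_entropy hp hr hu).add ((hp.continuousAt hu).comp continuousAt_fst))

theorem integrable_mul_of_bounded_on {f θ : ℝ → ℝ} {C : ℝ} (hf : AEStronglyMeasurable f)
    (hθ : Continuous θ) (hc : HasCompactSupport θ) (hC : ∀ᵐ x, θ x ≠ 0 → |f x| ≤ C) :
    Integrable (fun x => f x * θ x) := by
  refine ((hθ.norm.const_mul C).integrable_of_hasCompactSupport
    (hc.norm.mul_left)).mono' (hf.mul hθ.aestronglyMeasurable) ?_
  filter_upwards [hC] with x hx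
  rw [norm_mul]
  rcases eq_or_ne (θ x) 0 with h | h
  · simp [h]
  · exact mul_le_mul_of_nonneg_right (hx h) (norm_nonneg _)

/-- A distributional inequality `G' ≤ -a` on the half line forces `G` to jump downwards. -/
theorem right_le_left_of_weak {a G : ℝ → ℝ} {ξ₁ aL aR gL gR : ℝ} (hξ₁ : ξ₁ < 0)
    (ham : AEStronglyMeasurable a) (hGm : AEStronglyMeasurable G)
    (haL : Tendsto a (𝓝[<] ξ₁) (𝓝 aL)) (haR : Tendsto a (𝓝[>] ξ₁) (𝓝 aR))
    (hGL : Tendsto G (𝓝[<] ξ₁) (𝓝 gL)) (hGR : Tendsto G (𝓝[>] ξ₁) (𝓝 gR))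
    (h : ∀ ψ : ℝ → ℝ, ContDiff ℝ 1 ψ → HasCompactSupport ψ → tsupport ψ ⊆ Iio 0 →
      (∀ ξ, 0 ≤ ψ ξ) → Integrable (fun ξ => a ξ * ψ ξ) → Integrable (fun ξ => G ξ * deriv ψ ξ) →
      0 ≤ ∫ ξ, (G ξ * deriv ψ ξ - a ξ * ψ ξ)) : gR ≤ gL := by
  have hbd : ∃ C, ∀ᶠ ξ in 𝓝[≠] ξ₁, |a ξ| ≤ C ∧ |G ξ| ≤ C := by
    have key : ∀ {f : ℝ → ℝ} {l : Filter ℝ} {c : ℝ}, Tendsto f l (𝓝 c) →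
        ∀ᶠ ξ in l, |f ξ| ≤ |c| + 1 := fun {f l c} hf =>
      (hf.abs.eventually (eventually_lt_nhds (lt_add_one |c|))).mono fun _ h => h.le
    refine ⟨max (max (|aL| + 1) (|aR| + 1)) (max (|gL| + 1) (|gR| + 1)), ?_⟩
    rw [← Iio_union_Ioi, nhdsWithin_union, eventually_sup]
    constructor
    · filter_upwards [key haL, key hGL] with ξ h1 h2
      exact ⟨h1.trans ((le_max_left _ _).trans (le_max_left _ _)),
        h2.trans ((le_max_left _ _).trans (le_max_right _ _))⟩
    · filter_upwards [key haR, key hGR] with ξ h1 h2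
      exact ⟨h1.trans ((le_max_right _ _).trans (le_max_left _ _)),
        h2.trans ((le_max_right _ _).trans (le_max_right _ _))⟩
  obtain ⟨C, hC⟩ := hbd
  rw [eventually_nhdsWithin_iff] at hC
  obtain ⟨r, hr, hrC⟩ := Metric.eventually_nhds_iff.1 (hC.and (eventually_lt_nhds hξ₁))
  let β : ContDiffBump (0 : ℝ) := ⟨1 / 2, 1, by norm_num, by norm_num⟩
  have hβ1 : ContDiff ℝ 1 β := β.contDiff
  have hβc : Continuous β := β.continuous
  have hβdc : Continuous (deriv β) := hβ1.continuous_deriv le_rfl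
  have hβd : ∀ y, HasDerivAt β (deriv β y) y := fun y =>
    (hβ1.differentiable one_ne_zero y).hasDerivAt
  have hβs : ∀ y, 1 ≤ |y| → β y = 0 := fun y hy => by
    refine β.zero_of_le_dist ?_
    rw [Real.dist_0_eq_abs]; exact hy
  have hβds : ∀ y, 1 < |y| → deriv β y = 0 := fun y hy => by
    have : (β : ℝ → ℝ) =ᶠ[𝓝 y] fun _ => 0 := by
      filter_upwards [(continuous_abs.tendsto y).eventually (eventually_gt_nhds hy)] with z hz
      exact hβs z hz.le
    rw [this.deriv_eq, deriv_const]
  have hβ0 : β 0 = 1 := β.one_of_mem_closedBall (Metric.mem_closedBall_self (by norm_num [β]))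
  -- The inequality tested with `β((ξ - ξ₁) / ε)` and rescaled. As `ε → 0` the term with `a`
  -- disappears and the rest tends to `(gL - gR) β 0`, where `β 0 = 1`.
  set J : ℝ → ℝ := fun ε =>
    ∫ y, (G (ξ₁ + ε * y) * deriv β y - ε * (a (ξ₁ + ε * y) * β y)) with hJ
  have hbound : ∀ ε, 0 < ε → ε < r → ∀ y, y ≠ 0 → |y| ≤ 1 →
      |a (ξ₁ + ε * y)| ≤ C ∧ |G (ξ₁ + ε * y)| ≤ C := by
    intro ε h0 h1 y hy0 hy
    refine (hrC (y := ξ₁ + ε * y) ?_).1 ?_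
    · rw [Real.dist_eq, add_sub_cancel_left, abs_mul, abs_of_pos h0]
      nlinarith [abs_nonneg y]
    · simp only [mem_compl_iff, mem_singleton_iff]
      intro hcon
      have : ε * y = 0 := by linarith
      rcases mul_eq_zero.1 this with h | h
      · exact h0.ne' h
      · exact hy0 h
  have hJ0 : ∀ ε, 0 < ε → ε < r → 0 ≤ J ε := by
    intro ε h0 h1
    set ψ : ℝ → ℝ := fun ξ => β ((ξ - ξ₁) / ε) with hψ
    have hψd : ∀ ξ, HasDerivAt ψ (deriv β ((ξ - ξ₁) / ε) / ε) ξ := fun ξ => by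
      have h2 : HasDerivAt (fun ξ => (ξ - ξ₁) / ε) (1 / ε) ξ :=
        ((hasDerivAt_id ξ).sub_const ξ₁).div_const ε
      exact ((hβd _).comp ξ h2).congr_deriv (by ring)
    have hψde : deriv ψ = fun ξ => deriv β ((ξ - ξ₁) / ε) / ε := funext fun ξ => (hψd ξ).deriv
    have hψ1 : ContDiff ℝ 1 ψ := hβ1.comp (by fun_prop)
    have hsub : ∀ ξ, 1 < |(ξ - ξ₁) / ε| ∨ dist ξ ξ₁ ≤ ε := fun ξ => by
      rw [abs_div, abs_of_pos h0, lt_div_iff₀ h0, one_mul, Real.dist_eq]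
      exact lt_or_ge _ _
    have hψs : Function.support ψ ⊆ Metric.closedBall ξ₁ ε := fun ξ hξ =>
      (hsub ξ).resolve_left fun hcon => hξ (hβs _ hcon.le)
    have hψds : ∀ ξ, deriv ψ ξ ≠ 0 → dist ξ ξ₁ ≤ ε := fun ξ hξ =>
      (hsub ξ).resolve_left fun hcon => hξ (by rw [hψde]; simp only [hβds _ hcon, zero_div])
    have hψt : tsupport ψ ⊆ Metric.closedBall ξ₁ ε :=
      closure_minimal hψs Metric.isClosed_closedBall
    have hψc : HasCompactSupport ψ :=
      (isCompact_closedBall ξ₁ ε).of_isClosed_subset isClosed_closure hψt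
    have hne : ∀ᵐ ξ : ℝ, ξ ≠ ξ₁ := by simp [ae_iff, measure_singleton]
    have hint := h ψ hψ1 hψc (hψt.trans fun ξ hξ => (hrC (lt_of_le_of_lt hξ h1)).2)
      (fun ξ => β.nonneg)
      (integrable_mul_of_bounded_on (C := C) ham hψ1.continuous hψc (by
        filter_upwards [hne] with ξ h2 h3
        exact ((hrC (lt_of_le_of_lt (hψs h3) h1)).1 h2).1))
      (integrable_mul_of_bounded_on (C := C) hGm (hψ1.continuous_deriv le_rfl) hψc.deriv (by
        filter_upwards [hne] with ξ h2 h3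
        exact ((hrC (lt_of_le_of_lt (hψds ξ h3) h1)).1 h2).2))
    have e : J ε = ∫ ξ, (G ξ * deriv ψ ξ - a ξ * ψ ξ) := by
      set f : ℝ → ℝ := fun ξ => G ξ * deriv ψ ξ - a ξ * ψ ξ with hf
      have e1 := integral_add_left_eq_self (μ := volume) f ξ₁
      have e2 := Measure.integral_comp_mul_left (fun z => f (ξ₁ + z)) ε
      rw [e1, abs_of_pos (inv_pos.2 h0), smul_eq_mul] at e2
      have e3 : ∫ z, f z = ε * ∫ x, f (ξ₁ + ε * x) := by
        rw [e2]; field_simp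
      rw [e3, ← integral_const_mul]
      have e4 : ∀ y, (ξ₁ + ε * y - ξ₁) / ε = y := fun y => by
        rw [add_sub_cancel_left, mul_div_cancel_left₀ _ h0.ne']
      have e5 : ∀ y, deriv ψ (ξ₁ + ε * y) = deriv β y / ε := fun y => by rw [(hψd _).deriv, e4]
      have e6 : ∀ y, ψ (ξ₁ + ε * y) = β y := fun y => by simp only [hψ, e4]
      simp only [hJ, hf, e5, e6]
      congr 1
      ext y
      field_simp
    rw [e]
    exact hint
  have hlim : Tendsto J (𝓝[>] 0)
      (𝓝 (∫ y, (if y < 0 then gL else gR) * deriv β y)) := by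
    refine tendsto_integral_filter_of_dominated_convergence
      (fun y => C * |deriv β y| + r * (C * |β y|)) ?_ ?_ ?_ ?_
    · filter_upwards [Ioo_mem_nhdsGT hr] with ε hε
      have hq : Measure.QuasiMeasurePreserving (fun y : ℝ => ξ₁ + ε * y) := by
        have h1 : Measure.QuasiMeasurePreserving (fun y : ℝ => ε * y) := by
          refine ⟨by fun_prop, ?_⟩
          rw [Real.map_volume_mul_left hε.1.ne']
          exact Measure.smul_absolutelyContinuous
        exact (measurePreserving_add_left volume ξ₁).quasiMeasurePreserving.comp h1
      exact ((hGm.comp_quasiMeasurePreserving hq).mul hβdc.aestronglyMeasurable).sub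
        (((ham.comp_quasiMeasurePreserving hq).mul hβc.aestronglyMeasurable).const_mul ε)
    · filter_upwards [Ioo_mem_nhdsGT hr] with ε hε
      have hne : ∀ᵐ ξ : ℝ, ξ ≠ 0 := by simp [ae_iff, measure_singleton]
      filter_upwards [hne] with y hy
      rcases le_or_gt |y| 1 with h1 | h1
      · obtain ⟨h2, h3⟩ := hbound ε hε.1 hε.2 y hy h1
        refine (norm_sub_le _ _).trans (add_le_add ?_ ?_)
        · rw [norm_mul]
          exact mul_le_mul_of_nonneg_right h3 (abs_nonneg _)
        · rw [norm_mul, norm_mul, Real.norm_of_nonneg hε.1.le]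
          exact mul_le_mul hε.2.le (mul_le_mul_of_nonneg_right h2 (abs_nonneg _)) (by positivity)
            hr.le
      · rw [hβs y h1.le, hβds y h1]
        simp
    · refine ((continuous_const.mul hβdc.abs).integrable_of_hasCompactSupport ?_).add
        ((continuous_const.mul (continuous_const.mul hβc.abs)).integrable_of_hasCompactSupport ?_)
      · exact (β.hasCompactSupport.deriv.norm.mul_left)
      · exact ((β.hasCompactSupport.norm.mul_left).mul_left)
    · have hne : ∀ᵐ ξ : ℝ, ξ ≠ 0 := by simp [ae_iff, measure_singleton]
      filter_upwards [hne] with y hy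
      have hid : Tendsto (fun ε : ℝ => ε) (𝓝[>] 0) (𝓝 0) := nhdsWithin_le_nhds
      have hc0 : Tendsto (fun ε : ℝ => ξ₁ + ε * y) (𝓝[>] 0) (𝓝 ξ₁) := by
        simpa using (hid.mul_const y).const_add ξ₁
      have main : ∀ {cG ca : ℝ} {s : Set ℝ}, (∀ ε, 0 < ε → ξ₁ + ε * y ∈ s) →
          Tendsto G (𝓝[s] ξ₁) (𝓝 cG) → Tendsto a (𝓝[s] ξ₁) (𝓝 ca) →
          Tendsto (fun ε => G (ξ₁ + ε * y) * deriv β y - ε * (a (ξ₁ + ε * y) * β y)) (𝓝[>] 0)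
            (𝓝 (cG * deriv β y)) := by
        intro cG ca s hs h1 h2
        have h3 : Tendsto (fun ε : ℝ => ξ₁ + ε * y) (𝓝[>] 0) (𝓝[s] ξ₁) :=
          tendsto_nhdsWithin_iff.2 ⟨hc0, by
            filter_upwards [self_mem_nhdsWithin] with ε hε using hs ε hε⟩
        simpa using ((h1.comp h3).mul_const (deriv β y)).sub
          (hid.mul ((h2.comp h3).mul_const (β y)))
      rcases lt_or_gt_of_ne hy with h1 | h1
      · rw [if_pos h1]
        exact main (fun ε hε => by simp only [mem_Iio]; nlinarith) hGL haL
      · rw [if_neg h1.not_gt]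
        exact main (fun ε hε => by simp only [mem_Ioi]; nlinarith) hGR haR
  have hval : ∫ y, (if y < 0 then gL else gR) * deriv β y = gL - gR := by
    rw [← intervalIntegral.integral_eq_integral_of_support_subset (a := -2) (b := 2)]
    swap
    · intro y hy
      have : |y| ≤ 1 := not_lt.1 fun hcon => hy (by simp only [hβds y hcon, mul_zero])
      have := abs_le.1 this
      exact ⟨by linarith, by linarith⟩
    have hβ2 : β (-2) = 0 ∧ β 2 = 0 := ⟨hβs _ (by norm_num), hβs _ (by norm_num)⟩
    have hFTC : ∀ x y, ∫ z in x..y, deriv β z = β y - β x := fun x y =>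
      intervalIntegral.integral_eq_sub_of_hasDerivAt (fun z _ => hβd z)
        (hβdc.intervalIntegrable _ _)
    have e1 : ∀ᵐ y, y ∈ uIoc (-2 : ℝ) 0 →
        (if y < 0 then gL else gR) * deriv β y = gL * deriv β y := by
      have hne : ∀ᵐ ξ : ℝ, ξ ≠ 0 := by simp [ae_iff, measure_singleton]
      filter_upwards [hne] with y hy h1
      rw [uIoc_of_le (by norm_num)] at h1
      rw [if_pos (lt_of_le_of_ne h1.2 hy)]
    have e2 : ∀ y, y ∈ uIoc (0 : ℝ) 2 →
        (if y < 0 then gL else gR) * deriv β y = gR * deriv β y := by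
      intro y h1
      rw [uIoc_of_le (by norm_num)] at h1
      rw [if_neg h1.1.not_gt]
    rw [← intervalIntegral.integral_add_adjacent_intervals (b := 0),
      intervalIntegral.integral_congr_ae e1,
      intervalIntegral.integral_congr_ae (Eventually.of_forall e2),
      intervalIntegral.integral_const_mul, intervalIntegral.integral_const_mul, hFTC, hFTC,
      hβ2.1, hβ2.2, hβ0]
    · ring
    · refine (((hβdc.intervalIntegrable (-2) 0).const_mul gL).congr_ae ?_)
      exact (ae_restrict_iff' measurableSet_uIoc).2 (e1.mono fun y hy h => (hy h).symm)
    · refine (((hβdc.intervalIntegrable 0 2).const_mul gR).congr_ae ?_)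
      exact (ae_restrict_iff' measurableSet_uIoc).2
        (Eventually.of_forall fun y h => (e2 y h).symm)
  rw [hval] at hlim
  have := ge_of_tendsto hlim (by
    filter_upwards [Ioo_mem_nhdsGT hr] with ε hε using hJ0 ε hε.1 hε.2)
  linarith

/-- A self-similar weak entropy solution of bounded variation in `ξ < 0`, with subsonic values and
with state `ul` at `-∞`. -/
structure IsHalfSolution (p : ℝ → ℝ) (ρref : ℝ) (ul : ℝ × ℝ) (g : ℝ → ℝ × ℝ) : Prop where
  boundedVariation : BoundedVariationOn g univ
  measurable : AEStronglyMeasurable g volume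
  mem : ∀ᵐ ξ, ξ < 0 → g ξ ∈ subsonic p
  integrable : IntegrableOn (fun ξ => g ξ - ul) (Iio 0)
  mass : ∀ ψ : ℝ → ℝ, ContDiff ℝ 1 ψ → HasCompactSupport ψ → tsupport ψ ⊆ Iio 0 →
    ∫ ξ, (((g ξ).2 - ξ * (g ξ).1) * deriv ψ ξ - (g ξ).1 * ψ ξ) = 0
  momentum : ∀ ψ : ℝ → ℝ, ContDiff ℝ 1 ψ → HasCompactSupport ψ → tsupport ψ ⊆ Iio 0 →
    ∫ ξ, ((dynPressure p (g ξ) - ξ * (g ξ).2) * deriv ψ ξ - (g ξ).2 * ψ ξ) = 0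
  -- Integrability is a premise, so no bound of the entropy near vacuum is needed before vacuum has
  -- been excluded. Tests concentrated at a point with one-sided limits of the entropy satisfy it.
  entropy_ineq : ∀ ψ : ℝ → ℝ, ContDiff ℝ 1 ψ → HasCompactSupport ψ → tsupport ψ ⊆ Iio 0 →
    (∀ ξ, 0 ≤ ψ ξ) → Integrable (fun ξ => entropy p ρref (g ξ) * ψ ξ) →
    Integrable (fun ξ => (entropyFlux p ρref (g ξ) - ξ * entropy p ρref (g ξ)) * deriv ψ ξ) →
    0 ≤ ∫ ξ, ((entropyFlux p ρref (g ξ) - ξ * entropy p ρref (g ξ)) * deriv ψ ξ -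
      entropy p ρref (g ξ) * ψ ξ)

/-- A function of bounded variation is differentiable, hence continuous, almost everywhere. So a
profile may be replaced by its left-continuous version. -/
theorem ae_leftLim_eq {g : ℝ → ℝ × ℝ} (hg : BoundedVariationOn g univ) :
    g.leftLim =ᵐ[volume] g := by
  filter_upwards [hg.locallyBoundedVariationOn.ae_differentiableAt] with ξ hξ
  exact tendsto_nhds_unique (hg.tendsto_leftLim ξ)
    (hξ.continuousAt.tendsto.mono_left nhdsWithin_le_nhds)

theorem IsHalfSolution.congr_ae {p : ℝ → ℝ} {ρref : ℝ} {ul : ℝ × ℝ} {g g' : ℝ → ℝ × ℝ}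
    (h : IsHalfSolution p ρref ul g) (hg' : BoundedVariationOn g' univ) (he : g' =ᵐ[volume] g) :
    IsHalfSolution p ρref ul g' where
  boundedVariation := hg'
  measurable := h.measurable.congr he.symm
  mem := by filter_upwards [h.mem, he] with ξ h1 h2 h3; rw [h2]; exact h1 h3
  integrable := h.integrable.congr (by
    refine ae_restrict_of_ae ?_
    filter_upwards [he] with ξ h1; rw [h1])
  mass := fun ψ h1 h2 h3 => by
    rw [← h.mass ψ h1 h2 h3]
    refine integral_congr_ae ?_
    filter_upwards [he] with ξ h1; rw [h1]
  momentum := fun ψ h1 h2 h3 => by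
    rw [← h.momentum ψ h1 h2 h3]
    refine integral_congr_ae ?_
    filter_upwards [he] with ξ h1; rw [h1]
  entropy_ineq := fun ψ h1 h2 h3 h4 h5 h6 => by
    refine (h.entropy_ineq ψ h1 h2 h3 h4 (h5.congr ?_) (h6.congr ?_)).trans_eq
      (integral_congr_ae ?_)
    · filter_upwards [he] with ξ h1; rw [h1]
    · filter_upwards [he] with ξ h1; rw [h1]
    · filter_upwards [he] with ξ h1; rw [h1]

theorem weaklySubsonic_of_tendsto {p : ℝ → ℝ} (hp : PressureLaw p) {U : ℝ → ℝ × ℝ} {F : Filter ℝ}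
    [F.NeBot] {L : ℝ × ℝ} (hL : Tendsto U F (𝓝 L)) (h : ∀ᶠ ξ in F, U ξ ∈ subsonic p)
    (hpos : L.1 ≠ 0) : L ∈ weaklySubsonic p := by
  have h1 : Tendsto (fun ξ => (U ξ).1) F (𝓝 L.1) := (continuous_fst.tendsto L).comp hL
  have h2 : Tendsto (fun ξ => (U ξ).2) F (𝓝 L.2) := (continuous_snd.tendsto L).comp hL
  have h0 : 0 < L.1 :=
    lt_of_le_of_ne (ge_of_tendsto h1 (h.mono fun _ h => h.1.le)) hpos.symm
  refine ⟨h0, ?_, fun r hr => ?_⟩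
  · exact le_of_tendsto_of_tendsto h2.abs
      (h1.mul (((hp.continuousAt_deriv h0).tendsto.comp h1).sqrt))
      (h.mono fun _ h => (mem_subsonic_iff.1 h).2.le)
  · obtain ⟨ξ, h3, h4⟩ := (h.and (h1.eventually (eventually_lt_nhds hr))).exists
    exact (deriv_pos_of_mem_subsonic h3).trans_le (hp.deriv_le_deriv h3.1 h4.le)

theorem BoundedVariationOn.exists_norm_le {g : ℝ → ℝ × ℝ} (hg : BoundedVariationOn g univ) :
    ∃ M, ∀ ξ, ‖g ξ‖ ≤ M :=
  ⟨‖g 0‖ + (eVariationOn g univ).toReal, fun ξ => by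
    have := hg.dist_le (mem_univ ξ) (mem_univ 0)
    rw [dist_eq_norm] at this
    calc ‖g ξ‖ = ‖g 0 + (g ξ - g 0)‖ := by rw [add_sub_cancel]
      _ ≤ ‖g 0‖ + ‖g ξ - g 0‖ := norm_add_le _ _
      _ ≤ _ := by gcongr⟩

/-- For subsonic states `q² / ρ ≤ ρ p'(ρ)`, so bounded densities bound the dynamic pressure up to
vacuum. -/
theorem abs_dynPressure_le {p : ℝ → ℝ} (hp : PressureLaw p) {u : ℝ × ℝ} (hu : u ∈ subsonic p)
    {M : ℝ} (hM : u.1 ≤ M) : |dynPressure p u| ≤ M * deriv p M + p M := by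
  have hpos := hu.1
  have h1 := hp.deriv_le_deriv hpos hM
  have h2 := hp.monotoneOn hpos (hpos.trans_le hM) hM
  have h3 := hp.pos _ hpos
  have h4 := (mem_subsonic_iff.1 hu).2
  have h5 := hp.sq_sqrt_deriv hpos
  have h6 : u.2 ^ 2 / u.1 ≤ u.1 * deriv p u.1 := by
    rw [div_le_iff₀ hpos, ← sq_abs, ← h5]
    calc |u.2| ^ 2 ≤ (u.1 * √(deriv p u.1)) ^ 2 := pow_le_pow_left₀ (abs_nonneg _) h4.le 2
      _ = _ := by ring
  have h7 : u.1 * deriv p u.1 ≤ M * deriv p M :=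
    mul_le_mul hM h1 (hp.deriv_nonneg _ hpos) (hpos.le.trans hM)
  have h8 : 0 ≤ u.2 ^ 2 / u.1 := by positivity
  rw [dynPressure, abs_of_nonneg (by linarith)]
  linarith

/-- A left-continuous half-line solution is a fan. -/
theorem IsHalfSolution.isFan {p : ℝ → ℝ} (hp : PressureLaw p) {ρref : ℝ} (hr : 0 < ρref)
    {ul : ℝ × ℝ} {U : ℝ → ℝ × ℝ} (h : IsHalfSolution p ρref ul U)
    (hleft : ∀ ξ, Tendsto U (𝓝[<] ξ) (𝓝 (U ξ))) : IsFan p ul U U.rightLim := by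
  have hright : ∀ ξ, Tendsto U (𝓝[>] ξ) (𝓝 (U.rightLim ξ)) := h.boundedVariation.tendsto_rightLim
  obtain ⟨M, hM⟩ := BoundedVariationOn.exists_norm_le h.boundedVariation
  have hM1 : ∀ ξ, |(U ξ).1| ≤ M := fun ξ => (norm_fst_le (U ξ)).trans (hM ξ)
  have hM2 : ∀ ξ, |(U ξ).2| ≤ M := fun ξ => (norm_snd_le (U ξ)).trans (hM ξ)
  have hm1 : AEStronglyMeasurable (fun ξ => (U ξ).1) volume := h.measurable.fst
  have hm2 : AEStronglyMeasurable (fun ξ => (U ξ).2) volume := h.measurable.snd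
  have hi1 : LocallyIntegrable (fun ξ => (U ξ).1) volume :=
    (locallyIntegrable_const M).mono hm1
      (Eventually.of_forall fun ξ => (hM1 ξ).trans (le_abs_self M))
  have hi2 : LocallyIntegrable (fun ξ => (U ξ).2) volume :=
    (locallyIntegrable_const M).mono hm2
      (Eventually.of_forall fun ξ => (hM2 ξ).trans (le_abs_self M))
  have hid : AEStronglyMeasurable (fun ξ : ℝ => ξ) volume := aestronglyMeasurable_id
  have hlin : Continuous fun ξ : ℝ => |ξ| * M := continuous_abs.mul continuous_const
  obtain ⟨k₁, hk₁⟩ := ae_eq_sub_integral_of_weak hi1 (G := fun ξ => (U ξ).2 - ξ * (U ξ).1)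
    (by
      refine LocallyIntegrable.locallyIntegrableOn (hi2.sub ?_) _
      refine hlin.locallyIntegrable.mono (hid.mul hm1) (Eventually.of_forall fun ξ => ?_)
      rw [norm_mul]
      exact (mul_le_mul_of_nonneg_left (hM1 ξ) (norm_nonneg _)).trans (le_abs_self _)) h.mass
  have hPi : LocallyIntegrableOn (fun ξ => dynPressure p (U ξ)) (Iio 0) := by
    rw [locallyIntegrableOn_iff isOpen_Iio.isLocallyClosed]
    intro K hK0 hK
    have hae : ∀ᵐ ξ ∂volume.restrict K, U ξ ∈ subsonic p :=
      (ae_restrict_iff' hK.measurableSet).2 (h.mem.mono fun ξ h1 h2 => h1 (hK0 h2))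
    have hmeas : AEStronglyMeasurable (fun ξ => dynPressure p (U ξ)) (volume.restrict K) :=
      aestronglyMeasurable_comp_of_continuousOn (continuousOn_dynPressure hp) h.measurable.restrict
        (hae.mono fun _ h => h.1)
    refine ((integrable_const_iff (c := M * deriv p M + p M)).2
      (Or.inr (isFiniteMeasure_restrict.2 hK.measure_lt_top.ne))).mono' hmeas ?_
    filter_upwards [hae] with ξ hξ
    exact abs_dynPressure_le hp hξ ((le_abs_self _).trans (hM1 ξ))
  obtain ⟨k₂, hk₂⟩ := ae_eq_sub_integral_of_weak hi2
    (G := fun ξ => dynPressure p (U ξ) - ξ * (U ξ).2)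
    (hPi.sub (LocallyIntegrable.locallyIntegrableOn (by
      refine hlin.locallyIntegrable.mono (hid.mul hm2) (Eventually.of_forall fun ξ => ?_)
      rw [norm_mul]
      exact (mul_le_mul_of_nonneg_left (hM2 ξ) (norm_nonneg _)).trans (le_abs_self _)) _))
    h.momentum
  have hii : ∀ {f : ℝ → ℝ}, LocallyIntegrable f volume → ∀ x y, IntervalIntegrable f volume x y :=
    fun hf x y => (hf.integrableOn_isCompact isCompact_uIcc).intervalIntegrable
  -- Any limit at `ξ` along a filter compatible with null sets is not vacuum and satisfies the
  -- integrated equations, whose right side is continuous in `ξ`. Comparing the left and the right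
  -- limit gives the Rankine-Hugoniot condition.
  have hlim : ∀ {ξ : ℝ} {F : Filter ℝ} [F.NeBot] {L : ℝ × ℝ}, ξ < 0 → F ≤ 𝓝[≠] ξ ⊓ ae volume →
      Tendsto U F (𝓝 L) → L ∈ weaklySubsonic p ∧
      flux p L - ξ • L = (k₁ - ∫ η in (-1 : ℝ)..ξ, (U η).1, k₂ - ∫ η in (-1 : ℝ)..ξ, (U η).2) := by
    intro ξ F _ L hξ hF hL
    have hFae : F ≤ ae volume := hF.trans inf_le_right
    have hFn : F ≤ 𝓝 ξ := hF.trans (inf_le_left.trans nhdsWithin_le_nhds)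
    have hidF : Tendsto (fun η : ℝ => η) F (𝓝 ξ) := hFn
    have hneg : ∀ᶠ η in F, η < 0 := hFn (eventually_lt_nhds hξ)
    have hmem : ∀ᶠ η in F, U η ∈ subsonic p := by
      filter_upwards [hneg, hFae h.mem] with η h1 h2 using h2 h1
    have h1 : Tendsto (fun ξ => (U ξ).1) F (𝓝 L.1) := (continuous_fst.tendsto L).comp hL
    have hL1 : L.1 ≠ 0 := fun h0 =>
      not_tendsto_density_zero hp hξ hM hi1 hi2 h.mem hk₁ hk₂ hF (h0 ▸ h1)
    have hLm := weaklySubsonic_of_tendsto hp hL hmem hL1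
    refine ⟨hLm, ?_⟩
    have hfl : Tendsto (fun η => flux p (U η) - η • U η) F (𝓝 (flux p L - ξ • L)) :=
      ((hasFDerivAt_flux hp hLm.1).continuousAt.tendsto.comp hL).sub (hidF.smul hL)
    have hc1 := (intervalIntegral.continuous_primitive (hii hi1) (-1)).tendsto ξ
    have hc2 := (intervalIntegral.continuous_primitive (hii hi2) (-1)).tendsto ξ
    have hr : Tendsto (fun η => (k₁ - ∫ η in (-1 : ℝ)..η, (U η).1,
        k₂ - ∫ η in (-1 : ℝ)..η, (U η).2)) F
        (𝓝 (k₁ - ∫ η in (-1 : ℝ)..ξ, (U η).1, k₂ - ∫ η in (-1 : ℝ)..ξ, (U η).2)) :=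
      ((hc1.mono_left hFn).const_sub k₁).prodMk_nhds ((hc2.mono_left hFn).const_sub k₂)
    refine tendsto_nhds_unique hfl (hr.congr' ?_)
    filter_upwards [hneg, hFae hk₁, hFae hk₂] with η h1 h2 h3
    rw [← h2 h1, ← h3 h1]
    rfl
  have hL : ∀ ξ : ℝ, ξ < 0 → U ξ ∈ weaklySubsonic p ∧ flux p (U ξ) - ξ • U ξ =
      (k₁ - ∫ η in (-1 : ℝ)..ξ, (U η).1, k₂ - ∫ η in (-1 : ℝ)..ξ, (U η).2) := fun ξ hξ =>
    hlim (F := 𝓝[<] ξ ⊓ ae volume) hξ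
    (le_inf (inf_le_left.trans (nhdsWithin_mono _ fun x hx => ne_of_lt hx)) inf_le_right)
    ((hleft ξ).mono_left (inf_le_left (b := ae volume)))
  have hR : ∀ ξ : ℝ, ξ < 0 → U.rightLim ξ ∈ weaklySubsonic p ∧ flux p (U.rightLim ξ) - ξ • U.rightLim ξ =
      (k₁ - ∫ η in (-1 : ℝ)..ξ, (U η).1, k₂ - ∫ η in (-1 : ℝ)..ξ, (U η).2) := fun ξ hξ =>
    hlim (F := 𝓝[>] ξ ⊓ ae volume) hξ
    (le_inf (inf_le_left.trans (nhdsWithin_mono _ fun x hx => ne_of_gt hx)) inf_le_right)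
    ((hright ξ).mono_left (inf_le_left (b := ae volume)))
  have hRH : ∀ ξ < 0, flux p (U.rightLim ξ) - flux p (U ξ) = ξ • (U.rightLim ξ - U ξ) := by
    intro ξ hξ
    have := (hR ξ hξ).2.trans (hL ξ hξ).2.symm
    rw [smul_sub, sub_eq_sub_iff_sub_eq_sub]
    exact this
  have hpos : ∀ᵐ ξ ∂volume.restrict (Iio 0), 0 < (U ξ).1 :=
    (ae_restrict_iff' measurableSet_Iio).2 (Eventually.of_forall fun ξ hξ => (hL ξ hξ).1.1)
  refine ⟨fun ξ _ => hleft ξ, fun ξ _ => hright ξ, fun ξ hξ => (hL ξ hξ).1,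
    fun ξ hξ => (hR ξ hξ).1, hRH, fun ξ hξ => ?_, fun ξ hξ heq => ?_, ⟨M, fun ξ _ => hM ξ⟩,
    h.integrable⟩
  · refine eq_or_lax hp hr hξ (hL ξ hξ).1 (hR ξ hξ).1 (hRH ξ hξ) ?_
    -- The densities are known to be positive only for `ξ < 0`, and measurability of the composition
    -- requires this; hence the cut-off, which test functions supported in `ξ < 0` do not notice.
    have hEm : AEStronglyMeasurable ((Iio 0).indicator fun ξ => entropy p ρref (U ξ)) volume :=
      (aestronglyMeasurable_indicator_iff measurableSet_Iio).2
        (aestronglyMeasurable_comp_of_continuousOn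
          (fun u hu => (continuousAt_entropy hp hr hu).continuousWithinAt) h.measurable.restrict hpos)
    have hFm : AEStronglyMeasurable ((Iio 0).indicator fun ξ => entropyFlux p ρref (U ξ)) volume :=
      (aestronglyMeasurable_indicator_iff measurableSet_Iio).2
        (aestronglyMeasurable_comp_of_continuousOn
          (fun u hu => (continuousAt_entropyFlux hp hr hu).continuousWithinAt)
          h.measurable.restrict hpos)
    have hlimE : ∀ {l : Filter ℝ} {L : ℝ × ℝ} {f : ℝ × ℝ → ℝ}, l ≤ 𝓝 ξ → ContinuousAt f L →
        Tendsto U l (𝓝 L) → Tendsto ((Iio 0).indicator fun ξ => f (U ξ)) l (𝓝 (f L)) := by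
      intro l L f hl hf hUL
      refine (hf.tendsto.comp hUL).congr' ?_
      filter_upwards [hl (eventually_lt_nhds hξ)] with η hη
      exact (indicator_of_mem (s := Iio 0) hη _).symm
    have hidl : ∀ {l : Filter ℝ}, l ≤ 𝓝 ξ → Tendsto (fun η : ℝ => η) l (𝓝 ξ) := fun hl => hl
    have cEL := continuousAt_entropy hp hr (hL ξ hξ).1.1
    have cER := continuousAt_entropy hp hr (hR ξ hξ).1.1
    have cFL := continuousAt_entropyFlux hp hr (hL ξ hξ).1.1
    have cFR := continuousAt_entropyFlux hp hr (hR ξ hξ).1.1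
    have hin : ∀ {f : ℝ → ℝ} {ψ : ℝ → ℝ}, tsupport ψ ⊆ Iio 0 →
        (fun ξ => (Iio 0).indicator f ξ * ψ ξ) = fun ξ => f ξ * ψ ξ := by
      intro f ψ hs
      ext η
      by_cases hη : η ∈ Iio (0 : ℝ)
      · rw [indicator_of_mem hη]
      · rw [image_eq_zero_of_notMem_tsupport fun hcon => hη (hs hcon), mul_zero, mul_zero]
    have key := right_le_left_of_weak hξ hEm (hFm.sub (hid.mul hEm))
      (hlimE nhdsWithin_le_nhds cEL (hleft ξ)) (hlimE nhdsWithin_le_nhds cER (hright ξ))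
      ((hlimE nhdsWithin_le_nhds cFL (hleft ξ)).sub
        ((hidl nhdsWithin_le_nhds).mul (hlimE nhdsWithin_le_nhds cEL (hleft ξ))))
      ((hlimE nhdsWithin_le_nhds cFR (hright ξ)).sub
        ((hidl nhdsWithin_le_nhds).mul (hlimE nhdsWithin_le_nhds cER (hright ξ)))) ?_
    · linarith
    intro ψ h1 h2 h3 h4 h5 h6
    have h3' : tsupport (deriv ψ) ⊆ Iio 0 := tsupport_deriv_subset.trans h3
    have e1 := hin (f := fun ξ => entropy p ρref (U ξ)) h3
    have e2 : (fun ξ => ((Iio 0).indicator (fun ξ => entropyFlux p ρref (U ξ)) ξ -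
        ξ * (Iio 0).indicator (fun ξ => entropy p ρref (U ξ)) ξ) * deriv ψ ξ) =
        fun ξ => (entropyFlux p ρref (U ξ) - ξ * entropy p ρref (U ξ)) * deriv ψ ξ := by
      ext η
      have e3 := congrFun (hin (f := fun ξ => entropy p ρref (U ξ)) h3') η
      have e4 := congrFun (hin (f := fun ξ => entropyFlux p ρref (U ξ)) h3') η
      rw [sub_mul, sub_mul, e4, mul_assoc, e3, mul_assoc]
    have h5' := h5
    have h6' := h6
    rw [e1] at h5'
    have h6'' : Integrable (fun ξ => (entropyFlux p ρref (U ξ) - ξ * entropy p ρref (U ξ)) *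
        deriv ψ ξ) := e2 ▸ h6'
    refine (h.entropy_ineq ψ h1 h2 h3 h4 h5' h6'').trans_eq ?_
    congr 1
    ext η
    exact congrArg₂ (· - ·) (congrFun e2 η).symm (congrFun e1 η).symm
  · have hcont : ContinuousAt U ξ := by
      refine continuousAt_iff_continuous_left'_right'.2 ⟨hleft ξ, ?_⟩
      have := hright ξ
      rwa [← heq] at this
    have d1 := intervalIntegral.integral_hasDerivAt_right (hii hi1 (-1) ξ)
      (hm1.stronglyMeasurableAtFilter) (continuous_fst.continuousAt.comp hcont)
    have d2 := intervalIntegral.integral_hasDerivAt_right (hii hi2 (-1) ξ)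
      (hm2.stronglyMeasurableAtFilter) (continuous_snd.continuousAt.comp hcont)
    refine ((d1.const_sub k₁).prodMk (d2.const_sub k₂)).congr_of_eventuallyEq ?_
    filter_upwards [eventually_lt_nhds hξ] with η hη
    exact (hL η hη).2

/-! ### Self-similar test functions -/

theorem integral_mul_deriv_id {χ : ℝ → ℝ} (hχ : ContDiff ℝ 1 χ) (hc : HasCompactSupport χ) :
    ∫ t, t * deriv χ t = -∫ t, χ t := by
  have hd : Continuous (deriv χ) := hχ.continuous_deriv le_rfl
  have i1 : Integrable fun t => t * deriv χ t :=
    (continuous_id.mul hd).integrable_of_hasCompactSupport hc.deriv.mul_left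
  have i2 : Integrable χ := hχ.continuous.integrable_of_hasCompactSupport hc
  have i3 : Integrable fun t => t * χ t :=
    (continuous_id.mul hχ.continuous).integrable_of_hasCompactSupport hc.mul_left
  have := integral_eq_zero_of_hasDerivAt_of_integrable (f := fun t => t * χ t)
    (f' := fun t => 1 * χ t + t * deriv χ t)
    (fun t => (hasDerivAt_id t).mul (hχ.differentiable one_ne_zero t).hasDerivAt)
    (by simp only [one_mul]; exact i2.add i1) i3
  simp only [one_mul] at this
  rw [integral_add i2 i1] at this
  linarith

theorem isTest_mul_comp_div {χ ψ : ℝ → ℝ} (hχ : ContDiff ℝ 1 χ) (hχs : tsupport χ ⊆ Icc 1 2)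
    (hψ : ContDiff ℝ 1 ψ) (hψc : HasCompactSupport ψ) :
    IsTest fun z => χ z.1 * ψ (z.2 / z.1) := by
  obtain ⟨R, hR⟩ := hψc.isCompact.isBounded.subset_closedBall 0
  have hts : tsupport (fun z : ℝ × ℝ => χ z.1 * ψ (z.2 / z.1)) ⊆
      Icc 1 2 ×ˢ Icc (-(2 * |R|)) (2 * |R|) := by
    refine closure_minimal (fun z hz => ?_) (isClosed_Icc.prod isClosed_Icc)
    have h1 := hχs (subset_tsupport χ (left_ne_zero_of_mul hz))
    have h2 := hR (subset_tsupport ψ (right_ne_zero_of_mul hz))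
    have h3 : 0 < z.1 := lt_of_lt_of_le one_pos h1.1
    rw [Metric.mem_closedBall, Real.dist_0_eq_abs, abs_div, abs_of_pos h3,
      div_le_iff₀ h3] at h2
    refine ⟨h1, abs_le.1 (h2.trans ?_)⟩
    nlinarith [h1.1, h1.2, le_abs_self R, abs_nonneg R]
  refine ⟨contDiff_iff_contDiffAt.2 fun z => ?_,
    (isCompact_Icc.prod isCompact_Icc).of_isClosed_subset isClosed_closure hts,
    hts.trans fun z hz => ⟨lt_of_lt_of_le one_pos hz.1.1, mem_univ _⟩⟩
  by_cases hz : z ∈ tsupport fun z : ℝ × ℝ => χ z.1 * ψ (z.2 / z.1)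
  · have : z.1 ≠ 0 := (lt_of_lt_of_le one_pos (hts hz).1.1).ne'
    exact (hχ.contDiffAt.comp z contDiffAt_fst).mul
      (hψ.contDiffAt.comp z (contDiffAt_snd.div contDiffAt_fst this))
  · exact contDiffAt_const.congr_of_eventuallyEq (notMem_tsupport_iff_eventuallyEq.1 hz)

/-- Substituting `x = t ξ` separates the variables. The `t`-derivative of `χ` comes with a factor
`t`, and `∫ t χ' = -∫ χ` produces the zero-order term of the equation in `ξ`. -/
theorem integral_selfSimilar_test {χ ψ : ℝ → ℝ} (hχ : ContDiff ℝ 1 χ)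
    (hχs : tsupport χ ⊆ Icc 1 2) (hψ : ContDiff ℝ 1 ψ)
    {A B : ℝ → ℝ → ℝ} {a b : ℝ → ℝ} (hA : ∀ t, 0 < t → A t =ᵐ[volume] fun x => a (x / t))
    (hB : ∀ t, 0 < t → B t =ᵐ[volume] fun x => b (x / t))
    (ha : Integrable fun ξ => a ξ * ψ ξ) (hb : Integrable fun ξ => (b ξ - ξ * a ξ) * deriv ψ ξ) :
    ∫ t in Ioi (0 : ℝ), ∫ x, (A t x * dt (fun z => χ z.1 * ψ (z.2 / z.1)) t x +
        B t x * dx (fun z => χ z.1 * ψ (z.2 / z.1)) t x) =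
      (∫ t, χ t) * ∫ ξ, ((b ξ - ξ * a ξ) * deriv ψ ξ - a ξ * ψ ξ) := by
  have hχc : HasCompactSupport χ := isCompact_Icc.of_isClosed_subset isClosed_closure hχs
  have inner : ∀ t, 0 < t → ∫ x, (A t x * dt (fun z => χ z.1 * ψ (z.2 / z.1)) t x +
        B t x * dx (fun z => χ z.1 * ψ (z.2 / z.1)) t x) =
      t * deriv χ t * (∫ ξ, a ξ * ψ ξ) + χ t * ∫ ξ, (b ξ - ξ * a ξ) * deriv ψ ξ := by
    intro t ht
    have hdt : ∀ x, dt (fun z => χ z.1 * ψ (z.2 / z.1)) t x =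
        deriv χ t * ψ (x / t) - χ t * (deriv ψ (x / t) * (x / t) / t) := fun x => by
      have h1 : HasDerivAt (fun s : ℝ => x / s) (-x / t ^ 2) t :=
        ((hasDerivAt_const t x).div (hasDerivAt_id t) ht.ne').congr_deriv (by simp)
      refine (((hχ.differentiable one_ne_zero t).hasDerivAt.mul
        ((hψ.differentiable one_ne_zero (x / t)).hasDerivAt.comp t h1)).congr_deriv ?_).deriv
      field_simp
      simp
      ring
    have hdx : ∀ x, dx (fun z => χ z.1 * ψ (z.2 / z.1)) t x = χ t * (deriv ψ (x / t) / t) :=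
      fun x => by
      have h1 : HasDerivAt (fun y : ℝ => y / t) (1 / t) x := (hasDerivAt_id x).div_const t
      refine ((((hψ.differentiable one_ne_zero (x / t)).hasDerivAt.comp x h1).const_mul
        (χ t)).congr_deriv ?_).deriv
      ring
    have e1 : ∫ x, (A t x * dt (fun z => χ z.1 * ψ (z.2 / z.1)) t x +
        B t x * dx (fun z => χ z.1 * ψ (z.2 / z.1)) t x) =
        ∫ x, (fun ξ => deriv χ t * (a ξ * ψ ξ) + χ t / t * ((b ξ - ξ * a ξ) * deriv ψ ξ))
          (x / t) := by
      refine integral_congr_ae ?_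
      filter_upwards [hA t ht, hB t ht] with x h1 h2
      rw [hdt, hdx, h1, h2]
      field_simp
      ring
    rw [e1, Measure.integral_comp_div
      (fun ξ => deriv χ t * (a ξ * ψ ξ) + χ t / t * ((b ξ - ξ * a ξ) * deriv ψ ξ)) t, integral_add (ha.const_mul _) (hb.const_mul _),
      integral_const_mul, integral_const_mul, abs_of_pos ht, smul_eq_mul]
    field_simp
  rw [setIntegral_congr_fun measurableSet_Ioi fun t ht => inner t ht]
  have hz : ∀ t, t ∉ Ioi (0 : ℝ) → t ∉ tsupport χ := fun t ht hcon =>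
    ht (lt_of_lt_of_le one_pos (hχs hcon).1)
  rw [setIntegral_eq_integral_of_forall_compl_eq_zero fun t ht => by
    rw [image_eq_zero_of_notMem_tsupport (hz t ht),
      image_eq_zero_of_notMem_tsupport fun hcon => hz t ht (tsupport_deriv_subset hcon)]
    simp]
  have i1 : Integrable fun t => t * deriv χ t :=
    (continuous_id.mul (hχ.continuous_deriv le_rfl)).integrable_of_hasCompactSupport
      hχc.deriv.mul_left
  have i2 : Integrable χ := hχ.continuous.integrable_of_hasCompactSupport hχc
  rw [integral_add (i1.mul_const _) (i2.mul_const _), integral_mul_const, integral_mul_const,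
    integral_mul_deriv_id hχ hχc, integral_sub hb ha]
  ring

/-! ### Reflection -/

/-- The state seen in the reflected pipe. -/
def refl (u : ℝ × ℝ) : ℝ × ℝ := (u.1, -u.2)

theorem refl_refl (u : ℝ × ℝ) : refl (refl u) = u := by simp [refl]

theorem continuous_refl : Continuous refl := continuous_fst.prodMk continuous_snd.neg

theorem norm_refl_sub (u v : ℝ × ℝ) : ‖refl u - refl v‖ = ‖u - v‖ := by
  have : refl u - refl v = ((u - v).1, -(u - v).2) := by ext <;> simp [refl]; ring
  rw [this, Prod.norm_def, Prod.norm_def, norm_neg]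

theorem dynPressure_refl (p : ℝ → ℝ) (u : ℝ × ℝ) : dynPressure p (refl u) = dynPressure p u := by
  simp [dynPressure, refl]

theorem entropy_refl (p : ℝ → ℝ) (ρref : ℝ) (u : ℝ × ℝ) :
    entropy p ρref (refl u) = entropy p ρref u := by
  simp [entropy, refl]

theorem entropyFlux_refl (p : ℝ → ℝ) (ρref : ℝ) (u : ℝ × ℝ) :
    entropyFlux p ρref (refl u) = -entropyFlux p ρref u := by
  rw [entropyFlux, entropy_refl]
  simp [entropyFlux, refl, neg_div]

theorem refl_mem_subsonic {p : ℝ → ℝ} {u : ℝ × ℝ} : refl u ∈ subsonic p ↔ u ∈ subsonic p := by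
  simp [subsonic, refl, neg_div]

theorem lipschitzWith_refl : LipschitzWith 1 refl :=
  LipschitzWith.of_dist_le_mul fun u v => by
    rw [dist_eq_norm, dist_eq_norm, norm_refl_sub, NNReal.coe_one, one_mul]

/-! ### Profiles of self-similar solutions -/

/-- Substitution of `-ξ`: the weak form is invariant under reflection when the flux changes sign and
the density does not. -/
theorem weak_comp_neg (a b ψ : ℝ → ℝ) :
    ∫ ξ, ((-b (-ξ) - ξ * a (-ξ)) * deriv ψ ξ - a (-ξ) * ψ ξ) =
      ∫ ξ, ((b ξ - ξ * a ξ) * deriv (fun η => ψ (-η)) ξ - a ξ * ψ (-ξ)) := by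
  rw [← integral_neg_eq_self fun ξ =>
    (b ξ - ξ * a ξ) * deriv (fun η => ψ (-η)) ξ - a ξ * ψ (-ξ)]
  congr 1
  ext ξ
  rw [deriv_comp_neg, neg_neg]
  ring

/-- Profiles `g = g(x / t)` of self-similar weak entropy solutions with Riemann datum `(ul, ur)`;
the equations are tested away from the kink. -/
structure IsProfile (p : ℝ → ℝ) (ρref : ℝ) (ul ur : ℝ × ℝ) (g : ℝ → ℝ × ℝ) : Prop where
  boundedVariation : BoundedVariationOn g univ
  measurable : AEStronglyMeasurable g volume
  mem : ∀ᵐ ξ, g ξ ∈ subsonic p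
  integrable_left : IntegrableOn (fun ξ => g ξ - ul) (Iio 0)
  integrable_right : IntegrableOn (fun ξ => g ξ - ur) (Ioi 0)
  mass : ∀ ψ : ℝ → ℝ, ContDiff ℝ 1 ψ → HasCompactSupport ψ → 0 ∉ tsupport ψ →
    ∫ ξ, (((g ξ).2 - ξ * (g ξ).1) * deriv ψ ξ - (g ξ).1 * ψ ξ) = 0
  momentum : ∀ ψ : ℝ → ℝ, ContDiff ℝ 1 ψ → HasCompactSupport ψ → 0 ∉ tsupport ψ →
    ∫ ξ, ((dynPressure p (g ξ) - ξ * (g ξ).2) * deriv ψ ξ - (g ξ).2 * ψ ξ) = 0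
  entropy_ineq : ∀ ψ : ℝ → ℝ, ContDiff ℝ 1 ψ → HasCompactSupport ψ → 0 ∉ tsupport ψ →
    (∀ ξ, 0 ≤ ψ ξ) → Integrable (fun ξ => entropy p ρref (g ξ) * ψ ξ) →
    Integrable (fun ξ => (entropyFlux p ρref (g ξ) - ξ * entropy p ρref (g ξ)) * deriv ψ ξ) →
    0 ≤ ∫ ξ, ((entropyFlux p ρref (g ξ) - ξ * entropy p ρref (g ξ)) * deriv ψ ξ -
      entropy p ρref (g ξ) * ψ ξ)

theorem IsProfile.isHalfSolution {p : ℝ → ℝ} {ρref : ℝ} {ul ur : ℝ × ℝ} {g : ℝ → ℝ × ℝ}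
    (h : IsProfile p ρref ul ur g) : IsHalfSolution p ρref ul g where
  boundedVariation := h.boundedVariation
  measurable := h.measurable
  mem := h.mem.mono fun _ h _ => h
  integrable := h.integrable_left
  mass := fun ψ h1 h2 h3 => h.mass ψ h1 h2 fun h0 => lt_irrefl (0 : ℝ) (h3 h0)
  momentum := fun ψ h1 h2 h3 => h.momentum ψ h1 h2 fun h0 => lt_irrefl (0 : ℝ) (h3 h0)
  entropy_ineq := fun ψ h1 h2 h3 => h.entropy_ineq ψ h1 h2 fun h0 => lt_irrefl (0 : ℝ) (h3 h0)

/-- Transfers everything known on `ξ < 0` to `ξ > 0`. -/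
theorem IsProfile.reflect {p : ℝ → ℝ} {ρref : ℝ} {ul ur : ℝ × ℝ} {g : ℝ → ℝ × ℝ}
    (h : IsProfile p ρref ul ur g) :
    IsProfile p ρref (refl ur) (refl ul) fun ξ => refl (g (-ξ)) := by
  have hneg : MeasurePreserving (fun ξ : ℝ => -ξ) volume volume :=
    Measure.measurePreserving_neg volume
  have hts : ∀ ψ : ℝ → ℝ, tsupport (fun ξ => ψ (-ξ)) = (fun ξ => -ξ) ⁻¹' tsupport ψ := fun ψ =>
    tsupport_comp_eq_preimage ψ (Homeomorph.neg ℝ)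
  have hψ : ∀ ψ : ℝ → ℝ, ContDiff ℝ 1 ψ → HasCompactSupport ψ → 0 ∉ tsupport ψ →
      ContDiff ℝ 1 (fun ξ => ψ (-ξ)) ∧ HasCompactSupport (fun ξ => ψ (-ξ)) ∧
      0 ∉ tsupport fun ξ => ψ (-ξ) := fun ψ h1 h2 h3 =>
    ⟨h1.comp contDiff_neg, h2.comp_homeomorph (Homeomorph.neg ℝ), by rw [hts]; simpa using h3⟩
  have hint : ∀ {s t : Set ℝ} {u : ℝ × ℝ}, MeasurableSet t → (fun ξ => -ξ) ⁻¹' t = s →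
      IntegrableOn (fun ξ => g ξ - u) t →
      IntegrableOn (fun ξ => refl (g (-ξ)) - refl u) s := by
    intro s t u ht hst hi
    have h1 := (hneg.integrableOn_comp_preimage (Homeomorph.neg ℝ).measurableEmbedding).2 hi
    rw [hst] at h1
    refine Integrable.mono h1 ?_ (Eventually.of_forall fun ξ => (norm_refl_sub _ _).le)
    exact ((continuous_refl.comp_aestronglyMeasurable
      (h.measurable.comp_measurePreserving hneg)).sub aestronglyMeasurable_const).restrict
  refine ⟨?_, continuous_refl.comp_aestronglyMeasurable
      (h.measurable.comp_measurePreserving hneg), ?_,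
    hint measurableSet_Ioi (by simp) h.integrable_right,
    hint measurableSet_Iio (by simp) h.integrable_left,
    fun ψ h1 h2 h3 => ?_, fun ψ h1 h2 h3 => ?_, fun ψ h1 h2 h3 h4 h5 h6 => ?_⟩
  · have h1 : BoundedVariationOn (fun ξ => g (-ξ)) univ := by
      have := eVariationOn.comp_le_of_antitoneOn g (t := univ) (fun ξ : ℝ => -ξ)
        (fun x _ y _ hxy => neg_le_neg hxy) (mapsTo_univ _ univ)
      exact ne_top_of_le_ne_top h.boundedVariation this
    exact lipschitzWith_refl.comp_boundedVariationOn h1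
  · exact (hneg.quasiMeasurePreserving.ae h.mem).mono fun ξ h => refl_mem_subsonic.2 h
  · obtain ⟨g1, g2, g3⟩ := hψ ψ h1 h2 h3
    rw [← h.mass _ g1 g2 g3, ← weak_comp_neg]
    rfl
  · obtain ⟨g1, g2, g3⟩ := hψ ψ h1 h2 h3
    have := h.momentum _ g1 g2 g3
    rw [← weak_comp_neg, ← neg_eq_zero, ← integral_neg] at this
    rw [← this]
    congr 1
    ext ξ
    rw [dynPressure_refl, refl]
    ring
  · obtain ⟨g1, g2, g3⟩ := hψ ψ h1 h2 h3
    simp only [entropy_refl, entropyFlux_refl] at h5 h6 ⊢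
    rw [weak_comp_neg (fun ξ => entropy p ρref (g ξ)) (fun ξ => entropyFlux p ρref (g ξ))]
    refine h.entropy_ineq _ g1 g2 g3 (fun ξ => h4 _) ?_ ?_
    · simpa using h5.comp_neg
    · refine h6.comp_neg.congr (Eventually.of_forall fun ξ => ?_)
      simp only [neg_neg, deriv_comp_neg]
      ring

theorem ae_comp_div {P : ℝ → Prop} (h : ∀ᵐ x, P x) {t : ℝ} (ht : 0 < t) : ∀ᵐ x, P (x / t) := by
  have : Measure.QuasiMeasurePreserving (fun x : ℝ => x * t⁻¹) volume volume := by
    refine ⟨measurable_mul_const _, ?_⟩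
    rw [Real.map_volume_mul_right (inv_pos.2 ht).ne']
    exact Measure.smul_absolutelyContinuous
  simpa only [div_eq_mul_inv] using this.ae h

/-- The kink conditions for the traces at `0` of a profile. -/
def HasKinkTraces (p : ℝ → ℝ) (c : ℝ) (g : ℝ → ℝ × ℝ) : Prop :=
  ∃ q Pm Pp, LeftTrace (fun ξ => (g ξ).2) q ∧ RightTrace (fun ξ => (g ξ).2) q ∧
    LeftTrace (fun ξ => dynPressure p (g ξ)) Pm ∧ RightTrace (fun ξ => dynPressure p (g ξ)) Pp ∧
    Pp - Pm = -(c * q)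

/-- The version of bounded variation at time `1` serves as profile at all times. The equations in
`ξ` come from testing with `χ(t) ψ(x / t)`, where `χ ≥ 0` has positive integral. -/
theorem IsWeakEntropySolution.exists_profile {p : ℝ → ℝ} (hp : PressureLaw p) {ρref c : ℝ}
    {ul ur : ℝ × ℝ} {w : ℝ → ℝ → ℝ × ℝ}
    (h : IsWeakEntropySolution p ρref c (riemannDatum ul ur) w) (hs : IsSelfSimilar w)
    (hsub : IsSubsonicValued p w) :
    ∃ g, IsProfile p ρref ul ur g ∧ HasKinkTraces p c g ∧
      ∀ t, 0 < t → w t =ᵐ[volume] fun x => g (x / t) := by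
  obtain ⟨g, hg, hwg⟩ := h.boundedVariation 1 zero_le_one
  obtain ⟨U, hU⟩ := hs
  have hUg : U =ᵐ[volume] g := by
    filter_upwards [hU 1 one_pos, hwg] with x h1 h2
    rw [← h2, h1, div_one]
  have hgt : ∀ t, 0 < t → w t =ᵐ[volume] fun x => g (x / t) := fun t ht => by
    filter_upwards [hU t ht, ae_comp_div hUg ht] with x h1 h2
    rw [h1, h2]
  have hdat : Measurable (riemannDatum ul ur) :=
    Measurable.ite measurableSet_Iio measurable_const measurable_const
  have hint : Integrable fun x => g x - riemannDatum ul ur x :=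
    (h.integrable 1 zero_le_one).congr (by filter_upwards [hwg] with x hx; rw [hx])
  have hm : AEStronglyMeasurable g volume := by
    have := hint.aestronglyMeasurable.add hdat.aestronglyMeasurable
    refine this.congr (Eventually.of_forall fun x => ?_)
    simp
  have hmem : ∀ᵐ ξ, g ξ ∈ subsonic p := by
    filter_upwards [hsub 1 one_pos, hwg] with x h1 h2
    rwa [← h2]
  obtain ⟨M, hM⟩ := BoundedVariationOn.exists_norm_le hg
  have hM1 : ∀ ξ, |(g ξ).1| ≤ M := fun ξ => (norm_fst_le (g ξ)).trans (hM ξ)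
  have hM2 : ∀ ξ, |(g ξ).2| ≤ M := fun ξ => (norm_snd_le (g ξ)).trans (hM ξ)
  let χ : ContDiffBump (3 / 2 : ℝ) := ⟨1 / 4, 1 / 2, by norm_num, by norm_num⟩
  have hχ : ContDiff ℝ 1 χ := χ.contDiff
  have hχs : tsupport χ ⊆ Icc 1 2 := by
    rw [χ.tsupport_eq, Real.closedBall_eq_Icc]
    norm_num [χ]
  have hχi : 0 < ∫ t, χ t := χ.integral_pos
  have hnd : ∀ f : ℝ → ℝ, AEStronglyMeasurable f volume → (∃ C, ∀ᵐ x, |f x| ≤ C) →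
      ∀ ψ : ℝ → ℝ, Continuous ψ → HasCompactSupport ψ → Integrable fun x => f x * ψ x :=
    fun f hf ⟨C, hC⟩ ψ h1 h2 => integrable_mul_of_bounded_on hf h1 h2 (hC.mono fun _ h _ => h)
  have hidd : ∀ f : ℝ → ℝ, AEStronglyMeasurable f volume → (∃ C, ∀ᵐ x, |f x| ≤ C) →
      ∀ ψ : ℝ → ℝ, Continuous ψ → HasCompactSupport ψ → Integrable fun x => x * f x * ψ x :=
    fun f hf hC ψ h1 h2 =>
      (hnd f hf hC (fun x => x * ψ x) (continuous_id.mul h1) h2.mul_left).congr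
        (Eventually.of_forall fun x => by ring)
  have m1 : AEStronglyMeasurable (fun ξ => (g ξ).1) volume := hm.fst
  have m2 : AEStronglyMeasurable (fun ξ => (g ξ).2) volume := hm.snd
  have m3 : AEStronglyMeasurable (fun ξ => dynPressure p (g ξ)) volume :=
    aestronglyMeasurable_comp_of_continuousOn (continuousOn_dynPressure hp) hm
      (hmem.mono fun _ h => h.1)
  have b1 : ∃ C, ∀ᵐ ξ, |(g ξ).1| ≤ C := ⟨M, Eventually.of_forall hM1⟩
  have b2 : ∃ C, ∀ᵐ ξ, |(g ξ).2| ≤ C := ⟨M, Eventually.of_forall hM2⟩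
  have b3 : ∃ C, ∀ᵐ ξ, |dynPressure p (g ξ)| ≤ C :=
    ⟨_, hmem.mono fun ξ hξ => abs_dynPressure_le hp hξ ((le_abs_self _).trans (hM1 ξ))⟩
  refine ⟨g, ⟨hg, hm, hmem, ?_, ?_, fun ψ h1 h2 h3 => ?_, fun ψ h1 h2 h3 => ?_,
    fun ψ h1 h2 h3 h4 h5 h6 => ?_⟩, ?_, hgt⟩
  · refine hint.integrableOn.congr_fun (fun x hx => ?_) measurableSet_Iio
    simp only [riemannDatum, if_pos (show x < 0 from hx)]
  · refine hint.integrableOn.congr_fun (fun x hx => ?_) measurableSet_Ioi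
    simp only [riemannDatum, if_neg (not_lt.2 (le_of_lt (show 0 < x from hx)))]
  · have d1 := h1.continuous_deriv le_rfl
    have := h.mass _ (isTest_mul_comp_div hχ hχs h1 h2)
    rw [integral_selfSimilar_test hχ hχs h1 (A := fun t x => (w t x).1)
      (B := fun t x => (w t x).2) (a := fun ξ => (g ξ).1) (b := fun ξ => (g ξ).2)
      (fun t ht => (hgt t ht).mono fun x hx => congrArg Prod.fst hx)
      (fun t ht => (hgt t ht).mono fun x hx => congrArg Prod.snd hx)
      (hnd _ m1 b1 ψ h1.continuous h2)
      (((hnd _ m2 b2 _ d1 h2.deriv).sub (hidd _ m1 b1 _ d1 h2.deriv)).congr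
        (Eventually.of_forall fun ξ => by simp only [Pi.sub_apply]; ring))] at this
    exact (mul_eq_zero.1 this).resolve_left hχi.ne'
  · have d1 := h1.continuous_deriv le_rfl
    obtain ⟨q₀, -, hq⟩ := h.momentum
    have := hq _ (isTest_mul_comp_div hχ hχs h1 h2)
    rw [integral_selfSimilar_test hχ hχs h1 (A := fun t x => (w t x).2)
      (B := fun t x => dynPressure p (w t x)) (a := fun ξ => (g ξ).2)
      (b := fun ξ => dynPressure p (g ξ))
      (fun t ht => (hgt t ht).mono fun x hx => congrArg Prod.snd hx)
      (fun t ht => (hgt t ht).mono fun x hx => congrArg (dynPressure p) hx)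
      (hnd _ m2 b2 ψ h1.continuous h2)
      (((hnd _ m3 b3 _ d1 h2.deriv).sub (hidd _ m2 b2 _ d1 h2.deriv)).congr
        (Eventually.of_forall fun ξ => by simp only [Pi.sub_apply]; ring))] at this
    -- On `x = 0` the test function takes the value `χ(t) ψ(0) = 0`, so the source at the kink drops
    -- out.
    simp only [zero_div, image_eq_zero_of_notMem_tsupport h3, mul_zero, integral_zero] at this
    exact (mul_eq_zero.1 this).resolve_left hχi.ne'
  · have := h.entropy_ineq _ (isTest_mul_comp_div hχ hχs h1 h2)
      fun z => mul_nonneg χ.nonneg (h4 _)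
    rw [integral_selfSimilar_test hχ hχs h1 (A := fun t x => entropy p ρref (w t x))
      (B := fun t x => entropyFlux p ρref (w t x)) (a := fun ξ => entropy p ρref (g ξ))
      (b := fun ξ => entropyFlux p ρref (g ξ))
      (fun t ht => (hgt t ht).mono fun x hx => congrArg (entropy p ρref) hx)
      (fun t ht => (hgt t ht).mono fun x hx => congrArg (entropyFlux p ρref) hx) h5 h6] at this
    exact (mul_nonneg_iff_of_pos_left hχi).1 this
  · obtain ⟨q₀, htr, -⟩ := h.momentum
    obtain ⟨t1, t2, Pm, Pp, t3, t4, t5⟩ := htr 1 one_pos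
    have hcongr : ∀ {F : Filter ℝ} {f : ℝ × ℝ → ℝ} {l : ℝ}, F ≤ ae volume →
        Tendsto (fun x => f (w 1 x)) F (𝓝 l) → Tendsto (fun x => f (g x)) F (𝓝 l) :=
      fun {F f l} hF ht => ht.congr' (by filter_upwards [hF hwg] with x hx; rw [hx])
    exact ⟨q₀ 1, Pm, Pp, hcongr (f := Prod.snd) inf_le_right t1,
      hcongr (f := Prod.snd) inf_le_right t2, hcongr inf_le_right t3, hcongr inf_le_right t4, t5⟩

/-! ### Uniqueness of profiles and of solutions -/

theorem IsHalfSolution.ae_eq_or_trace_lt {p : ℝ → ℝ} (hp : PressureLaw p) {ρref : ℝ}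
    (hr : 0 < ρref) {ul : ℝ × ℝ} (hul : ul ∈ subsonic p) {g g' : ℝ → ℝ × ℝ}
    (hg : IsHalfSolution p ρref ul g) (hg' : IsHalfSolution p ρref ul g') {q P q' P' : ℝ}
    (hq : LeftTrace (fun ξ => (g ξ).2) q) (hP : LeftTrace (fun ξ => dynPressure p (g ξ)) P)
    (hq' : LeftTrace (fun ξ => (g' ξ).2) q')
    (hP' : LeftTrace (fun ξ => dynPressure p (g' ξ)) P') :
    (∀ᵐ ξ, ξ < 0 → g ξ = g' ξ) ∨ (q < q' ∧ P' < P) ∨ (q' < q ∧ P < P') := by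
  have fan : ∀ {g : ℝ → ℝ × ℝ}, IsHalfSolution p ρref ul g → IsFan p ul g.leftLim
      g.leftLim.rightLim := fun {g} hg =>
    (hg.congr_ae hg.boundedVariation.leftLim (ae_leftLim_eq hg.boundedVariation)).isFan hp hr
      fun ξ => (hg.boundedVariation.continuousWithinAt_leftLim (x := ξ)).tendsto.mono_left
        (nhdsWithin_mono _ Iio_subset_Iic_self)
  have tr : ∀ {g : ℝ → ℝ × ℝ} {f : ℝ × ℝ → ℝ} {l : ℝ}, IsHalfSolution p ρref ul g →
      LeftTrace (fun ξ => f (g ξ)) l →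
      Tendsto (fun ξ => f (g.leftLim ξ)) (𝓝[<] 0 ⊓ ae volume) (𝓝 l) := fun {g f l} hg hl => by
    refine Tendsto.congr' ?_ hl
    filter_upwards [inf_le_right (a := 𝓝[<] (0 : ℝ)) (ae_leftLim_eq hg.boundedVariation)] with ξ h
    rw [h]
  refine ((fan hg).eq_or_trace_lt hp hul (fan hg') inf_le_left (tr (f := Prod.snd) hg hq)
    (tr hg hP) (tr (f := Prod.snd) hg' hq') (tr hg' hP')).imp_left fun h => ?_
  filter_upwards [ae_leftLim_eq hg.boundedVariation, ae_leftLim_eq hg'.boundedVariation]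
    with ξ h1 h2 h3
  rw [← h1, ← h2, h ξ h3]

theorem RightTrace.comp_neg {f : ℝ → ℝ} {l : ℝ} (h : RightTrace f l) :
    LeftTrace (fun ξ => f (-ξ)) l := by
  refine Tendsto.comp h ?_
  refine tendsto_inf.2 ⟨?_, ?_⟩
  · have : Tendsto (fun ξ : ℝ => -ξ) (𝓝[<] 0) (𝓝[>] 0) := by
      simpa using tendsto_neg_nhdsLT (a := (0 : ℝ))
    exact this.mono_left inf_le_left
  · exact (Measure.measurePreserving_neg
      (volume : Measure ℝ)).quasiMeasurePreserving.tendsto_ae.mono_left inf_le_right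

/-- Profiles satisfying the kink conditions are determined by the Riemann datum. -/
theorem IsProfile.ae_eq {p : ℝ → ℝ} (hp : PressureLaw p) {ρref c : ℝ} (hr : 0 < ρref) (hc : 0 ≤ c)
    {ul ur : ℝ × ℝ} (hul : ul ∈ subsonic p) (hur : ur ∈ subsonic p) {g g' : ℝ → ℝ × ℝ}
    (hg : IsProfile p ρref ul ur g) (hg' : IsProfile p ρref ul ur g')
    (ht : HasKinkTraces p c g) (ht' : HasKinkTraces p c g') : g =ᵐ[volume] g' := by
  obtain ⟨q, Pm, Pp, t1, t2, t3, t4, t5⟩ := ht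
  obtain ⟨q', Pm', Pp', t1', t2', t3', t4', t5'⟩ := ht'
  have hL := hg.isHalfSolution.ae_eq_or_trace_lt hp hr hul hg'.isHalfSolution t1 t3 t1' t3'
  have rq : ∀ {g : ℝ → ℝ × ℝ} {q : ℝ}, RightTrace (fun ξ => (g ξ).2) q →
      LeftTrace (fun ξ => (refl (g (-ξ))).2) (-q) := fun h => Tendsto.neg h.comp_neg
  have rP : ∀ {g : ℝ → ℝ × ℝ} {P : ℝ}, RightTrace (fun ξ => dynPressure p (g ξ)) P →
      LeftTrace (fun ξ => dynPressure p (refl (g (-ξ)))) P := fun h => by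
    simp only [dynPressure_refl]
    exact h.comp_neg
  have hR := hg.reflect.isHalfSolution.ae_eq_or_trace_lt hp hr (refl_mem_subsonic.2 hur)
    hg'.reflect.isHalfSolution (rq t2) (rP t4) (rq t2') (rP t4')
  have eqL : (∀ᵐ ξ, ξ < 0 → g ξ = g' ξ) → q = q' := fun h => by
    refine tendsto_nhds_unique t1 (Tendsto.congr' ?_ t1')
    filter_upwards [inf_le_left (b := ae volume) self_mem_nhdsWithin,
      inf_le_right (a := 𝓝[<] (0 : ℝ)) h] with ξ h1 h2
    rw [h2 h1]
  have eqR : (∀ᵐ ξ, ξ < 0 → refl (g (-ξ)) = refl (g' (-ξ))) → q = q' := fun h => by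
    refine neg_injective (tendsto_nhds_unique (rq t2) (Tendsto.congr' ?_ (rq t2')))
    filter_upwards [inf_le_left (b := ae volume) self_mem_nhdsWithin,
      inf_le_right (a := 𝓝[<] (0 : ℝ)) h] with ξ h1 h2
    rw [h2 h1]
  have key : (∀ᵐ ξ, ξ < 0 → g ξ = g' ξ) ∧
      (∀ᵐ ξ, ξ < 0 → refl (g (-ξ)) = refl (g' (-ξ))) := by
    -- If the left parts differ, say `q < q'` and `Pm' < Pm`, the right parts must differ as well,
    -- and reflection gives `Pp < Pp'`. Then `Pp - Pm < Pp' - Pm'`, that is `-(c q) < -(c q')`,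
    -- against `c ≥ 0`.
    rcases hL with hL | ⟨l1, l2⟩ | ⟨l1, l2⟩
    · have := eqL hL
      rcases hR with hR | ⟨r1, r2⟩ | ⟨r1, r2⟩
      · exact ⟨hL, hR⟩
      all_goals linarith
    · rcases hR with hR | ⟨r1, r2⟩ | ⟨r1, r2⟩
      · linarith [eqR hR]
      · linarith
      · nlinarith
    · rcases hR with hR | ⟨r1, r2⟩ | ⟨r1, r2⟩
      · linarith [eqR hR]
      · nlinarith
      · linarith
  have hneg := (Measure.measurePreserving_neg
    (volume : Measure ℝ)).quasiMeasurePreserving.ae key.2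
  have hne : ∀ᵐ ξ : ℝ, ξ ≠ 0 := by simp [ae_iff, measure_singleton]
  filter_upwards [key.1, hneg, hne] with ξ h1 h2 h3
  rcases lt_or_gt_of_ne h3 with h | h
  · exact h1 h
  · have := congrArg refl (h2 (neg_neg_of_pos h))
    simpa [refl_refl] using this

theorem IsWeakEntropySolution.ae_eq {p : ℝ → ℝ} (hp : PressureLaw p) {ρref c : ℝ}
    (hr : 0 < ρref) (hc : 0 ≤ c) {ul ur : ℝ × ℝ} (hul : ul ∈ subsonic p) (hur : ur ∈ subsonic p)
    {u w : ℝ → ℝ → ℝ × ℝ} (hu : IsWeakEntropySolution p ρref c (riemannDatum ul ur) u)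
    (hus : IsSelfSimilar u) (hu' : IsSubsonicValued p u)
    (hw : IsWeakEntropySolution p ρref c (riemannDatum ul ur) w)
    (hws : IsSelfSimilar w) (hw' : IsSubsonicValued p w) {t : ℝ} (ht : 0 < t) :
    w t =ᵐ[volume] u t := by
  obtain ⟨g, h1, h2, h3⟩ := hu.exists_profile hp hus hu'
  obtain ⟨g', h1', h2', h3'⟩ := hw.exists_profile hp hws hw'
  filter_upwards [h3 t ht, h3' t ht, ae_comp_div (h1.ae_eq hp hr hc hul hur h1' h2 h2') ht]
    with x e1 e2 e3
  rw [e1, e2, e3]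

/-! ### Wave curves -/

/-- A continuous map from a compact set to a Hausdorff space is closed, and preimages under the
inverse are images. -/
theorem continuousOn_of_injOn_of_isCompact {X Y : Type*} [TopologicalSpace X] [TopologicalSpace Y]
    [T2Space Y] {f : X → Y} {g : Y → X} {K : Set X} {S : Set Y} (hK : IsCompact K)
    (hf : ContinuousOn f K) (hinj : InjOn f K) (hg : MapsTo g S K) (hfg : ∀ y ∈ S, f (g y) = y) :
    ContinuousOn g S := by
  refine continuousOn_iff_isClosed.2 fun t ht =>
    ⟨f '' (K ∩ t), ((hK.inter_right ht).image_of_continuousOn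
      (hf.mono inter_subset_left)).isClosed, ?_⟩
  ext y
  refine ⟨fun ⟨h1, h2⟩ => ⟨⟨g y, ⟨hg h2, h1⟩, hfg y h2⟩, h2⟩, fun ⟨⟨k, ⟨h1, h2⟩, h3⟩, h4⟩ => ⟨?_, h4⟩⟩
  have : g y = k := hinj (hg h4) h1 ((hfg y h4).trans h3.symm)
  rw [mem_preimage, this]
  exact h2

theorem StrictAntiOn.exists_continuousOn_rightInverse {f : ℝ → ℝ} {a b : ℝ} (hab : a ≤ b)
    (hf : ContinuousOn f (Icc a b)) (hanti : StrictAntiOn f (Icc a b)) :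
    ∃ g : ℝ → ℝ, ContinuousOn g (Icc (f b) (f a)) ∧ MapsTo g (Icc (f b) (f a)) (Icc a b) ∧
      ∀ y ∈ Icc (f b) (f a), f (g y) = y := by
  have hsurj := intermediate_value_Icc' hab hf
  have hex : ∀ y, ∃ x, y ∈ Icc (f b) (f a) → x ∈ Icc a b ∧ f x = y := fun y => by
    by_cases hy : y ∈ Icc (f b) (f a)
    · obtain ⟨x, hx⟩ := hsurj hy
      exact ⟨x, fun _ => hx⟩
    · exact ⟨0, fun h => absurd h hy⟩
  choose g hg using hex
  exact ⟨g, continuousOn_of_injOn_of_isCompact isCompact_Icc hf hanti.injOn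
    (fun y hy => (hg y hy).1) (fun y hy => (hg y hy).2), fun y hy => (hg y hy).1,
    fun y hy => (hg y hy).2⟩

/-- Mass flow through a shock joining the densities `ρl` and `ρ`. -/
def shockMassFlow (p : ℝ → ℝ) (ρl ρ : ℝ) : ℝ := √(ρl * ρ * dslope p ρl ρ)

/-- Speed of the shock of the first family from `ul` to a state of density `ρ`. -/
def shockSpeed (p : ℝ → ℝ) (ul : ℝ × ℝ) (ρ : ℝ) : ℝ :=
  ul.2 / ul.1 - shockMassFlow p ul.1 ρ / ul.1

/-- Velocity along the rarefaction curve of the first family through `ul`. -/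
def rarefactionVelocity (p : ℝ → ℝ) (ul : ℝ × ℝ) (ρ : ℝ) : ℝ :=
  ul.2 / ul.1 + ∫ r in ρ..ul.1, √(deriv p r) / r

/-- First characteristic speed along the rarefaction curve of the first family through `ul`. -/
def rarefactionSpeed (p : ℝ → ℝ) (ul : ℝ × ℝ) (ρ : ℝ) : ℝ :=
  rarefactionVelocity p ul ρ - √(deriv p ρ)

/-- Momentum along the wave curve of the first family through `ul`. -/
def curveMomentum (p : ℝ → ℝ) (ul : ℝ × ℝ) (ρ : ℝ) : ℝ :=
  if ul.1 ≤ ρ then ul.2 + shockSpeed p ul ρ * (ρ - ul.1) else ρ * rarefactionVelocity p ul ρ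

theorem continuousOn_dslope_pressure {p : ℝ → ℝ} (hp : PressureLaw p) {ρl : ℝ} (hl : 0 < ρl) :
    ContinuousOn (dslope p ρl) (Ioi 0) :=
  (continuousOn_dslope (Ioi_mem_nhds hl)).2 ⟨hp.continuousOn, (hp.hasDerivAt hl).differentiableAt⟩

theorem dslope_pressure_eq {p : ℝ → ℝ} {ρl ρ : ℝ} (h : ρl < ρ) :
    dslope p ρl ρ = (p ρ - p ρl) / (ρ - ρl) := by
  rw [dslope_of_ne _ h.ne', slope_def_field]

theorem dslope_pressure_le_deriv {p : ℝ → ℝ} (hp : PressureLaw p) {ρl ρ : ℝ} (hl : 0 < ρl)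
    (h : ρl ≤ ρ) : dslope p ρl ρ ≤ deriv p ρ := by
  rcases h.eq_or_lt with rfl | h
  · rw [dslope_same]
  rw [dslope_of_ne _ h.ne']
  exact hp.convexOn.slope_le_deriv (mem_Ioi.2 hl) (mem_Ioi.2 (hl.trans h)) h
    (hp.hasDerivAt (hl.trans h)).differentiableAt

theorem monotoneOn_dslope_pressure {p : ℝ → ℝ} (hp : PressureLaw p) {ρl : ℝ} (hl : 0 < ρl) :
    MonotoneOn (dslope p ρl) (Ici ρl) := by
  intro x hx y hy hxy
  rcases (mem_Ici.1 hx).eq_or_lt with rfl | hx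
  · rcases hxy.eq_or_lt with rfl | hxy
    · exact le_rfl
    rw [dslope_same, dslope_of_ne _ hxy.ne']
    exact hp.convexOn.deriv_le_slope (mem_Ioi.2 hl) (mem_Ioi.2 (hl.trans hxy)) hxy
      (hp.hasDerivAt hl).differentiableAt
  · rw [dslope_pressure_eq hx, dslope_pressure_eq (hx.trans_le hxy)]
    exact hp.secant_le hl hx hxy

theorem deriv_le_dslope_pressure {p : ℝ → ℝ} (hp : PressureLaw p) {ρl ρ : ℝ} (hl : 0 < ρl)
    (h : ρl ≤ ρ) : deriv p ρl ≤ dslope p ρl ρ := by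
  rw [← dslope_same p ρl]
  exact monotoneOn_dslope_pressure hp hl (mem_Ici.2 le_rfl) h h

/-- At the base point `dslope` is the derivative, so the shock curve starts with the characteristic
speed and joins the rarefaction curve continuously. -/
theorem shockMassFlow_self {p : ℝ → ℝ} {ρl : ℝ} (hl : 0 < ρl) :
    shockMassFlow p ρl ρl = ρl * √(deriv p ρl) := by
  rw [shockMassFlow, dslope_same, Real.sqrt_mul (by positivity), Real.sqrt_mul_self hl.le]

theorem monotoneOn_shockMassFlow {p : ℝ → ℝ} (hp : PressureLaw p) {ρl : ℝ} (hl : 0 < ρl) :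
    MonotoneOn (shockMassFlow p ρl) (Ici ρl) := by
  intro x hx y hy hxy
  refine Real.sqrt_le_sqrt ?_
  have h1 := monotoneOn_dslope_pressure hp hl hx hy hxy
  have h2 := deriv_le_dslope_pressure hp hl hx
  have h3 := hp.deriv_nonneg _ hl
  have hx0 : 0 < x := hl.trans_le hx
  exact mul_le_mul (mul_le_mul_of_nonneg_left hxy hl.le) h1 (h3.trans h2) (by
    have := hx0.trans_le hxy
    positivity)

theorem sq_shockMassFlow {p : ℝ → ℝ} (hp : PressureLaw p) {ρl ρ : ℝ} (hl : 0 < ρl) (h : ρl < ρ) :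
    shockMassFlow p ρl ρ ^ 2 * (ρ - ρl) = ρl * ρ * (p ρ - p ρl) := by
  have h2 := deriv_le_dslope_pressure hp hl h.le
  have h3 := hp.deriv_nonneg _ hl
  have h4 := hl.trans h
  have h5 : 0 < ρ - ρl := sub_pos.2 h
  rw [shockMassFlow, Real.sq_sqrt (mul_nonneg (by positivity) (h3.trans h2)), dslope_pressure_eq h]
  field_simp

theorem continuousOn_shockSpeed {p : ℝ → ℝ} (hp : PressureLaw p) {ul : ℝ × ℝ} (hl : 0 < ul.1) :
    ContinuousOn (shockSpeed p ul) (Ioi 0) :=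
  continuousOn_const.sub (((continuousOn_const.mul continuousOn_id).mul
    (continuousOn_dslope_pressure hp hl)).sqrt.div_const _)

theorem antitoneOn_shockSpeed {p : ℝ → ℝ} (hp : PressureLaw p) {ul : ℝ × ℝ} (hl : 0 < ul.1) :
    AntitoneOn (shockSpeed p ul) (Ici ul.1) := fun _ hx _ hy hxy =>
  sub_le_sub_left (div_le_div_of_nonneg_right (monotoneOn_shockMassFlow hp hl hx hy hxy) hl.le) _

theorem shockSpeed_self {p : ℝ → ℝ} {ul : ℝ × ℝ} (hl : 0 < ul.1) :
    shockSpeed p ul ul.1 = charSpeed p 0 ul := by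
  rw [shockSpeed, shockMassFlow_self hl, charSpeed, if_pos rfl]
  field_simp

theorem shockSpeed_le {p : ℝ → ℝ} (hp : PressureLaw p) {ul : ℝ × ℝ} (hl : 0 < ul.1) {ρ : ℝ}
    (h : ul.1 ≤ ρ) : shockSpeed p ul ρ ≤ charSpeed p 0 ul := by
  rw [← shockSpeed_self hl]
  exact antitoneOn_shockSpeed hp hl (mem_Ici.2 le_rfl) h h

theorem shock_momentum_eq {p : ℝ → ℝ} {ul : ℝ × ℝ} (hl : 0 < ul.1) (ρ : ℝ) :
    ul.2 + shockSpeed p ul ρ * (ρ - ul.1) = shockMassFlow p ul.1 ρ + shockSpeed p ul ρ * ρ := by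
  rw [shockSpeed]
  field_simp
  ring

theorem shock_dynPressure {p : ℝ → ℝ} (hp : PressureLaw p) {ul : ℝ × ℝ} (hl : 0 < ul.1) {ρ : ℝ}
    (h : ul.1 < ρ) :
    dynPressure p (ρ, ul.2 + shockSpeed p ul ρ * (ρ - ul.1)) - dynPressure p ul =
      shockSpeed p ul ρ * (shockSpeed p ul ρ * (ρ - ul.1)) := by
  have h1 := sq_shockMassFlow hp hl h
  have h2 : ul.2 = shockMassFlow p ul.1 ρ + shockSpeed p ul ρ * ul.1 := by
    linarith [shock_momentum_eq (p := p) hl ρ]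
  have h3 := hl.trans h
  simp only [dynPressure]
  rw [shock_momentum_eq hl, h2]
  generalize shockSpeed p ul ρ = s at *
  generalize shockMassFlow p ul.1 ρ = m at *
  have h4 : p ρ - p ul.1 = m ^ 2 * (ρ - ul.1) / (ul.1 * ρ) := by
    rw [h1]; field_simp
  have h5 : p ρ = p ul.1 + m ^ 2 * (ρ - ul.1) / (ul.1 * ρ) := by linarith
  rw [h5]
  field_simp
  ring

/-- Convexity places the secant slope of `p` between the derivatives at both ends, and the strict
inequality of the densities makes the Lax inequalities strict even where `p` is affine. -/
theorem shock_isWave {p : ℝ → ℝ} (hp : PressureLaw p) {ul : ℝ × ℝ} (hl : ul ∈ subsonic p) {ρ : ℝ}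
    (h : ul.1 < ρ) :
    IsWave p 0 ul (ρ, ul.2 + shockSpeed p ul ρ * (ρ - ul.1)) (shockSpeed p ul ρ)
      (shockSpeed p ul ρ)
      fun ξ => if ξ ≤ shockSpeed p ul ρ then ul else
        (ρ, ul.2 + shockSpeed p ul ρ * (ρ - ul.1)) := by
  have h0 := hl.1
  have hρ := h0.trans h
  have hd := deriv_pos_of_mem_subsonic hl
  have h1 := deriv_le_dslope_pressure hp h0 h.le
  have h2 := dslope_pressure_le_deriv hp h0 h.le
  refine ⟨fun ξ hξ => if_pos hξ.le, fun ξ hξ => if_neg (not_le.2 hξ), Or.inr (Or.inl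
    ⟨rfl, ?_, ?_, ?_⟩)⟩
  · ext
    · simp [flux]
    · simpa [flux] using shock_dynPressure hp h0 h
  · rw [charSpeed, if_pos rfl, shock_momentum_eq h0]
    have : shockMassFlow p ul.1 ρ < ρ * √(deriv p ρ) := by
      have e : ρ * √(deriv p ρ) = √(ρ * ρ * deriv p ρ) := by
        rw [Real.sqrt_mul (by positivity), Real.sqrt_mul_self hρ.le]
      rw [e, shockMassFlow]
      refine Real.sqrt_lt_sqrt (mul_nonneg (by positivity) (hd.le.trans h1)) ?_
      exact mul_lt_mul (mul_lt_mul_of_pos_right h hρ) h2 (hd.trans_le h1) (by positivity)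
    have h3 : shockMassFlow p ul.1 ρ / ρ < √(deriv p ρ) := by rwa [div_lt_iff₀' hρ]
    rw [add_div, mul_div_assoc, div_self hρ.ne']
    linarith
  · rw [charSpeed, if_pos rfl, shockSpeed]
    have : ul.1 * √(deriv p ul.1) < shockMassFlow p ul.1 ρ := by
      rw [← shockMassFlow_self h0]
      refine Real.sqrt_lt_sqrt (by rw [dslope_same]; positivity) ?_
      rw [dslope_same]
      exact mul_lt_mul (mul_lt_mul_of_pos_left h h0) h1 hd (by positivity)
    have h3 : √(deriv p ul.1) < shockMassFlow p ul.1 ρ / ul.1 := by rwa [lt_div_iff₀' h0]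
    linarith

theorem hasDerivAt_rarefactionVelocity {p : ℝ → ℝ} (hp : PressureLaw p) {ul : ℝ × ℝ}
    (hl : 0 < ul.1) {ρ : ℝ} (hρ : 0 < ρ) :
    HasDerivAt (rarefactionVelocity p ul) (-(√(deriv p ρ) / ρ)) ρ := by
  have hc : ContinuousOn (fun r => √(deriv p r) / r) (Ioi 0) :=
    hp.continuousOn_sqrt_deriv.div continuousOn_id fun r hr => ne_of_gt hr
  have hsub : uIcc ρ ul.1 ⊆ Ioi 0 := fun r hr => lt_of_lt_of_le (lt_min hρ hl) hr.1
  refine (intervalIntegral.integral_hasDerivAt_left (hc.mono hsub).intervalIntegrable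
    (hc.stronglyMeasurableAtFilter isOpen_Ioi ρ hρ)
    (hc.continuousAt (Ioi_mem_nhds hρ))).const_add _

theorem hasDerivAt_rarefactionMomentum {p : ℝ → ℝ} (hp : PressureLaw p) {ul : ℝ × ℝ}
    (hl : 0 < ul.1) {ρ : ℝ} (hρ : 0 < ρ) :
    HasDerivAt (fun ρ => ρ * rarefactionVelocity p ul ρ) (rarefactionSpeed p ul ρ) ρ := by
  refine ((hasDerivAt_id ρ).mul (hasDerivAt_rarefactionVelocity hp hl hρ)).congr_deriv ?_
  simp only [id, rarefactionSpeed]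
  field_simp
  ring

/-- The velocity contributes `-√p' / ρ < 0`, so the first family is genuinely nonlinear also where
`p'' = 0`. -/
theorem hasDerivAt_rarefactionSpeed {p : ℝ → ℝ} (hp : PressureLaw p) {ul : ℝ × ℝ}
    (hl : 0 < ul.1) {ρ : ℝ} (hρ : 0 < ρ) (hd : 0 < deriv p ρ) :
    ∃ d < 0, HasDerivAt (rarefactionSpeed p ul) d ρ := by
  refine ⟨_, ?_, (hasDerivAt_rarefactionVelocity hp hl hρ).sub
    ((hp.hasDerivAt_deriv hρ).sqrt hd.ne')⟩
  have h1 := hp.deriv_deriv_nonneg ρ hρ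
  have h2 : 0 < √(deriv p ρ) := Real.sqrt_pos.2 hd
  have h3 : 0 < √(deriv p ρ) / ρ := by positivity
  have h4 : 0 ≤ deriv (deriv p) ρ / (2 * √(deriv p ρ)) := by positivity
  linarith

/-- The tangent of the rarefaction curve is an eigenvector; the free factor `k` admits any
parametrization of the curve. -/
theorem fluxDeriv_rarefaction {p : ℝ → ℝ} (hp : PressureLaw p) {ul : ℝ × ℝ} {ρ : ℝ}
    (hρ : 0 < ρ) (k : ℝ) :
    fluxDeriv p (ρ, ρ * rarefactionVelocity p ul ρ) (k, rarefactionSpeed p ul ρ * k) =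
      rarefactionSpeed p ul ρ • (k, rarefactionSpeed p ul ρ * k) := by
  have h := hp.sq_sqrt_deriv hρ
  rw [fluxDeriv_apply]
  ext
  · simp
  · simp only [mul_div_cancel_left₀ _ hρ.ne', Prod.smul_mk, smul_eq_mul, rarefactionSpeed]
    linear_combination (-k) * h

/-- A wave with subsonic values both components of which are monotone or antitone. -/
structure IsMonotoneWave (p : ℝ → ℝ) (i : Fin 2) (uL uR : ℝ × ℝ) (a b : ℝ) (W : ℝ → ℝ × ℝ) :
    Prop where
  isWave : IsWave p i uL uR a b W
  mem : ∀ ξ, W ξ ∈ subsonic p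
  fst : Monotone (fun ξ => (W ξ).1) ∨ Antitone fun ξ => (W ξ).1
  snd : Monotone (fun ξ => (W ξ).2) ∨ Antitone fun ξ => (W ξ).2

theorem monotone_or_antitone_step (s x y : ℝ) :
    Monotone (fun ξ => if ξ ≤ s then x else y) ∨ Antitone fun ξ => if ξ ≤ s then x else y := by
  rcases le_total x y with h | h
  · refine Or.inl fun ξ η hξη => ?_
    dsimp only
    split_ifs with h1 h2 h2
    exacts [le_rfl, h, absurd (hξη.trans h2) h1, le_rfl]
  · refine Or.inr fun ξ η hξη => ?_
    dsimp only
    split_ifs with h1 h2 h2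
    exacts [le_rfl, absurd (hξη.trans h1) h2, h, le_rfl]

theorem IsMonotoneWave.trivial {p : ℝ → ℝ} {u : ℝ × ℝ} (hu : u ∈ subsonic p) (i : Fin 2) :
    IsMonotoneWave p i u u (charSpeed p i u) (charSpeed p i u) fun _ => u :=
  ⟨⟨fun _ _ => rfl, fun _ _ => rfl, Or.inl ⟨rfl, rfl, rfl⟩⟩, fun _ => hu,
    Or.inl monotone_const, Or.inl monotone_const⟩

theorem IsMonotoneWave.shock {p : ℝ → ℝ} (hp : PressureLaw p) {ul : ℝ × ℝ} (hl : ul ∈ subsonic p)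
    {ρ : ℝ} (h : ul.1 < ρ) (hm : (ρ, ul.2 + shockSpeed p ul ρ * (ρ - ul.1)) ∈ subsonic p) :
    IsMonotoneWave p 0 ul (ρ, ul.2 + shockSpeed p ul ρ * (ρ - ul.1)) (shockSpeed p ul ρ)
      (shockSpeed p ul ρ)
      fun ξ => if ξ ≤ shockSpeed p ul ρ then ul else
        (ρ, ul.2 + shockSpeed p ul ρ * (ρ - ul.1)) := by
  refine ⟨shock_isWave hp hl h, fun ξ => ?_, ?_, ?_⟩
  · split_ifs
    exacts [hl, hm]
  · simp only [apply_ite Prod.fst]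
    exact monotone_or_antitone_step _ _ _
  · simp only [apply_ite Prod.snd]
    exact monotone_or_antitone_step _ _ _

theorem strictAntiOn_rarefactionSpeed {p : ℝ → ℝ} (hp : PressureLaw p) {ul : ℝ × ℝ}
    (hl : 0 < ul.1) {r : ℝ} (hr : 0 < r) (hd : 0 < deriv p r) :
    StrictAntiOn (rarefactionSpeed p ul) (Ici r) := by
  have key : ∀ ρ, r ≤ ρ → ∃ d < 0, HasDerivAt (rarefactionSpeed p ul) d ρ := fun ρ h =>
    hasDerivAt_rarefactionSpeed hp hl (hr.trans_le h) (hd.trans_le (hp.deriv_le_deriv hr h))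
  refine strictAntiOn_of_deriv_neg (convex_Ici r) (fun ρ h => ?_) fun ρ h => ?_
  · obtain ⟨d, -, h1⟩ := key ρ h
    exact h1.continuousAt.continuousWithinAt
  · rw [interior_Ici] at h
    obtain ⟨d, h0, h1⟩ := key ρ (le_of_lt h)
    rwa [h1.deriv]

theorem rarefactionVelocity_self {p : ℝ → ℝ} (ul : ℝ × ℝ) :
    rarefactionVelocity p ul ul.1 = ul.2 / ul.1 := by
  simp [rarefactionVelocity]

theorem rarefactionSpeed_self {p : ℝ → ℝ} (ul : ℝ × ℝ) :
    rarefactionSpeed p ul ul.1 = charSpeed p 0 ul := by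
  rw [rarefactionSpeed, rarefactionVelocity_self, charSpeed, if_pos rfl]

theorem strictAntiOn_rarefactionMomentum {p : ℝ → ℝ} (hp : PressureLaw p) {ul : ℝ × ℝ}
    (hl : 0 < ul.1) {r : ℝ} (hr : 0 < r) (hd : 0 < deriv p r) (hΛ : rarefactionSpeed p ul r < 0) :
    StrictAntiOn (fun ρ => ρ * rarefactionVelocity p ul ρ) (Ici r) := by
  refine strictAntiOn_of_deriv_neg (convex_Ici r) (fun ρ h =>
    (hasDerivAt_rarefactionMomentum hp hl (hr.trans_le h)).continuousAt.continuousWithinAt)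
    fun ρ h => ?_
  rw [interior_Ici] at h
  rw [(hasDerivAt_rarefactionMomentum hp hl (hr.trans h)).deriv]
  exact ((strictAntiOn_rarefactionSpeed hp hl hr hd).antitoneOn (mem_Ici.2 le_rfl)
    (mem_Ici.2 (le_of_lt h)) (le_of_lt h)).trans_lt hΛ

/-- As `ρ √p'(ρ)` is nondecreasing, a bound of `|q|` at the smallest density guarantees subsonicity
along the whole curve. -/
theorem mem_subsonic_of_abs_lt {p : ℝ → ℝ} (hp : PressureLaw p) {r ρ q : ℝ} (hr : 0 < r)
    (h : r ≤ ρ) (hq : |q| < r * √(deriv p r)) : (ρ, q) ∈ subsonic p :=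
  mem_subsonic_iff.2 ⟨hr.trans_le h, hq.trans_le (mul_sqrt_deriv_le hp hr h)⟩

/-- The characteristic speed is strictly decreasing in the density, so its inverse is the density as
a function of `ξ`. Negative speeds make the momentum monotone along the wave, so that bounds on
`|q|` at both ends control the interior. -/
theorem exists_rarefaction {p : ℝ → ℝ} (hp : PressureLaw p) {ul : ℝ × ℝ} {r : ℝ} (hr : 0 < r)
    (hrl : r < ul.1) (hd : 0 < deriv p r) (hΛ : rarefactionSpeed p ul r < 0)
    (hql : |ul.2| < r * √(deriv p r))
    (hqr : |r * rarefactionVelocity p ul r| < r * √(deriv p r)) :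
    ∃ W, IsMonotoneWave p 0 ul (r, r * rarefactionVelocity p ul r) (charSpeed p 0 ul)
      (rarefactionSpeed p ul r) W := by
  have hl := hr.trans hrl
  have hS := strictAntiOn_rarefactionSpeed hp hl hr hd
  have hQ := strictAntiOn_rarefactionMomentum hp hl hr hd hΛ
  have hsub : Icc r ul.1 ⊆ Ici r := Icc_subset_Ici_self
  have hderiv : ∀ ρ, r ≤ ρ → ∃ d < 0, HasDerivAt (rarefactionSpeed p ul) d ρ := fun ρ h =>
    hasDerivAt_rarefactionSpeed hp hl (hr.trans_le h) (hd.trans_le (hp.deriv_le_deriv hr h))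
  obtain ⟨g, hgc, hgm, hgi⟩ := StrictAntiOn.exists_continuousOn_rightInverse hrl.le
    (fun ρ h => by
      obtain ⟨d, -, h1⟩ := hderiv ρ h.1
      exact h1.continuousAt.continuousWithinAt) (hS.mono hsub)
  rw [rarefactionSpeed_self] at hgc hgm hgi
  set a := charSpeed p 0 ul with ha
  set b := rarefactionSpeed p ul r with hb
  have hab : a < b := by
    rw [ha, hb, ← rarefactionSpeed_self]
    exact hS (mem_Ici.2 le_rfl) (mem_Ici.2 hrl.le) hrl
  have hga : g a = ul.1 := by
    refine (hS.mono hsub).injOn (hgm ⟨le_rfl, hab.le⟩) ⟨hrl.le, le_rfl⟩ ?_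
    rw [hgi _ ⟨le_rfl, hab.le⟩, rarefactionSpeed_self]
  have hgb : g b = r := by
    refine (hS.mono hsub).injOn (hgm ⟨hab.le, le_rfl⟩) ⟨le_rfl, hrl.le⟩ ?_
    rw [hgi _ ⟨hab.le, le_rfl⟩]
  have hganti : AntitoneOn g (Icc a b) := by
    intro x hx y hy hxy
    by_contra! hcon
    have := (hS.mono hsub) (hgm hx) (hgm hy) hcon
    rw [hgi x hx, hgi y hy] at this
    exact not_lt.2 hxy this
  -- Projecting `ξ` to `[a, b]` extends the density by its end values and keeps it continuous and
  -- monotone on the whole line.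
  set D : ℝ → ℝ := fun ξ => g (projIcc a b hab.le ξ) with hD
  have hDm : ∀ ξ, D ξ ∈ Icc r ul.1 := fun ξ => hgm (projIcc a b hab.le ξ).2
  have hDanti : Antitone D := fun x y hxy =>
    hganti (projIcc a b hab.le x).2 (projIcc a b hab.le y).2 (monotone_projIcc hab.le hxy)
  have hDle : ∀ ξ ≤ a, D ξ = ul.1 := fun ξ hξ => by
    rw [hD]; simp only [projIcc_of_le_left hab.le hξ, hga]
  have hDge : ∀ ξ, b ≤ ξ → D ξ = r := fun ξ hξ => by
    rw [hD]; simp only [projIcc_of_right_le hab.le hξ, hgb]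
  have hDg : ∀ ξ ∈ Icc a b, D ξ = g ξ := fun ξ hξ => by
    rw [hD]; simp only [projIcc_of_mem hab.le hξ]
  have hDc : Continuous D :=
    (continuousOn_iff_continuous_domRestrict.1 hgc).comp continuous_projIcc
  set M : ℝ → ℝ := fun ρ => ρ * rarefactionVelocity p ul ρ with hM
  have hMd : ∀ ρ, r ≤ ρ → HasDerivAt M (rarefactionSpeed p ul ρ) ρ := fun ρ h =>
    hasDerivAt_rarefactionMomentum hp hl (hr.trans_le h)
  have hMl : M ul.1 = ul.2 := by
    rw [hM]
    simp only [rarefactionVelocity_self]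
    exact mul_div_cancel₀ _ hl.ne'
  have hMc : Continuous fun ξ => M (D ξ) := continuous_iff_continuousAt.2 fun ξ =>
    (hMd _ (hDm ξ).1).continuousAt.comp hDc.continuousAt
  have hMmono : Monotone fun ξ => M (D ξ) := fun x y hxy =>
    hQ.antitoneOn (hDm y).1 (hDm x).1 (hDanti hxy)
  have hM1 : ∀ ξ, ul.2 ≤ M (D ξ) := fun ξ => by
    rw [← hMl]
    exact hQ.antitoneOn (hDm ξ).1 (mem_Ici.2 hrl.le) (hDm ξ).2
  have hM2 : ∀ ξ, M (D ξ) ≤ M r := fun ξ =>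
    hQ.antitoneOn (mem_Ici.2 le_rfl) (hDm ξ).1 (hDm ξ).1
  refine ⟨fun ξ => (D ξ, M (D ξ)), ⟨fun ξ hξ => ?_, fun ξ hξ => ?_, Or.inr (Or.inr
    ⟨hab, rfl, ?_, (hDc.prodMk hMc).continuousOn, ?_, ?_, fun ξ hξ => ⟨?_, ?_⟩⟩)⟩, fun ξ => ?_,
    Or.inr hDanti, Or.inl hMmono⟩
  · simp only [hDle ξ hξ.le, hMl]
  · simp only [hDge ξ hξ.le]
    rfl
  · rw [charSpeed, if_pos rfl, mul_div_cancel_left₀ _ hr.ne']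
    rfl
  · simp only [hDle a le_rfl, hMl]
  · simp only [hDge b le_rfl]
    rfl
  · have h1 : rarefactionSpeed p ul (D ξ) = ξ := by
      rw [hDg ξ ⟨hξ.1.le, hξ.2.le⟩, hgi ξ ⟨hξ.1.le, hξ.2.le⟩]
    rw [charSpeed, if_pos rfl]
    simp only [hM, mul_div_cancel_left₀ _ (hr.trans_le (hDm ξ).1).ne']
    exact h1
  · have h1 : rarefactionSpeed p ul (D ξ) = ξ := by
      rw [hDg ξ ⟨hξ.1.le, hξ.2.le⟩, hgi ξ ⟨hξ.1.le, hξ.2.le⟩]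
    obtain ⟨d, hd0, hd1⟩ := hderiv _ (hDm ξ).1
    have h2 : HasDerivAt D d⁻¹ ξ := by
      refine HasDerivAt.of_local_left_inverse hDc.continuousAt hd1 hd0.ne ?_
      filter_upwards [Icc_mem_nhds hξ.1 hξ.2] with η hη
      rw [hDg η hη, hgi η hη]
    have h3 : HasDerivAt (fun ξ => M (D ξ)) (rarefactionSpeed p ul (D ξ) * d⁻¹) ξ :=
      (hMd _ (hDm ξ).1).comp ξ h2
    refine ⟨_, h2.prodMk h3, ?_⟩
    have hpos := hr.trans_le (hDm ξ).1
    rw [(hasFDerivAt_flux hp (u := (D ξ, M (D ξ))) hpos).fderiv,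
      fluxDeriv_rarefaction hp hpos, h1]
  · refine mem_subsonic_of_abs_lt hp hr (hDm ξ).1 (abs_lt.2 ?_)
    exact ⟨(abs_lt.1 hql).1.trans_le (hM1 ξ), (hM2 ξ).trans_lt (abs_lt.1 hqr).2⟩

/-- The wave curve of the first family through `ul`, parametrized by the momentum `q`; the
dynamic pressure along the curve is decreasing at a rate at least `κ`, as seen from `ul`. -/
theorem exists_waveCurve {p : ℝ → ℝ} (hp : PressureLaw p) {ul : ℝ × ℝ} (hul : ul ∈ subsonic p)
    {r₁ r₂ κ q₁ q₂ : ℝ} (hr₁ : 0 < r₁) (h₁ : r₁ < ul.1) (h₂ : ul.1 < r₂) (hκ : 0 < κ)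
    (hΛ : rarefactionSpeed p ul r₁ ≤ -κ)
    (hq : ∀ q ∈ Icc q₁ q₂, |q| < r₁ * √(deriv p r₁)) (hqul : ul.2 ∈ Icc q₁ q₂)
    (hq₂ : q₂ ≤ ul.2 + κ * (ul.1 - r₁)) (hq₁ : ul.2 - κ * (r₂ - ul.1) ≤ q₁) :
    ∃ P : ℝ → ℝ, ContinuousOn P (Icc q₁ q₂) ∧ ∀ q ∈ Icc q₁ q₂,
      (∃ ρ a b W, (ρ, q) ∈ subsonic p ∧ P q = dynPressure p (ρ, q) ∧
        IsMonotoneWave p 0 ul (ρ, q) a b W ∧ b < 0) ∧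
      (ul.2 ≤ q → P q + κ * (q - ul.2) ≤ dynPressure p ul) ∧
      (q ≤ ul.2 → dynPressure p ul + κ * (ul.2 - q) ≤ P q) := by
  have hl := hul.1
  have hd : 0 < deriv p r₁ := by
    have h1 := (abs_nonneg _).trans_lt (hq _ hqul)
    exact Real.sqrt_pos.1 (pos_of_mul_pos_right h1 hr₁.le)
  have hS := strictAntiOn_rarefactionSpeed hp hl hr₁ hd
  have hSle : ∀ ρ, r₁ ≤ ρ → rarefactionSpeed p ul ρ ≤ -κ := fun ρ h =>
    (hS.antitoneOn (mem_Ici.2 le_rfl) (mem_Ici.2 h) h).trans hΛ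
  have hchar : charSpeed p 0 ul ≤ -κ := by
    rw [← rarefactionSpeed_self]
    exact hSle _ h₁.le
  have hs : ∀ ρ, ul.1 ≤ ρ → shockSpeed p ul ρ ≤ -κ := fun ρ h => (shockSpeed_le hp hl h).trans hchar
  have hΛ0 : rarefactionSpeed p ul r₁ < 0 := by linarith
  have hM := strictAntiOn_rarefactionMomentum hp hl hr₁ hd hΛ0
  have hMl : ul.1 * rarefactionVelocity p ul ul.1 = ul.2 := by
    rw [rarefactionVelocity_self]
    exact mul_div_cancel₀ _ hl.ne'
  set Q := curveMomentum p ul with hQdef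
  have hQs : ∀ ρ, ul.1 ≤ ρ → Q ρ = ul.2 + shockSpeed p ul ρ * (ρ - ul.1) := fun ρ h => if_pos h
  have hQr : ∀ ρ, ρ ≤ ul.1 → Q ρ = ρ * rarefactionVelocity p ul ρ := fun ρ h => by
    rcases h.eq_or_lt with rfl | h
    · rw [hQs _ le_rfl, hMl]; simp
    · exact if_neg (not_le.2 h)
  have hQl : Q ul.1 = ul.2 := by rw [hQr _ le_rfl, hMl]
  have hunion : Icc r₁ ul.1 ∪ Icc ul.1 r₂ = Icc r₁ r₂ := Icc_union_Icc_eq_Icc h₁.le h₂.le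
  have hQcont : ContinuousOn Q (Icc r₁ r₂) := by
    rw [← hunion]
    refine ContinuousOn.union_of_isClosed ?_ ?_ isClosed_Icc isClosed_Icc
    · refine ContinuousOn.congr (f := fun ρ => ρ * rarefactionVelocity p ul ρ) (fun ρ h =>
        (hasDerivAt_rarefactionMomentum hp hl
          (hr₁.trans_le h.1)).continuousAt.continuousWithinAt) fun ρ h => hQr ρ h.2
    · refine ContinuousOn.congr (continuousOn_const.add
        (((continuousOn_shockSpeed hp hl).mono fun ρ h => hl.trans_le h.1).mul
          (continuousOn_id.sub continuousOn_const))) fun ρ h => hQs ρ h.1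
  -- On the rarefaction part the derivative is the characteristic speed. On the shock part the
  -- momentum is `qₗ + s (ρ - ρₗ)` with `s ≤ -κ` nonincreasing in `ρ`.
  have hQanti : StrictAntiOn Q (Icc r₁ r₂) := by
    rw [← hunion]
    refine StrictAntiOn.union (c := ul.1) ?_ ?_ ⟨⟨h₁.le, le_rfl⟩, fun x h => h.2⟩
      ⟨⟨le_rfl, h₂.le⟩, fun x h => h.1⟩
    · intro x hx y hy hxy
      rw [hQr x hx.2, hQr y hy.2]
      exact hM hx.1 hy.1 hxy
    · intro x hx y hy hxy
      rw [hQs x hx.1, hQs y hy.1]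
      have e1 := antitoneOn_shockSpeed hp hl (mem_Ici.2 hx.1) (mem_Ici.2 hy.1) hxy.le
      have e2 := hs x hx.1
      have e3 := hx.1
      nlinarith
  -- From `dq = λ dρ` and `dP = λ dq` follows `d(P + κ q) = λ (λ + κ) dρ`, which is nonnegative
  -- because `λ ≤ -κ < 0`.
  have hcurve : ∀ ρ, 0 < ρ → HasDerivAt
      (fun ρ => dynPressure p (ρ, ρ * rarefactionVelocity p ul ρ) +
        κ * (ρ * rarefactionVelocity p ul ρ))
      (rarefactionSpeed p ul ρ * (rarefactionSpeed p ul ρ + κ)) ρ := fun ρ hρ => by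
    have e1 := hasDerivAt_rarefactionMomentum hp hl hρ
    have e2 := (hasFDerivAt_dynPressure hp (u := (ρ, ρ * rarefactionVelocity p ul ρ))
      hρ).comp_hasDerivAt ρ ((hasDerivAt_id ρ).prodMk e1)
    refine (e2.add (e1.const_mul κ)).congr_deriv ?_
    have e3 := congrArg Prod.snd (fluxDeriv_rarefaction hp (ul := ul) hρ 1)
    rw [fluxDeriv_apply] at e3
    simp at e3 ⊢
    linarith
  have hPmono : MonotoneOn (fun ρ => dynPressure p (ρ, ρ * rarefactionVelocity p ul ρ) +
      κ * (ρ * rarefactionVelocity p ul ρ)) (Ici r₁) := by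
    refine monotoneOn_of_deriv_nonneg (convex_Ici r₁) (fun ρ h =>
      (hcurve ρ (hr₁.trans_le h)).continuousAt.continuousWithinAt) (fun ρ h => ?_) fun ρ h => ?_
    · rw [interior_Ici] at h
      exact (hcurve ρ (hr₁.trans h)).differentiableAt.differentiableWithinAt
    · rw [interior_Ici] at h
      rw [(hcurve ρ (hr₁.trans h)).deriv]
      have := hSle ρ (le_of_lt h)
      nlinarith
  -- The momentum changes at rate at least `κ` in the density, so densities down to `r₁` reach all
  -- momenta up to `q₂`.
  have hMκ : AntitoneOn (fun ρ => ρ * rarefactionVelocity p ul ρ + κ * ρ) (Ici r₁) := by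
    have hder : ∀ ρ, 0 < ρ → HasDerivAt (fun ρ => ρ * rarefactionVelocity p ul ρ + κ * ρ)
        (rarefactionSpeed p ul ρ + κ) ρ := fun ρ hρ =>
      ((hasDerivAt_rarefactionMomentum hp hl hρ).add
        ((hasDerivAt_id ρ).const_mul κ)).congr_deriv (by simp)
    refine antitoneOn_of_deriv_nonpos (convex_Ici r₁) (fun ρ h =>
      (hder ρ (hr₁.trans_le h)).continuousAt.continuousWithinAt) (fun ρ h => ?_) fun ρ h => ?_
    · rw [interior_Ici] at h
      exact (hder ρ (hr₁.trans h)).differentiableAt.differentiableWithinAt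
    · rw [interior_Ici] at h
      rw [(hder ρ (hr₁.trans h)).deriv]
      linarith [hSle ρ (le_of_lt h)]
  obtain ⟨g, hgc, hgm, hgi⟩ := StrictAntiOn.exists_continuousOn_rightInverse (h₁.trans h₂).le
    hQcont hQanti
  have hJ : Icc q₁ q₂ ⊆ Icc (Q r₂) (Q r₁) := by
    refine Icc_subset_Icc ?_ ?_
    · rw [hQs _ h₂.le]
      nlinarith [hs _ h₂.le]
    · rw [hQr _ h₁.le]
      have := hMκ (mem_Ici.2 le_rfl) (mem_Ici.2 h₁.le) h₁.le
      simp only [hMl] at this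
      linarith
  have hgmem : ∀ q ∈ Icc q₁ q₂, (g q, q) ∈ subsonic p := fun q h =>
    mem_subsonic_of_abs_lt hp hr₁ (hgm (hJ h)).1 (hq q h)
  refine ⟨fun q => dynPressure p (g q, q), (continuousOn_dynPressure hp).comp
    ((hgc.mono hJ).prodMk continuousOn_id) fun q h => (hgmem q h).1, fun q h => ?_⟩
  have hgq := hgi q (hJ h)
  have hmem := hgmem q h
  have hgr := hgm (hJ h)
  have hulr : ul.1 ∈ Icc r₁ r₂ := ⟨h₁.le, h₂.le⟩
  rcases lt_trichotomy (g q) ul.1 with hlt | heq | hgt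
  · have hqgt : ul.2 < q := by
      rw [← hQl, ← hgq]
      exact hQanti hgr hulr hlt
    have hqe : g q * rarefactionVelocity p ul (g q) = q := by rw [← hQr _ hlt.le, hgq]
    refine ⟨?_, fun _ => ?_, fun hcon => absurd hqgt (not_lt.2 hcon)⟩
    · have hmono := mul_sqrt_deriv_le hp hr₁ hgr.1
      obtain ⟨W, hW⟩ := exists_rarefaction hp (hr₁.trans_le hgr.1) hlt
        (hd.trans_le (hp.deriv_le_deriv hr₁ hgr.1)) ((hSle _ hgr.1).trans_lt (by linarith))
        ((hq _ hqul).trans_le hmono) (by rw [hqe]; exact (hq _ h).trans_le hmono)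
      rw [hqe] at hW
      exact ⟨g q, _, _, W, hmem, rfl, hW, (hSle _ hgr.1).trans_lt (by linarith)⟩
    · have := hPmono (mem_Ici.2 hgr.1) (mem_Ici.2 h₁.le) hlt.le
      simp only [hMl, hqe] at this
      linarith
  · have hqe : q = ul.2 := by rw [← hQl, ← hgq, heq]
    have hu : (g q, q) = ul := Prod.ext heq hqe
    refine ⟨⟨g q, charSpeed p 0 ul, charSpeed p 0 ul, fun _ => ul, hmem, rfl, ?_,
      lt_of_le_of_lt hchar (by linarith)⟩, fun _ => ?_, fun _ => ?_⟩
    · rw [hu]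
      exact IsMonotoneWave.trivial hul 0
    · simp only [hu]
      rw [hqe, sub_self, mul_zero, add_zero]
    · simp only [hu]
      rw [hqe, sub_self, mul_zero, add_zero]
  · have hqlt : q < ul.2 := by
      rw [← hQl, ← hgq]
      exact hQanti hulr hgr hgt
    have hqe : q = ul.2 + shockSpeed p ul (g q) * (g q - ul.1) := by rw [← hQs _ hgt.le, hgq]
    have hsg := hs _ hgt.le
    refine ⟨⟨g q, shockSpeed p ul (g q), shockSpeed p ul (g q),
      fun ξ => if ξ ≤ shockSpeed p ul (g q) then ul else (g q, q), hmem, rfl, ?_,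
      hsg.trans_lt (by linarith)⟩, fun hcon => absurd hqlt (not_lt.2 hcon), fun _ => ?_⟩
    · have := IsMonotoneWave.shock hp hul hgt (by rw [← hqe]; exact hmem)
      rwa [← hqe] at this
    · have := shock_dynPressure hp hl hgt
      rw [← hqe] at this
      nlinarith

/-! ### Stability of the wave curves and solution of the kink equation -/

theorem continuousAt_rarefactionSpeed_left {p : ℝ → ℝ} (hp : PressureLaw p) {ul : ℝ × ℝ}
    (hl : 0 < ul.1) {r : ℝ} (hr : 0 < r) : ContinuousAt (fun u => rarefactionSpeed p u r) ul := by
  have hc : ContinuousOn (fun r => √(deriv p r) / r) (Ioi 0) :=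
    hp.continuousOn_sqrt_deriv.div continuousOn_id fun r hr => ne_of_gt hr
  have hsub : uIcc r ul.1 ⊆ Ioi 0 := fun x hx => lt_of_lt_of_le (lt_min hr hl) hx.1
  have h1 := (intervalIntegral.integral_hasDerivAt_right (hc.mono hsub).intervalIntegrable
    (hc.stronglyMeasurableAtFilter isOpen_Ioi ul.1 hl)
    (hc.continuousAt (Ioi_mem_nhds hl))).continuousAt
  exact ((continuousAt_snd.div continuousAt_fst hl.ne').add
    (ContinuousAt.comp (f := Prod.fst) h1 continuousAt_fst)).sub continuousAt_const

/-- The slope bound and the interval of momenta depend only on the base state and serve all nearby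
left states. This uniformity replaces an implicit function theorem. -/
theorem eventually_exists_waveCurve {p : ℝ → ℝ} (hp : PressureLaw p) {ubar : ℝ × ℝ}
    (hu : ubar ∈ subsonic p) :
    ∃ κ > 0, ∃ η₀ > 0, ∀ η, 0 < η → η ≤ η₀ → ∀ᶠ ul in 𝓝 ubar, ul ∈ subsonic p →
      ul.2 ∈ Icc (ubar.2 - η) (ubar.2 + η) ∧
      ∃ P : ℝ → ℝ, ContinuousOn P (Icc (ubar.2 - η) (ubar.2 + η)) ∧
        ∀ q ∈ Icc (ubar.2 - η) (ubar.2 + η),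
          (∃ ρ a b W, (ρ, q) ∈ subsonic p ∧ P q = dynPressure p (ρ, q) ∧
            IsMonotoneWave p 0 ul (ρ, q) a b W ∧ b < 0) ∧
          (ul.2 ≤ q → P q + κ * (q - ul.2) ≤ dynPressure p ul) ∧
          (q ≤ ul.2 → dynPressure p ul + κ * (ul.2 - q) ≤ P q) := by
  have h0 := hu.1
  have hd := deriv_pos_of_mem_subsonic hu
  obtain ⟨r, ⟨hr0, hr1, hr2⟩, hr3⟩ : ∃ r, (0 < r ∧ |ubar.2| < r * √(deriv p r) ∧
      rarefactionSpeed p ubar r < 0) ∧ r < ubar.1 := by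
    have e1 : ∀ᶠ r in 𝓝 ubar.1, 0 < r := eventually_gt_nhds h0
    have e2 : ∀ᶠ r in 𝓝 ubar.1, |ubar.2| < r * √(deriv p r) :=
      (continuousAt_id.mul (hp.continuousOn_sqrt_deriv.continuousAt
        (Ioi_mem_nhds h0))).tendsto.eventually (eventually_gt_nhds (mem_subsonic_iff.1 hu).2)
    have e3 : ∀ᶠ r in 𝓝 ubar.1, rarefactionSpeed p ubar r < 0 := by
      obtain ⟨d, -, h1⟩ := hasDerivAt_rarefactionSpeed hp h0 h0 hd
      refine h1.continuousAt.tendsto.eventually (eventually_lt_nhds ?_)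
      rw [rarefactionSpeed_self]
      exact charSpeed_zero_neg hu
    have e4 : ∀ᶠ r in 𝓝[<] ubar.1, r < ubar.1 := self_mem_nhdsWithin
    exact ((((e1.and (e2.and e3)).filter_mono nhdsWithin_le_nhds).and e4)).exists
  -- Half the available speed, which leaves room for perturbing the left state.
  set κ := -rarefactionSpeed p ubar r / 2 with hκ
  have hκ0 : 0 < κ := by rw [hκ]; linarith
  -- The three bounds keep the states subsonic, within reach of rarefactions of density at least
  -- `r`, and within reach of shocks of density at most `ubar.1 + 1`.
  refine ⟨κ, hκ0, min ((r * √(deriv p r) - |ubar.2|) / 2) (min (κ * (ubar.1 - r) / 2) (κ / 2)),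
    lt_min (by linarith) (lt_min (by have := sub_pos.2 hr3; positivity) (by linarith)),
    fun η hη hη0 => ?_⟩
  have b1 := hη0.trans (min_le_left _ _)
  have b2 := (hη0.trans (min_le_right _ _)).trans (min_le_left _ _)
  have b3 := (hη0.trans (min_le_right _ _)).trans (min_le_right _ _)
  have c1 : Tendsto (fun u : ℝ × ℝ => u.1) (𝓝 ubar) (𝓝 ubar.1) := continuous_fst.tendsto _
  have c2 : Tendsto (fun u : ℝ × ℝ => u.2) (𝓝 ubar) (𝓝 ubar.2) := continuous_snd.tendsto _
  have f1 : ∀ᶠ ul in 𝓝 ubar, rarefactionSpeed p ul r < -κ :=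
    (continuousAt_rarefactionSpeed_left hp h0 hr0).tendsto.eventually
      (eventually_lt_nhds (by rw [hκ]; linarith))
  have f2 : ∀ᶠ ul in 𝓝 ubar, ubar.2 + η < ul.2 + κ * (ul.1 - r) :=
    (c2.add ((c1.sub_const r).const_mul κ)).eventually
      (eventually_gt_nhds (by have := mul_pos hκ0 (sub_pos.2 hr3); linarith))
  have f3 : ∀ᶠ ul in 𝓝 ubar, ul.2 - κ * (ubar.1 + 1 - ul.1) < ubar.2 - η :=
    (c2.sub ((c1.const_sub (ubar.1 + 1)).const_mul κ)).eventually
      (eventually_lt_nhds (by ring_nf; linarith))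
  filter_upwards [f1, f2, f3, c1.eventually (eventually_gt_nhds hr3),
    c1.eventually (eventually_lt_nhds (lt_add_one ubar.1)),
    c2.eventually (Icc_mem_nhds (sub_lt_self _ hη) (lt_add_of_pos_right _ hη))]
    with ul g1 g2 g3 g4 g5 g6 hul
  refine ⟨g6, exists_waveCurve hp hul hr0 g4 g5 hκ0 g1.le (fun q hq => ?_) g6 g2.le g3.le⟩
  have : |q| ≤ |ubar.2| + η := by
    have h1 : |q - ubar.2| ≤ η := abs_le.2 ⟨by linarith [hq.1], by linarith [hq.2]⟩
    have h2 := abs_add_le ubar.2 (q - ubar.2)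
    rw [add_sub_cancel] at h2
    linarith
  linarith

theorem charSpeed_one_refl (p : ℝ → ℝ) (u : ℝ × ℝ) :
    charSpeed p 1 (refl u) = -charSpeed p 0 u := by
  simp [charSpeed, refl]
  ring

/-- Reflection exchanges the end states, changes the sign of all speeds and takes the first family
to the second. -/
theorem IsMonotoneWave.reflect {p : ℝ → ℝ} (hp : PressureLaw p) {uL uR : ℝ × ℝ} {a b : ℝ}
    {W : ℝ → ℝ × ℝ} (h : IsMonotoneWave p 0 uL uR a b W) :
    IsMonotoneWave p 1 (refl uR) (refl uL) (-b) (-a) fun ξ => refl (W (-ξ)) := by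
  obtain ⟨⟨h1, h2, h3⟩, hm, hf, hs⟩ := h
  refine ⟨⟨fun ξ hξ => congrArg refl (h2 _ (by linarith)),
    fun ξ hξ => congrArg refl (h1 _ (by linarith)), ?_⟩,
    fun ξ => refl_mem_subsonic.2 (hm _), ?_, ?_⟩
  · rcases h3 with ⟨rfl, rfl, rfl⟩ | ⟨rfl, h4, h5, h6⟩ | ⟨h4, h5, h6, h7, h8, h9, h10⟩
    · exact Or.inl ⟨rfl, (charSpeed_one_refl p _).symm, rfl⟩
    · refine Or.inr (Or.inl ⟨rfl, ?_, ?_, ?_⟩)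
      · have e1 := congrArg Prod.fst h4
        have e2 := congrArg Prod.snd h4
        simp only [flux, Prod.fst_sub, Prod.snd_sub, Prod.smul_fst, Prod.smul_snd,
          smul_eq_mul] at e1 e2
        ext
        · simp only [flux, refl, Prod.fst_sub, Prod.smul_fst, smul_eq_mul]
          linarith
        · simp only [flux, dynPressure_refl, Prod.snd_sub, Prod.smul_snd, smul_eq_mul]
          simp only [refl]
          linarith
      · rw [charSpeed_one_refl]; linarith
      · rw [charSpeed_one_refl]; linarith
    · refine Or.inr (Or.inr ⟨by linarith, by rw [charSpeed_one_refl, h6],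
        by rw [charSpeed_one_refl, h5], ?_, by simp only [neg_neg, h9],
        by simp only [neg_neg, h8],
        fun ξ hξ => ?_⟩)
      · exact continuous_refl.comp_continuousOn (h7.comp continuous_neg.continuousOn
          fun ξ hξ => ⟨by linarith [hξ.2], by linarith [hξ.1]⟩)
      · obtain ⟨e1, V, e2, e3⟩ := h10 (-ξ) ⟨by linarith [hξ.2], by linarith [hξ.1]⟩
        have e4 : HasDerivAt (fun ξ => W (-ξ)) (-V) ξ := 
          (e2.scomp ξ (hasDerivAt_neg ξ)).congr_deriv (by simp)
        have hpos := (hm (-ξ)).1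
        refine ⟨by rw [charSpeed_one_refl, e1, neg_neg], (-V.1, V.2), ?_, ?_⟩
        · have e5 : HasDerivAt (fun ξ => (W (-ξ)).1) (-V.1) ξ := e4.fst
          have e6 : HasDerivAt (fun ξ => (W (-ξ)).2) (-V.2) ξ := e4.snd
          exact (e5.prodMk e6.neg).congr_deriv (by rw [neg_neg])
        · rw [(hasFDerivAt_flux hp hpos).fderiv, fluxDeriv_apply] at e3
          rw [(hasFDerivAt_flux hp (u := refl (W (-ξ))) hpos).fderiv, fluxDeriv_apply]
          have e5 := congrArg Prod.fst e3
          have e6 := congrArg Prod.snd e3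
          simp only [Prod.smul_fst, Prod.smul_snd, smul_eq_mul] at e5 e6
          ext
          · simp only [Prod.smul_mk, smul_eq_mul]
            linarith
          · simp only [refl, Prod.smul_mk, smul_eq_mul, neg_div]
            linarith
  · exact hf.symm.imp (fun h x y hxy => h (neg_le_neg hxy)) fun h x y hxy => h (neg_le_neg hxy)
  · exact hs.imp (fun h x y hxy => neg_le_neg (h (neg_le_neg hxy)))
      fun h x y hxy => neg_le_neg (h (neg_le_neg hxy))

theorem eventually_exists_waves {p : ℝ → ℝ} (hp : PressureLaw p) {c : ℝ} (hc : 0 ≤ c)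
    {vl vr : ℝ × ℝ} (hvl : vl ∈ subsonic p) (hvr : vr ∈ subsonic p) (hk : KinkCondition p c vl vr) :
    ∀ᶠ z : (ℝ × ℝ) × (ℝ × ℝ) in 𝓝 (vl, vr), z.1 ∈ subsonic p → z.2 ∈ subsonic p →
      ∃ um ∈ subsonic p, ∃ up ∈ subsonic p, ∃ (a₁ b₁ a₂ b₂ : ℝ) (W₁ W₂ : ℝ → ℝ × ℝ),
        IsMonotoneWave p 0 z.1 um a₁ b₁ W₁ ∧ b₁ < 0 ∧ KinkCondition p c um up ∧
        IsMonotoneWave p 1 up z.2 a₂ b₂ W₂ ∧ 0 < a₂ := by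
  obtain ⟨κ₁, hκ₁, η₁, hη₁, H₁⟩ := eventually_exists_waveCurve hp hvl
  obtain ⟨κ₂, hκ₂, η₂, hη₂, H₂⟩ := eventually_exists_waveCurve hp (refl_mem_subsonic.2 hvr)
  obtain ⟨hkq, hkP⟩ := hk
  set η := min η₁ η₂ with hη
  have hη0 : 0 < η := lt_min hη₁ hη₂
  specialize H₁ η hη0 (min_le_left _ _)
  specialize H₂ η hη0 (min_le_right _ _)
  set q₀ := vl.2 with hq₀
  have hr2 : (refl vr).2 = -q₀ := by rw [← hkq]; rfl
  rw [hr2] at H₂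
  have hfst : Tendsto (fun z : (ℝ × ℝ) × (ℝ × ℝ) => z.1) (𝓝 (vl, vr)) (𝓝 vl) :=
    continuous_fst.tendsto _
  have hsnd : Tendsto (fun z : (ℝ × ℝ) × (ℝ × ℝ) => z.2) (𝓝 (vl, vr)) (𝓝 vr) :=
    continuous_snd.tendsto _
  have hrefl : Tendsto (fun z : (ℝ × ℝ) × (ℝ × ℝ) => refl z.2) (𝓝 (vl, vr)) (𝓝 (refl vr)) :=
    (continuous_refl.tendsto _).comp hsnd
  have tP₁ := (continuousAt_dynPressure hp hvl.1).tendsto.comp hfst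
  have tP₂ := (continuousAt_dynPressure hp hvr.1).tendsto.comp hsnd
  have tq₁ := (continuous_snd.tendsto vl).comp hfst
  have tq₂ := (continuous_snd.tendsto vr).comp hsnd
  -- A lower bound of `G (q₀ + η)` by the slope estimates. At the stationary solution it equals `(κ₁
  -- + κ₂ + c) η > 0`, so it stays positive nearby; `E₂` is its counterpart at `q₀ - η`.
  have E₁ : ∀ᶠ z : (ℝ × ℝ) × (ℝ × ℝ) in 𝓝 (vl, vr),
      0 < dynPressure p z.2 - dynPressure p z.1 + κ₁ * (q₀ + η - z.1.2) +
        κ₂ * (q₀ + η - z.2.2) + c * (q₀ + η) := by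
    refine ((((tP₂.sub tP₁).add ((tq₁.const_sub (q₀ + η)).const_mul κ₁)).add
      ((tq₂.const_sub (q₀ + η)).const_mul κ₂)).add_const (c * (q₀ + η))).eventually
      (eventually_gt_nhds ?_)
    rw [hkP, hkq, ← hq₀]
    have : 0 < κ₁ * η + κ₂ * η := by positivity
    nlinarith
  have E₂ : ∀ᶠ z : (ℝ × ℝ) × (ℝ × ℝ) in 𝓝 (vl, vr),
      dynPressure p z.2 - dynPressure p z.1 + κ₁ * (q₀ - η - z.1.2) +
        κ₂ * (q₀ - η - z.2.2) + c * (q₀ - η) < 0 := by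
    refine ((((tP₂.sub tP₁).add ((tq₁.const_sub (q₀ - η)).const_mul κ₁)).add
      ((tq₂.const_sub (q₀ - η)).const_mul κ₂)).add_const (c * (q₀ - η))).eventually
      (eventually_lt_nhds ?_)
    rw [hkP, hkq, ← hq₀]
    have : 0 < κ₁ * η + κ₂ * η := by positivity
    nlinarith
  filter_upwards [hfst.eventually H₁, hrefl.eventually H₂, E₁, E₂] with z h₁ h₂ e₁ e₂ hz₁ hz₂
  obtain ⟨m₁, P₁, hP₁, K₁⟩ := h₁ hz₁
  obtain ⟨m₂, P₂, hP₂, K₂⟩ := h₂ (refl_mem_subsonic.2 hz₂)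
  have hz2 : (refl z.2).2 = -z.2.2 := rfl
  rw [hz2] at m₂ K₂
  have hneg : ∀ q ∈ Icc (q₀ - η) (q₀ + η), -q ∈ Icc (-q₀ - η) (-q₀ + η) := fun q h =>
    ⟨by linarith [h.2], by linarith [h.1]⟩
  -- A zero of `G` is a common momentum for which the kink condition holds. The curve through the
  -- right state is that of the reflected problem and is therefore evaluated at `-q`.
  set G : ℝ → ℝ := fun q => P₂ (-q) - P₁ q + c * q with hG
  have hGc : ContinuousOn G (Icc (q₀ - η) (q₀ + η)) :=
    ((hP₂.comp continuous_neg.continuousOn hneg).sub hP₁).add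
      (continuousOn_const.mul continuousOn_id)
  have hle : q₀ - η ≤ q₀ + η := by linarith
  have hGl : G (q₀ - η) ≤ 0 := by
    have k1 := (K₁ _ (left_mem_Icc.2 hle)).2.2 m₁.1
    have k2 := (K₂ _ (hneg _ (left_mem_Icc.2 hle))).2.1 (by linarith [m₂.2])
    rw [dynPressure_refl] at k2
    simp only [hG]
    linarith
  have hGr : 0 ≤ G (q₀ + η) := by
    have k1 := (K₁ _ (right_mem_Icc.2 hle)).2.1 m₁.2
    have k2 := (K₂ _ (hneg _ (right_mem_Icc.2 hle))).2.2 (by linarith [m₂.1])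
    rw [dynPressure_refl] at k2
    simp only [hG]
    linarith
  obtain ⟨q, hq, hGq⟩ := intermediate_value_Icc hle hGc ⟨hGl, hGr⟩
  obtain ⟨ρ₁, a₁, b₁, W₁, s₁, t₁, w₁, n₁⟩ := (K₁ q hq).1
  obtain ⟨ρ₂, a₂, b₂, W₂, s₂, t₂, w₂, n₂⟩ := (K₂ (-q) (hneg q hq)).1
  have w₂' := w₂.reflect hp
  have er : refl (ρ₂, -q) = (ρ₂, q) := by simp [refl]
  rw [refl_refl, er] at w₂'
  rw [← refl_mem_subsonic, er] at s₂
  rw [← dynPressure_refl, er] at t₂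
  refine ⟨(ρ₁, q), s₁, (ρ₂, q), s₂, a₁, b₁, -b₂, -a₂, W₁, _, w₁, n₁, ⟨rfl, ?_⟩, w₂',
    by linarith⟩
  rw [← t₁, ← t₂]
  simp only [hG] at hGq
  simp only
  linarith

/-! ### Balance laws for single waves -/

/-- `Q` is the flux accompanying the density `η`: `dQ = dη ∘ DF`. -/
def IsEntropyPair (p : ℝ → ℝ) (η Q : ℝ × ℝ → ℝ) : Prop :=
  ∀ u : ℝ × ℝ, 0 < u.1 → ∃ L : ℝ × ℝ →L[ℝ] ℝ, HasFDerivAt η L u ∧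
    HasFDerivAt Q (L.comp (fluxDeriv p u)) u

theorem isEntropyPair_mass (p : ℝ → ℝ) : IsEntropyPair p Prod.fst Prod.snd := fun _ _ =>
  ⟨ContinuousLinearMap.fst ℝ ℝ ℝ, hasFDerivAt_fst, hasFDerivAt_snd⟩

theorem isEntropyPair_momentum {p : ℝ → ℝ} (hp : PressureLaw p) :
    IsEntropyPair p Prod.snd (dynPressure p) := fun _ hu =>
  ⟨ContinuousLinearMap.snd ℝ ℝ ℝ, hasFDerivAt_snd, hasFDerivAt_dynPressure hp hu⟩

theorem isEntropyPair_entropy {p : ℝ → ℝ} (hp : PressureLaw p) {ρref : ℝ} (hr : 0 < ρref) :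
    IsEntropyPair p (entropy p ρref) (entropyFlux p ρref) := by
  intro u hu
  have h1 : HasFDerivAt (fun u : ℝ × ℝ => u.1) (ContinuousLinearMap.fst ℝ ℝ ℝ) u := hasFDerivAt_fst
  have h2 : HasFDerivAt (fun u : ℝ × ℝ => u.2) (ContinuousLinearMap.snd ℝ ℝ ℝ) u := hasFDerivAt_snd
  have hI := (hasDerivAt_integral_pressure hp hr hu).comp_hasFDerivAt u h1
  have hP := (hp.hasDerivAt hu).comp_hasFDerivAt u h1
  have hv := h2.mul ((hasDerivAt_inv hu.ne').comp_hasFDerivAt u h1)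
  have hk := (h2.pow 2).mul ((hasDerivAt_inv (x := 2 * u.1)
    (by positivity)).comp_hasFDerivAt u (h1.const_mul 2))
  have hE := hk.add (h1.mul hI)
  refine ⟨_, hE, ?_⟩
  refine (hv.mul (hE.add hP)).congr_fderiv ?_
  set I := ∫ r in ρref..u.1, p r / r ^ 2 with hI
  ext <;> simp [fluxDeriv] <;> rw [← hI] <;> field_simp <;> ring

/-- Along a sonic or constant piece the derivative of `Q - ξ η` is `-η`, since the tangent is
annihilated by `DF - ξ`. So the integrand is the derivative of `(Q - ξ η) ψ`. -/
theorem IsEntropyPair.weak_smooth {p : ℝ → ℝ} {η Q : ℝ × ℝ → ℝ} (h : IsEntropyPair p η Q)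
    {x y : ℝ} (hxy : x ≤ y) {W V : ℝ → ℝ × ℝ} (hV : ContinuousOn V (Icc x y))
    (hpos : ∀ ξ ∈ Icc x y, 0 < (V ξ).1)
    (hd : ∀ ξ ∈ Ioo x y, ∃ V', HasDerivAt V V' ξ ∧ fluxDeriv p (V ξ) V' = ξ • V')
    (hW : ∀ ξ ∈ Ioo x y, W ξ = V ξ) {ψ : ℝ → ℝ} (hψ : ContDiff ℝ 1 ψ) :
    IntervalIntegrable (fun ξ => (Q (W ξ) - ξ * η (W ξ)) * deriv ψ ξ - η (W ξ) * ψ ξ) volume x y ∧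
    ∫ ξ in x..y, ((Q (W ξ) - ξ * η (W ξ)) * deriv ψ ξ - η (W ξ) * ψ ξ) =
      (Q (V y) - y * η (V y)) * ψ y - (Q (V x) - x * η (V x)) * ψ x := by
  have hηc : ContinuousOn (fun ξ => η (V ξ)) (Icc x y) := fun ξ hξ => by
    obtain ⟨L, h1, -⟩ := h _ (hpos ξ hξ)
    exact h1.continuousAt.comp_continuousWithinAt (hV ξ hξ)
  have hQc : ContinuousOn (fun ξ => Q (V ξ)) (Icc x y) := fun ξ hξ => by
    obtain ⟨L, -, h1⟩ := h _ (hpos ξ hξ)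
    exact h1.continuousAt.comp_continuousWithinAt (hV ξ hξ)
  have hG : ContinuousOn (fun ξ => Q (V ξ) - ξ * η (V ξ)) (Icc x y) :=
    hQc.sub (continuousOn_id.mul hηc)
  have hcont : ContinuousOn
      (fun ξ => (Q (V ξ) - ξ * η (V ξ)) * deriv ψ ξ - η (V ξ) * ψ ξ) (Icc x y) :=
    (hG.mul (hψ.continuous_deriv le_rfl).continuousOn).sub (hηc.mul hψ.continuous.continuousOn)
  have hint := hcont.intervalIntegrable_of_Icc (μ := volume) hxy
  have hcongr : ∀ᵐ ξ, ξ ∈ uIoc x y →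
      (Q (V ξ) - ξ * η (V ξ)) * deriv ψ ξ - η (V ξ) * ψ ξ =
      (Q (W ξ) - ξ * η (W ξ)) * deriv ψ ξ - η (W ξ) * ψ ξ := by
    have hne : ∀ᵐ ξ : ℝ, ξ ≠ y := by simp [ae_iff, measure_singleton]
    filter_upwards [hne] with ξ h1 h2
    rw [uIoc_of_le hxy] at h2
    rw [hW ξ ⟨h2.1, lt_of_le_of_ne h2.2 h1⟩]
  refine ⟨hint.congr_ae ((ae_restrict_iff' measurableSet_uIoc).2 hcongr), ?_⟩
  rw [← intervalIntegral.integral_congr_ae hcongr]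
  refine intervalIntegral.integral_eq_sub_of_hasDerivAt_of_le
    (f := fun ξ => (Q (V ξ) - ξ * η (V ξ)) * ψ ξ) hxy
    (hG.mul hψ.continuous.continuousOn) (fun ξ hξ => ?_) hint
  obtain ⟨L, h1, h2⟩ := h _ (hpos ξ ⟨hξ.1.le, hξ.2.le⟩)
  obtain ⟨V', h3, h4⟩ := hd ξ hξ
  have e1 : HasDerivAt (fun ξ => η (V ξ)) (L V') ξ := h1.comp_hasDerivAt ξ h3
  have e2 : HasDerivAt (fun ξ => Q (V ξ)) (ξ * L V') ξ := by
    refine (h2.comp_hasDerivAt ξ h3).congr_deriv ?_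
    rw [ContinuousLinearMap.comp_apply, h4, map_smul, smul_eq_mul]
  refine ((e2.sub ((hasDerivAt_id ξ).mul e1)).mul
    (hψ.differentiable one_ne_zero ξ).hasDerivAt).congr_deriv ?_
  simp only [id, one_mul, Pi.sub_apply, Pi.mul_apply]
  ring

/-- The production of the pair `(η, Q)` in a discontinuity of speed `s`. -/
def production (η Q : ℝ × ℝ → ℝ) (s : ℝ) (uL uR : ℝ × ℝ) : ℝ :=
  (Q uL - s * η uL) - (Q uR - s * η uR)

/-- The boundary terms of consecutive smooth pieces cancel where the wave is continuous; a shock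
leaves its production `D`. -/
theorem IsMonotoneWave.weak {p : ℝ → ℝ} (hp : PressureLaw p) {i : Fin 2} {uL uR : ℝ × ℝ} {a b : ℝ}
    {W : ℝ → ℝ × ℝ} (hW : IsMonotoneWave p i uL uR a b W) (hL : uL ∈ subsonic p)
    (hR : uR ∈ subsonic p) {η Q : ℝ × ℝ → ℝ} (h : IsEntropyPair p η Q) :
    a ≤ b ∧ ∃ D, (D = 0 ∨ (flux p uR - flux p uL = a • (uR - uL) ∧ charSpeed p i uR < a ∧
        a < charSpeed p i uL ∧ D = production η Q a uL uR)) ∧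
      ∀ α β, α ≤ a → b ≤ β → ∀ ψ : ℝ → ℝ, ContDiff ℝ 1 ψ →
        IntervalIntegrable (fun ξ => (Q (W ξ) - ξ * η (W ξ)) * deriv ψ ξ - η (W ξ) * ψ ξ)
          volume α β ∧
        ∫ ξ in α..β, ((Q (W ξ) - ξ * η (W ξ)) * deriv ψ ξ - η (W ξ) * ψ ξ) =
          (Q uR - β * η uR) * ψ β - (Q uL - α * η uL) * ψ α + D * ψ a := by
  obtain ⟨⟨h1, h2, h3⟩, hm, -, -⟩ := hW
  have left : ∀ α, α ≤ a → ∀ ψ : ℝ → ℝ, ContDiff ℝ 1 ψ →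
      _ := fun α hα ψ hψ =>
    h.weak_smooth hα (W := W) (V := fun _ => uL) continuousOn_const (fun _ _ => hL.1)
      (fun ξ _ => ⟨0, hasDerivAt_const _ _, by simp⟩) (fun ξ hξ => h1 ξ hξ.2) hψ
  have right : ∀ β, b ≤ β → ∀ ψ : ℝ → ℝ, ContDiff ℝ 1 ψ →
      _ := fun β hβ ψ hψ =>
    h.weak_smooth hβ (W := W) (V := fun _ => uR) continuousOn_const (fun _ _ => hR.1)
      (fun ξ _ => ⟨0, hasDerivAt_const _ _, by simp⟩) (fun ξ hξ => h2 ξ hξ.1) hψ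
  rcases h3 with ⟨rfl, -, rfl⟩ | ⟨rfl, h4, h5, h6⟩ | ⟨h4, h5, h6, h7, h8, h9, h10⟩
  · refine ⟨le_rfl, 0, Or.inl rfl, fun α β hα hβ ψ hψ => ?_⟩
    obtain ⟨i1, e1⟩ := left α hα ψ hψ
    obtain ⟨i2, e2⟩ := right β hβ ψ hψ
    refine ⟨i1.trans i2, ?_⟩
    rw [← intervalIntegral.integral_add_adjacent_intervals i1 i2, e1, e2]
    ring
  · refine ⟨le_rfl, _, Or.inr ⟨h4, h5, h6, rfl⟩, fun α β hα hβ ψ hψ => ?_⟩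
    obtain ⟨i1, e1⟩ := left α hα ψ hψ
    obtain ⟨i2, e2⟩ := right β hβ ψ hψ
    refine ⟨i1.trans i2, ?_⟩
    rw [← intervalIntegral.integral_add_adjacent_intervals i1 i2, e1, e2, production]
    ring
  · refine ⟨h4.le, 0, Or.inl rfl, fun α β hα hβ ψ hψ => ?_⟩
    obtain ⟨i1, e1⟩ := left α hα ψ hψ
    obtain ⟨i2, e2⟩ := h.weak_smooth h4.le (W := W) h7 (fun ξ _ => (hm ξ).1) (fun ξ hξ => by
      obtain ⟨-, V, d1, d2⟩ := h10 ξ hξ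
      rw [(hasFDerivAt_flux hp (hm ξ).1).fderiv] at d2
      exact ⟨V, d1, d2⟩) (fun ξ _ => rfl) hψ
    obtain ⟨i3, e3⟩ := right β hβ ψ hψ
    refine ⟨(i1.trans i2).trans i3, ?_⟩
    rw [← intervalIntegral.integral_add_adjacent_intervals (i1.trans i2) i3,
      ← intervalIntegral.integral_add_adjacent_intervals i1 i2, e1, e2, e3, h8, h9]
    ring

/-! ### Production at shocks and at the kink -/

theorem production_mass {p : ℝ → ℝ} {uL uR : ℝ × ℝ} {s : ℝ}
    (h : flux p uR - flux p uL = s • (uR - uL)) : production Prod.fst Prod.snd s uL uR = 0 := by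
  have h1 : uR.2 - uL.2 = s * (uR.1 - uL.1) := congrArg Prod.fst h
  rw [production]
  linarith

theorem production_momentum {p : ℝ → ℝ} {uL uR : ℝ × ℝ} {s : ℝ}
    (h : flux p uR - flux p uL = s • (uR - uL)) :
    production Prod.snd (dynPressure p) s uL uR = 0 := by
  have h1 : dynPressure p uR - dynPressure p uL = s * (uR.2 - uL.2) := congrArg Prod.snd h
  rw [production]
  linarith

/-- Lax shocks produce entropy of the right sign. -/
theorem production_entropy_nonneg {p : ℝ → ℝ} (hp : PressureLaw p) {ρref : ℝ} (hr : 0 < ρref)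
    {i : Fin 2} {uL uR : ℝ × ℝ} (hL : 0 < uL.1) (hR : 0 < uR.1) {s : ℝ}
    (h : flux p uR - flux p uL = s • (uR - uL)) (h1 : charSpeed p i uR < s)
    (h2 : s < charSpeed p i uL) :
    0 ≤ production (entropy p ρref) (entropyFlux p ρref) s uL uR := by
  obtain ⟨hm, hh⟩ := relative_of_rankineHugoniot hL hR h
  rw [production, entropyFlux_sub_mul_entropy hL, entropyFlux_sub_mul_entropy hR, hm]
  rw [hm] at hh
  set m := uL.2 - s * uL.1 with hmdef
  have vL : uL.2 / uL.1 = s + m / uL.1 := by rw [hmdef]; field_simp; ring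
  have vR : uR.2 / uR.1 = s + m / uR.1 := by rw [← hm]; field_simp; ring
  have key : ∀ {ρ : ℝ}, 0 < ρ → (m ^ 2 / ρ ^ 2 < deriv p ρ ↔ |m / ρ| < √(deriv p ρ)) := by
    intro ρ hρ
    rw [← div_pow, Real.lt_sqrt (abs_nonneg _), sq_abs]
  rw [hh]
  suffices 0 ≤ m * (bernoulli p ρref m uL.1 - bernoulli p ρref m uR.1) by linarith
  -- For the first family the inequality at the left state gives `m > 0`, for the second the
  -- inequality at the right state gives `m < 0`. In both cases the incoming flow is supersonic
  -- relative to the shock.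
  have hcases : (√(deriv p uL.1) < m / uL.1 ∧ 0 < m) ∨ (m / uR.1 < -√(deriv p uR.1) ∧ m < 0) := by
    have sL := Real.sqrt_nonneg (deriv p uL.1)
    have sR := Real.sqrt_nonneg (deriv p uR.1)
    fin_cases i
    · simp only [charSpeed, Fin.zero_eta, if_pos] at h2
      have h3 : √(deriv p uL.1) < m / uL.1 := by linarith
      exact Or.inl ⟨h3, (div_pos_iff_of_pos_right hL).1 (sL.trans_lt h3)⟩
    · simp only [charSpeed, Fin.mk_one, one_ne_zero, if_false] at h1
      have h3 : m / uR.1 < -√(deriv p uR.1) := by linarith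
      exact Or.inr ⟨h3, by
        by_contra! hcon
        linarith [div_nonneg hcon hR.le]⟩
  rcases hcases with ⟨h3, h4⟩ | ⟨h3, h4⟩
  · refine mul_nonneg h4.le ?_
    rcases lt_trichotomy uL.1 uR.1 with h5 | h5 | h5
    · exact sub_nonneg.2 (bernoulli_lt hp hr hL h5 h4.ne' hh.symm).1.le
    · rw [h5, sub_self]
    · have h6 := (key hL).1 (bernoulli_lt hp hr hR h5 h4.ne' hh).2.2
      exact absurd h3 (not_lt.2 ((le_abs_self _).trans h6.le))
  · refine mul_nonneg_of_nonpos_of_nonpos h4.le ?_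
    rcases lt_trichotomy uL.1 uR.1 with h5 | h5 | h5
    · have h6 := (key hR).1 (bernoulli_lt hp hr hL h5 h4.ne hh.symm).2.2
      linarith [neg_abs_le (m / uR.1)]
    · rw [h5, sub_self]
    · exact sub_nonpos.2 (bernoulli_lt hp hr hR h5 h4.ne hh).1.le

/-- Along subsonic states of equal momentum the dynamic pressure and the Bernoulli function
increase with the density. -/
theorem dynPressure_lt_bernoulli_le {p : ℝ → ℝ} (hp : PressureLaw p) {ρref : ℝ} (hr : 0 < ρref)
    {ρ₁ ρ₂ q : ℝ} (h : (ρ₁, q) ∈ subsonic p) (h₁₂ : ρ₁ < ρ₂) :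
    dynPressure p (ρ₁, q) < dynPressure p (ρ₂, q) ∧
      bernoulli p ρref q ρ₁ ≤ bernoulli p ρref q ρ₂ := by
  have h0 : 0 < ρ₁ := h.1
  have hpos : ∀ ρ, ρ₁ ≤ ρ → 0 < deriv p ρ - q ^ 2 / ρ ^ 2 := fun ρ hρ => by
    have hρ0 := h0.trans_le hρ
    have h1 := (mem_subsonic_iff.1 h).2.trans_le (mul_sqrt_deriv_le hp h0 hρ)
    rw [sub_pos, div_lt_iff₀ (by positivity), ← sq_abs, ← hp.sq_sqrt_deriv hρ0, ← mul_pow,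
      mul_comm]
    exact pow_lt_pow_left₀ h1 (abs_nonneg _) two_ne_zero
  constructor
  · have hd : ∀ ρ, 0 < ρ → HasDerivAt (fun ρ => q ^ 2 / ρ + p ρ) (deriv p ρ - q ^ 2 / ρ ^ 2) ρ := by
      intro ρ hρ
      refine (((hasDerivAt_inv hρ.ne').const_mul (q ^ 2)).add (hp.hasDerivAt hρ)).congr_deriv ?_
      field_simp
      ring
    refine strictMonoOn_of_deriv_pos (f := fun ρ => q ^ 2 / ρ + p ρ) (convex_Ici ρ₁)
      (fun ρ hρ => (hd ρ (h0.trans_le hρ)).continuousAt.continuousWithinAt) (fun ρ hρ => ?_)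
      (mem_Ici.2 le_rfl) (mem_Ici.2 h₁₂.le) h₁₂
    rw [interior_Ici] at hρ
    rw [(hd ρ (h0.trans hρ)).deriv]
    exact hpos ρ (le_of_lt hρ)
  · have hd : ∀ ρ : ℝ, 0 < ρ → HasDerivAt (bernoulli p ρref q) ((deriv p ρ - q ^ 2 / ρ ^ 2) / ρ) ρ :=
      fun ρ hρ => hasDerivAt_bernoulli hp hr hρ q
    refine monotoneOn_of_deriv_nonneg (convex_Ici ρ₁)
      (fun ρ hρ => (hd ρ (h0.trans_le hρ)).continuousAt.continuousWithinAt) (fun ρ hρ => ?_)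
      (fun ρ hρ => ?_) (mem_Ici.2 le_rfl) (mem_Ici.2 h₁₂.le) h₁₂.le
    all_goals rw [interior_Ici] at hρ
    · exact (hd ρ (h0.trans hρ)).differentiableAt.differentiableWithinAt
    · rw [(hd ρ (h0.trans hρ)).deriv]
      exact div_nonneg (hpos ρ (le_of_lt hρ)).le (h0.trans hρ).le

/-- The entropy flow does not increase through the kink. -/
theorem KinkCondition.entropyFlux_le {p : ℝ → ℝ} (hp : PressureLaw p) {ρref : ℝ} (hr : 0 < ρref)
    {c : ℝ} (hc : 0 ≤ c) {um up : ℝ × ℝ} (hm : um ∈ subsonic p) (hup : up ∈ subsonic p)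
    (h : KinkCondition p c um up) : entropyFlux p ρref up ≤ entropyFlux p ρref um := by
  obtain ⟨ρ₁, q⟩ := um
  obtain ⟨ρ₂, q'⟩ := up
  obtain ⟨rfl, h2⟩ := h
  have e1 := entropyFlux_sub_mul_entropy (p := p) (ρref := ρref) hm.1 0
  have e2 := entropyFlux_sub_mul_entropy (p := p) (ρref := ρref) hup.1 0
  simp only [zero_mul, sub_zero, mul_zero, add_zero, ne_eq, OfNat.ofNat_ne_zero,
    not_false_eq_true, zero_pow, zero_div] at e1 e2
  simp only at h2
  rw [e1, e2]
  -- At speed zero the entropy flow is `q` times the Bernoulli function. If the density rises, so do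
  -- `P` and the Bernoulli function, and `[P] = -c q > 0` with `c ≥ 0` forces `q ≤ 0`; the other
  -- case is symmetric.
  rcases lt_trichotomy ρ₁ ρ₂ with h3 | rfl | h3
  · obtain ⟨h4, h5⟩ := dynPressure_lt_bernoulli_le hp hr hm h3
    exact mul_le_mul_of_nonpos_left h5 (by nlinarith)
  · exact le_rfl
  · obtain ⟨h4, h5⟩ := dynPressure_lt_bernoulli_le hp hr hup h3
    exact mul_le_mul_of_nonneg_left h5 (by nlinarith)

/-! ### Weak formulation for self-similar functions -/

theorem IsTest.exists_bounds {φ : ℝ × ℝ → ℝ} (hφ : IsTest φ) :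
    ∃ τ₁ > 0, ∃ τ₂ X : ℝ, ∀ t x, (t, x) ∈ tsupport φ → t ∈ Icc τ₁ τ₂ ∧ |x| ≤ X := by
  obtain ⟨-, hc, hs⟩ := hφ
  have hb := hc.isCompact.isBounded
  obtain ⟨R, hR⟩ := hb.subset_closedBall 0
  have hRb : ∀ t x, (t, x) ∈ tsupport φ → |t| ≤ R ∧ |x| ≤ R := fun t x h => by
    have := hR h
    rw [mem_closedBall_zero_iff, Prod.norm_def] at this
    exact ⟨(le_max_left _ _).trans this, (le_max_right _ _).trans this⟩
  rcases (tsupport φ).eq_empty_or_nonempty with h | h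
  · exact ⟨1, one_pos, 0, 0, fun t x hx => by rw [h] at hx; exact hx.elim⟩
  obtain ⟨z, hz, hmin⟩ := hc.isCompact.exists_isMinOn h continuous_fst.continuousOn
  exact ⟨z.1, (hs hz).1, R, R, fun t x hx =>
    ⟨⟨hmin hx, (le_abs_self t).trans (hRb t x hx).1⟩, (hRb t x hx).2⟩⟩

theorem IsTest.dt_eq {φ : ℝ × ℝ → ℝ} (hφ : IsTest φ) (t x : ℝ) :
    dt φ t x = fderiv ℝ φ (t, x) (1, 0) := by
  have h := (hφ.1.differentiable one_ne_zero (t, x)).hasFDerivAt.comp_hasDerivAt t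
    ((hasDerivAt_id t).prodMk (hasDerivAt_const t x))
  exact h.deriv

theorem IsTest.dx_eq {φ : ℝ × ℝ → ℝ} (hφ : IsTest φ) (t x : ℝ) :
    dx φ t x = fderiv ℝ φ (t, x) (0, 1) := by
  have h := (hφ.1.differentiable one_ne_zero (t, x)).hasFDerivAt.comp_hasDerivAt x
    ((hasDerivAt_const x t).prodMk (hasDerivAt_id x))
  exact h.deriv

theorem IsTest.integrable_ray {φ : ℝ × ℝ → ℝ} (hφ : IsTest φ) (ξ : ℝ) :
    Integrable fun t => φ (t, t * ξ) := by
  have hcont : Continuous fun t : ℝ => φ (t, t * ξ) := hφ.1.continuous.comp (by fun_prop)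
  refine hcont.integrable_of_hasCompactSupport (HasCompactSupport.of_support_subset_isCompact
    (hφ.2.1.isCompact.image continuous_fst) fun t ht => ?_)
  exact ⟨(t, t * ξ), subset_tsupport φ ht, rfl⟩

theorem IsTest.slice {φ : ℝ × ℝ → ℝ} (hφ : IsTest φ) {t : ℝ} (ht : 0 < t) :
    ContDiff ℝ 1 (fun ξ => φ (t, t * ξ)) ∧ HasCompactSupport fun ξ => φ (t, t * ξ) := by
  refine ⟨hφ.1.comp (by fun_prop), HasCompactSupport.of_support_subset_isCompact
    (hφ.2.1.isCompact.image (f := fun z : ℝ × ℝ => z.2 / t) (by fun_prop)) fun ξ hξ => ?_⟩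
  exact ⟨(t, t * ξ), subset_tsupport φ hξ, mul_div_cancel_left₀ _ ht.ne'⟩

/-- For a general test function the substitution `x = t ξ` splits the integrand into `a ∂ₜ(t φ(t, t
ξ))`, which integrates to zero in `t`, and the weak form in `ξ` for the slice `φ(t, t ·)`, which is
`K`. -/
theorem integral_selfSimilar {a b : ℝ → ℝ} {C : ℝ} (ha : AEStronglyMeasurable a volume)
    (hb : AEStronglyMeasurable b volume) (haC : ∀ ξ, |a ξ| ≤ C) (hbC : ∀ ξ, |b ξ| ≤ C)
    {K : (ℝ → ℝ) → ℝ} (hK : ∀ ψ, ContDiff ℝ 1 ψ → HasCompactSupport ψ →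
      ∫ ξ, ((b ξ - ξ * a ξ) * deriv ψ ξ - a ξ * ψ ξ) = K ψ)
    {φ : ℝ × ℝ → ℝ} (hφ : IsTest φ)
    (hKi : IntegrableOn (fun t => K fun ξ => φ (t, t * ξ)) (Ioi 0)) :
    ∫ t in Ioi (0 : ℝ), ∫ x, (a (x / t) * dt φ t x + b (x / t) * dx φ t x) =
      ∫ t in Ioi (0 : ℝ), K fun ξ => φ (t, t * ξ) := by
  obtain ⟨τ₁, hτ₁, τ₂, X, hbd⟩ := hφ.exists_bounds
  have hDc : Continuous (fderiv ℝ φ) := hφ.1.continuous_fderiv one_ne_zero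
  -- The derivative of `t φ(t, t ξ)` in `t`. Its support is compact because `t` stays away from zero
  -- on the support of `φ`.
  set h : ℝ × ℝ → ℝ := fun z =>
    φ (z.1, z.1 * z.2) + z.1 * fderiv ℝ φ (z.1, z.1 * z.2) (1, z.2) with hh
  have hhc : Continuous h := by
    have h1 : Continuous fun z : ℝ × ℝ => (z.1, z.1 * z.2) := by fun_prop
    have h2 : Continuous fun z : ℝ × ℝ => ((1 : ℝ), z.2) := by fun_prop
    exact (hφ.1.continuous.comp h1).add (continuous_fst.mul ((hDc.comp h1).clm_apply h2))
  have hH : ∀ t ξ, HasDerivAt (fun t => t * φ (t, t * ξ)) (h (t, ξ)) t := fun t ξ => by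
    have h1 := (hφ.1.differentiable one_ne_zero (t, t * ξ)).hasFDerivAt.comp_hasDerivAt t
      ((hasDerivAt_id t).prodMk ((hasDerivAt_id t).mul_const ξ))
    refine ((hasDerivAt_id t).mul h1).congr_deriv ?_
    simp [hh]
  have hsupp : ∀ t ξ, (t, t * ξ) ∉ tsupport φ → h (t, ξ) = 0 := fun t ξ hz => by
    have h1 : fderiv ℝ φ (t, t * ξ) = 0 :=
      image_eq_zero_of_notMem_tsupport fun hcon => hz (tsupport_fderiv_subset ℝ hcon)
    simp only [hh, image_eq_zero_of_notMem_tsupport hz, h1]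
    simp
  have hhs : HasCompactSupport h := by
    refine HasCompactSupport.of_support_subset_isCompact
      (isCompact_Icc.prod isCompact_Icc : IsCompact (Icc τ₁ τ₂ ×ˢ Icc (-(X / τ₁)) (X / τ₁)))
      fun z hz => ?_
    have hz' : (z.1, z.1 * z.2) ∈ tsupport φ := by
      by_contra hcon
      exact hz (hsupp z.1 z.2 hcon)
    obtain ⟨h1, h2⟩ := hbd _ _ hz'
    refine ⟨h1, abs_le.1 ?_⟩
    rw [le_div_iff₀ hτ₁]
    rw [abs_mul, abs_of_pos (hτ₁.trans_le h1.1)] at h2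
    nlinarith [abs_nonneg z.2, h1.1]
  have hint : Integrable (Function.uncurry fun t ξ => a ξ * h (t, ξ))
      ((volume : Measure ℝ).prod (volume : Measure ℝ)) := by
    have h1 : Integrable h ((volume : Measure ℝ).prod (volume : Measure ℝ)) :=
      hhc.integrable_of_hasCompactSupport hhs
    refine h1.bdd_mul (c := C) (f := fun z : ℝ × ℝ => a z.2) ha.comp_snd
      (Eventually.of_forall fun z => haC z.2)
  have hzero : ∫ t in Ioi (0 : ℝ), ∫ ξ, a ξ * h (t, ξ) = 0 := by
    rw [setIntegral_eq_integral_of_forall_compl_eq_zero fun t ht => by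
      have : ∀ ξ, h (t, ξ) = 0 := fun ξ => hsupp t ξ fun hcon => ht (hφ.2.2 hcon).1
      simp [this]]
    rw [integral_integral_swap hint]
    have : ∀ ξ, ∫ t, a ξ * h (t, ξ) = 0 := fun ξ => by
      rw [integral_const_mul]
      have hemb : HasCompactSupport fun t => h (t, ξ) :=
        HasCompactSupport.of_support_subset_isCompact (hhs.isCompact.image continuous_fst)
          fun t ht => ⟨(t, ξ), subset_tsupport h ht, rfl⟩
      have e := integral_eq_zero_of_hasDerivAt_of_integrable (fun t => hH t ξ)
        ((hhc.comp (by fun_prop : Continuous fun t : ℝ => (t, ξ))).integrable_of_hasCompactSupport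
          hemb)
        (by
          have hc : Continuous fun t : ℝ => t * φ (t, t * ξ) :=
            continuous_id.mul (hφ.1.continuous.comp (by fun_prop))
          refine hc.integrable_of_hasCompactSupport
            (HasCompactSupport.of_support_subset_isCompact
              (hφ.2.1.isCompact.image continuous_fst) fun t ht => ?_)
          exact ⟨(t, t * ξ), subset_tsupport φ (right_ne_zero_of_mul ht), rfl⟩)
      rw [e, mul_zero]
    simp [this]
  have inner : ∀ t ∈ Ioi (0 : ℝ), ∫ x, (a (x / t) * dt φ t x + b (x / t) * dx φ t x) =
      (∫ ξ, a ξ * h (t, ξ)) + K fun ξ => φ (t, t * ξ) := by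
    intro t ht
    have ht0 : 0 < t := ht
    obtain ⟨s1, s2⟩ := hφ.slice ht0
    have hd : ∀ ξ, deriv (fun ξ => φ (t, t * ξ)) ξ = t * fderiv ℝ φ (t, t * ξ) (0, 1) := fun ξ => by
      have h1 := (hφ.1.differentiable one_ne_zero (t, t * ξ)).hasFDerivAt.comp_hasDerivAt ξ
        ((hasDerivAt_const ξ t).prodMk ((hasDerivAt_id ξ).const_mul t))
      have h2 : ((0 : ℝ), t * 1) = t • ((0 : ℝ), (1 : ℝ)) := by simp
      rw [h2, map_smul, smul_eq_mul] at h1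
      exact h1.deriv
    have e1 : ∫ x, (a (x / t) * dt φ t x + b (x / t) * dx φ t x) =
        ∫ x, (fun ξ => a ξ * dt φ t (t * ξ) + b ξ * dx φ t (t * ξ)) (x / t) := by
      congr 1
      ext x
      simp only [mul_div_cancel₀ _ ht0.ne']
    have i1 : Integrable fun ξ => a ξ * h (t, ξ) := by
      refine integrable_mul_of_bounded_on (C := C) ha
        (hhc.comp (by fun_prop : Continuous fun ξ : ℝ => (t, ξ)))
        (HasCompactSupport.of_support_subset_isCompact (hhs.isCompact.image continuous_snd)
          fun ξ hξ => ⟨(t, ξ), subset_tsupport h hξ, rfl⟩)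
        (Eventually.of_forall fun ξ _ => haC ξ)
    have d1 := s1.continuous_deriv le_rfl
    have i2 : Integrable fun ξ => (b ξ - ξ * a ξ) * deriv (fun ξ => φ (t, t * ξ)) ξ -
        a ξ * φ (t, t * ξ) := by
      refine Integrable.sub ?_ (integrable_mul_of_bounded_on ha s1.continuous s2
        (Eventually.of_forall fun ξ _ => haC ξ))
      refine ((integrable_mul_of_bounded_on hb d1 s2.deriv
        (Eventually.of_forall fun ξ _ => hbC ξ)).sub (integrable_mul_of_bounded_on ha
          (continuous_id.mul d1) s2.deriv.mul_left
            (Eventually.of_forall fun ξ _ => haC ξ))).congr (Eventually.of_forall fun ξ => ?_)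
      simp only [Pi.sub_apply, Pi.mul_apply, id]
      ring
    rw [e1, Measure.integral_comp_div
      (fun ξ => a ξ * dt φ t (t * ξ) + b ξ * dx φ t (t * ξ)) t, abs_of_pos ht0, smul_eq_mul,
      ← hK _ s1 s2, ← integral_add i1 i2, ← integral_const_mul]
    congr 1
    ext ξ
    have h2 : ((1 : ℝ), ξ) = (1, 0) + ξ • (0, 1) := by simp
    rw [hd, hφ.dt_eq, hφ.dx_eq]
    simp only [hh]
    rw [h2, map_add, map_smul, smul_eq_mul]
    ring
  have hil : Integrable fun t => ∫ ξ, a ξ * h (t, ξ) := hint.integral_prod_left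
  rw [setIntegral_congr_fun measurableSet_Ioi inner, integral_add hil.integrableOn hKi, hzero,
    zero_add]

/-! ### The solution of the Riemann problem -/

/-- Incrementwise domination; it serves both for pairs of functions and for gluing at `ξ = 0`. -/
theorem boundedVariationOn_of_edist_le {E F G : Type*} [PseudoEMetricSpace E]
    [PseudoEMetricSpace F] [PseudoEMetricSpace G] {f : ℝ → E} {g : ℝ → F} {h : ℝ → G}
    {s : Set ℝ} (hg : BoundedVariationOn g s) (hh : BoundedVariationOn h s)
    (H : ∀ x y, x ≤ y → edist (f y) (f x) ≤ edist (g y) (g x) + edist (h y) (h x)) :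
    BoundedVariationOn f s := by
  refine ne_top_of_le_ne_top (ENNReal.add_ne_top.2 ⟨hg, hh⟩) (iSup_le ?_)
  rintro ⟨n, ⟨v, hv, vs⟩⟩
  calc ∑ i ∈ Finset.range n, edist (f (v (i + 1))) (f (v i))
      ≤ ∑ i ∈ Finset.range n, (edist (g (v (i + 1))) (g (v i)) +
          edist (h (v (i + 1))) (h (v i))) :=
        Finset.sum_le_sum fun i _ => H _ _ (hv (Nat.le_succ i))
    _ = _ := Finset.sum_add_distrib
    _ ≤ _ := add_le_add (eVariationOn.sum_le hv fun i => vs i) (eVariationOn.sum_le hv fun i => vs i)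

theorem boundedVariationOn_of_monotone_or_antitone {f : ℝ → ℝ} {C : ℝ}
    (hf : Monotone f ∨ Antitone f) (hC : ∀ x, |f x| ≤ C) : BoundedVariationOn f univ := by
  rcases hf with hf | hf
  · exact (hf.monotoneOn univ).boundedVariationOn fun x _ => hC x
  · have h1 : BoundedVariationOn (fun x => -f x) univ :=
      (hf.neg.monotoneOn univ).boundedVariationOn fun x _ => by rw [abs_neg]; exact hC x
    have h2 := LipschitzWith.comp_boundedVariationOn (f := fun y : ℝ => -y) (C := 1)
      (LipschitzWith.of_dist_le_mul fun x y => by simp [dist_neg_neg]) h1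
    simpa [Function.comp_def] using h2

theorem boundedVariationOn_prod {f : ℝ → ℝ × ℝ} {C : ℝ}
    (h₁ : Monotone (fun x => (f x).1) ∨ Antitone fun x => (f x).1)
    (h₂ : Monotone (fun x => (f x).2) ∨ Antitone fun x => (f x).2) (hC : ∀ x, ‖f x‖ ≤ C) :
    BoundedVariationOn f univ :=
  boundedVariationOn_of_edist_le
    (boundedVariationOn_of_monotone_or_antitone h₁ fun x => (norm_fst_le (f x)).trans (hC x))
    (boundedVariationOn_of_monotone_or_antitone h₂ fun x => (norm_snd_le (f x)).trans (hC x))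
    fun x y _ => by
      rw [Prod.edist_eq]
      exact max_le (le_add_right le_rfl) (le_add_left le_rfl)

theorem boundedVariationOn_step (u v : ℝ × ℝ) :
    BoundedVariationOn (fun ξ : ℝ => if ξ ≤ 0 then u else v) univ := by
  refine boundedVariationOn_prod (C := max ‖u‖ ‖v‖) ?_ ?_ fun ξ => ?_
  · simp only [apply_ite Prod.fst]
    exact monotone_or_antitone_step _ _ _
  · simp only [apply_ite Prod.snd]
    exact monotone_or_antitone_step _ _ _
  · split_ifs
    exacts [le_max_left _ _, le_max_right _ _]

theorem mem_uIcc_of_monotone_or_antitone {f : ℝ → ℝ} (hf : Monotone f ∨ Antitone f) {a b l r : ℝ}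
    (ha : ∀ ξ, ξ < a → f ξ = l) (hb : ∀ ξ, b < ξ → f ξ = r) (ξ : ℝ) : f ξ ∈ uIcc l r := by
  have h1 : f (min ξ (a - 1)) = l := ha _ ((min_le_right _ _).trans_lt (sub_one_lt a))
  have h2 : f (max ξ (b + 1)) = r := hb _ ((lt_add_one b).trans_le (le_max_right _ _))
  rcases hf with hf | hf
  · rw [mem_uIcc, ← h1, ← h2]
    exact Or.inl ⟨hf (min_le_left _ _), hf (le_max_left _ _)⟩
  · rw [mem_uIcc, ← h1, ← h2]
    exact Or.inr ⟨hf (le_max_left _ _), hf (min_le_left _ _)⟩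

theorem IsMonotoneWave.mem_prod {p : ℝ → ℝ} {i : Fin 2} {uL uR : ℝ × ℝ} {a b : ℝ}
    {W : ℝ → ℝ × ℝ} (h : IsMonotoneWave p i uL uR a b W) (ξ : ℝ) :
    W ξ ∈ uIcc uL.1 uR.1 ×ˢ uIcc uL.2 uR.2 :=
  ⟨mem_uIcc_of_monotone_or_antitone h.fst (fun ξ hξ => congrArg Prod.fst (h.isWave.1 ξ hξ))
      (fun ξ hξ => congrArg Prod.fst (h.isWave.2.1 ξ hξ)) ξ,
    mem_uIcc_of_monotone_or_antitone h.snd (fun ξ hξ => congrArg Prod.snd (h.isWave.1 ξ hξ))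
      (fun ξ hξ => congrArg Prod.snd (h.isWave.2.1 ξ hξ)) ξ⟩

theorem IsMonotoneWave.exists_bound {p : ℝ → ℝ} {i : Fin 2} {uL uR : ℝ × ℝ} {a b : ℝ}
    {W : ℝ → ℝ × ℝ} (h : IsMonotoneWave p i uL uR a b W) (hL : 0 < uL.1) (hR : 0 < uR.1)
    {E : Type*} [NormedAddCommGroup E] {f : ℝ × ℝ → E} (hf : ContinuousOn f {u | 0 < u.1}) :
    ∃ C, ∀ ξ, ‖f (W ξ)‖ ≤ C := by
  obtain ⟨C, hC⟩ := (isCompact_uIcc.prod isCompact_uIcc :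
    IsCompact (uIcc uL.1 uR.1 ×ˢ uIcc uL.2 uR.2)).exists_bound_of_continuousOn
    (hf.mono fun u hu => (lt_min hL hR).trans_le hu.1.1)
  exact ⟨C, fun ξ => hC _ (h.mem_prod ξ)⟩

theorem IsMonotoneWave.measurable {p : ℝ → ℝ} {i : Fin 2} {uL uR : ℝ × ℝ} {a b : ℝ}
    {W : ℝ → ℝ × ℝ} (h : IsMonotoneWave p i uL uR a b W) : Measurable W :=
  (h.fst.elim Monotone.measurable Antitone.measurable).prodMk
    (h.snd.elim Monotone.measurable Antitone.measurable)

/-- A `1`-wave in `ξ < 0` from `ul` to `um`, the stationary jump from `um` to `up`, and a `2`-wave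
in `ξ > 0` from `up` to `ur`. -/
structure IsKinkFan (p : ℝ → ℝ) (c : ℝ) (ul um up ur : ℝ × ℝ) (a₁ b₁ a₂ b₂ : ℝ)
    (W₁ W₂ : ℝ → ℝ × ℝ) : Prop where
  ul_mem : ul ∈ subsonic p
  um_mem : um ∈ subsonic p
  up_mem : up ∈ subsonic p
  ur_mem : ur ∈ subsonic p
  left : IsMonotoneWave p 0 ul um a₁ b₁ W₁
  left_neg : b₁ < 0
  kink : KinkCondition p c um up
  right : IsMonotoneWave p 1 up ur a₂ b₂ W₂
  right_pos : 0 < a₂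

/-- Juxtaposition of the waves `W₁` and `W₂` at `ξ = 0`. -/
def kinkProfile (W₁ W₂ : ℝ → ℝ × ℝ) (ξ : ℝ) : ℝ × ℝ := if ξ ≤ 0 then W₁ ξ else W₂ ξ

/-- The self-similar function of datum `(ul, ur)` and profile `kinkProfile W₁ W₂`. -/
def kinkSolution (ul ur : ℝ × ℝ) (W₁ W₂ : ℝ → ℝ × ℝ) (t x : ℝ) : ℝ × ℝ :=
  if 0 < t then kinkProfile W₁ W₂ (x / t) else riemannDatum ul ur x

namespace IsKinkFan

variable {p : ℝ → ℝ} {c : ℝ} {ul um up ur : ℝ × ℝ} {a₁ b₁ a₂ b₂ : ℝ} {W₁ W₂ : ℝ → ℝ × ℝ}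

theorem speed_le_left (hp : PressureLaw p) (h : IsKinkFan p c ul um up ur a₁ b₁ a₂ b₂ W₁ W₂) :
    a₁ ≤ b₁ :=
  (h.left.weak hp h.ul_mem h.um_mem (isEntropyPair_mass p)).1

theorem speed_le_right (hp : PressureLaw p) (h : IsKinkFan p c ul um up ur a₁ b₁ a₂ b₂ W₁ W₂) :
    a₂ ≤ b₂ :=
  (h.right.weak hp h.up_mem h.ur_mem (isEntropyPair_mass p)).1

theorem mem_subsonic (h : IsKinkFan p c ul um up ur a₁ b₁ a₂ b₂ W₁ W₂) (ξ : ℝ) :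
    kinkProfile W₁ W₂ ξ ∈ subsonic p := by
  rw [kinkProfile]
  split_ifs
  exacts [h.left.mem ξ, h.right.mem ξ]

theorem measurable (h : IsKinkFan p c ul um up ur a₁ b₁ a₂ b₂ W₁ W₂) :
    Measurable (kinkProfile W₁ W₂) :=
  Measurable.ite measurableSet_Iic h.left.measurable h.right.measurable

theorem exists_bound (h : IsKinkFan p c ul um up ur a₁ b₁ a₂ b₂ W₁ W₂)
    {E : Type*} [NormedAddCommGroup E] {f : ℝ × ℝ → E} (hf : ContinuousOn f {u | 0 < u.1}) :
    ∃ C, ∀ ξ, ‖f (kinkProfile W₁ W₂ ξ)‖ ≤ C := by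
  obtain ⟨C₁, h₁⟩ := h.left.exists_bound h.ul_mem.1 h.um_mem.1 hf
  obtain ⟨C₂, h₂⟩ := h.right.exists_bound h.up_mem.1 h.ur_mem.1 hf
  refine ⟨max C₁ C₂, fun ξ => ?_⟩
  rw [kinkProfile]
  split_ifs
  exacts [(h₁ ξ).trans (le_max_left _ _), (h₂ ξ).trans (le_max_right _ _)]

/-- Each wave is constant beyond `0`, so an increment across the kink is at most the sum of an
increment of the wave and one of the other side, by the triangle inequality. The gluing is done in
two steps, with a step function in between. -/
theorem boundedVariation (h : IsKinkFan p c ul um up ur a₁ b₁ a₂ b₂ W₁ W₂) :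
    BoundedVariationOn (kinkProfile W₁ W₂) univ := by
  obtain ⟨C₁, h₁⟩ := h.left.exists_bound h.ul_mem.1 h.um_mem.1 continuousOn_id
  obtain ⟨C₂, h₂⟩ := h.right.exists_bound h.up_mem.1 h.ur_mem.1 continuousOn_id
  have hW₁ : ∀ y, 0 < y → W₁ y = um := fun y hy => h.left.isWave.2.1 y (h.left_neg.trans hy)
  have hW₂ : ∀ x, x ≤ 0 → W₂ x = up := fun x hx => h.right.isWave.1 x (hx.trans_lt h.right_pos)
  have hV : BoundedVariationOn (fun ξ => if ξ ≤ 0 then W₁ ξ else up) univ := by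
    refine boundedVariationOn_of_edist_le (boundedVariationOn_step um up)
      (boundedVariationOn_prod h.left.fst h.left.snd h₁) fun x y hxy => ?_
    rcases le_or_gt y 0 with hy | hy
    · simp only [if_pos hy, if_pos (hxy.trans hy)]
      exact le_add_left le_rfl
    · rcases le_or_gt x 0 with hx | hx
      · simp only [if_neg (not_le.2 hy), if_pos hx, hW₁ y hy]
        exact edist_triangle _ _ _
      · simp [if_neg (not_le.2 hy), if_neg (not_le.2 hx)]
  refine boundedVariationOn_of_edist_le (boundedVariationOn_prod h.right.fst h.right.snd h₂) hV
    fun x y hxy => ?_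
  simp only [kinkProfile]
  rcases le_or_gt y 0 with hy | hy
  · simp only [if_pos hy, if_pos (hxy.trans hy)]
    exact le_add_left le_rfl
  · rcases le_or_gt x 0 with hx | hx
    · simp only [if_neg (not_le.2 hy), if_pos hx, hW₂ x hx]
      exact edist_triangle _ _ _
    · simp [if_neg (not_le.2 hy), if_neg (not_le.2 hx)]

/-- The two waves are integrated up to `ξ = 0`, where their boundary terms leave the jump of `Q` at
the kink. At the far ends the test function vanishes. -/
theorem weak (hp : PressureLaw p) (h : IsKinkFan p c ul um up ur a₁ b₁ a₂ b₂ W₁ W₂)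
    {η Q : ℝ × ℝ → ℝ} (hE : IsEntropyPair p η Q) :
    ∃ D₁ D₂, (D₁ = 0 ∨ (flux p um - flux p ul = a₁ • (um - ul) ∧ charSpeed p 0 um < a₁ ∧
        a₁ < charSpeed p 0 ul ∧ D₁ = production η Q a₁ ul um)) ∧
      (D₂ = 0 ∨ (flux p ur - flux p up = a₂ • (ur - up) ∧ charSpeed p 1 ur < a₂ ∧
        a₂ < charSpeed p 1 up ∧ D₂ = production η Q a₂ up ur)) ∧
      ∀ ψ : ℝ → ℝ, ContDiff ℝ 1 ψ → HasCompactSupport ψ →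
        ∫ ξ, ((Q (kinkProfile W₁ W₂ ξ) - ξ * η (kinkProfile W₁ W₂ ξ)) * deriv ψ ξ -
          η (kinkProfile W₁ W₂ ξ) * ψ ξ) = (Q um - Q up) * ψ 0 + D₁ * ψ a₁ + D₂ * ψ a₂ := by
  obtain ⟨l₁, D₁, hD₁, H₁⟩ := h.left.weak hp h.ul_mem h.um_mem hE
  obtain ⟨l₂, D₂, hD₂, H₂⟩ := h.right.weak hp h.up_mem h.ur_mem hE
  refine ⟨D₁, D₂, hD₁, hD₂, fun ψ hψ hψc => ?_⟩
  obtain ⟨R, hR⟩ := hψc.isCompact.isBounded.subset_closedBall 0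
  set S := max R (max |a₁| |b₂|) + 1 with hS
  have hRS : R < S := (le_max_left _ _).trans_lt (lt_add_one _)
  have ha₁ : |a₁| < S :=
    ((le_max_left _ _).trans (le_max_right _ _)).trans_lt (lt_add_one _)
  have hb₂ : |b₂| < S :=
    ((le_max_right _ _).trans (le_max_right _ _)).trans_lt (lt_add_one _)
  have hS0 : 0 < S := (abs_nonneg _).trans_lt ha₁
  have hz : ∀ ξ, S ≤ |ξ| → ξ ∉ tsupport ψ := fun ξ hξ hcon => by
    have := hR hcon
    rw [mem_closedBall_zero_iff, Real.norm_eq_abs] at this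
    linarith
  have hψ0 : ∀ ξ, S ≤ |ξ| → ψ ξ = 0 := fun ξ hξ => image_eq_zero_of_notMem_tsupport (hz ξ hξ)
  have hψ1 : ∀ ξ, S ≤ |ξ| → deriv ψ ξ = 0 := fun ξ hξ =>
    image_eq_zero_of_notMem_tsupport fun hcon => hz ξ hξ (tsupport_deriv_subset hcon)
  set g : ℝ → ℝ := fun ξ => (Q (kinkProfile W₁ W₂ ξ) - ξ * η (kinkProfile W₁ W₂ ξ)) * deriv ψ ξ -
    η (kinkProfile W₁ W₂ ξ) * ψ ξ with hg
  have hsupp : Function.support g ⊆ Ioc (-S) S := fun ξ hξ => by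
    have : |ξ| < S := by
      by_contra! hcon
      refine hξ ?_
      simp only [hg, hψ0 ξ hcon, hψ1 ξ hcon]
      ring
    exact ⟨(abs_lt.1 this).1, (abs_lt.1 this).2.le⟩
  obtain ⟨i₁, e₁⟩ := H₁ (-S) 0 (by linarith [(abs_lt.1 ha₁).1]) h.left_neg.le ψ hψ
  obtain ⟨i₂, e₂⟩ := H₂ 0 S h.right_pos.le (abs_lt.1 hb₂).2.le ψ hψ
  have c₁ : EqOn (fun ξ => (Q (W₁ ξ) - ξ * η (W₁ ξ)) * deriv ψ ξ - η (W₁ ξ) * ψ ξ) g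
      (uIoc (-S) 0) := fun ξ hξ => by
    rw [uIoc_of_le (by linarith)] at hξ
    simp only [hg, kinkProfile, if_pos hξ.2]
  have c₂ : EqOn (fun ξ => (Q (W₂ ξ) - ξ * η (W₂ ξ)) * deriv ψ ξ - η (W₂ ξ) * ψ ξ) g
      (uIoc 0 S) := fun ξ hξ => by
    rw [uIoc_of_le hS0.le] at hξ
    simp only [hg, kinkProfile, if_neg (not_le.2 hξ.1)]
  rw [← intervalIntegral.integral_eq_integral_of_support_subset hsupp,
    ← intervalIntegral.integral_add_adjacent_intervals (i₁.congr c₁) (i₂.congr c₂),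
    ← intervalIntegral.integral_congr_ae (ae_of_all _ c₁),
    ← intervalIntegral.integral_congr_ae (ae_of_all _ c₂), e₁, e₂, hψ0 S (le_abs_self S),
    hψ0 (-S) (by rw [abs_neg]; exact le_abs_self S)]
  ring

theorem weak_time (hp : PressureLaw p) (h : IsKinkFan p c ul um up ur a₁ b₁ a₂ b₂ W₁ W₂)
    {η Q : ℝ × ℝ → ℝ} (hE : IsEntropyPair p η Q) :
    ∃ D₁ D₂, (D₁ = 0 ∨ (flux p um - flux p ul = a₁ • (um - ul) ∧ charSpeed p 0 um < a₁ ∧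
        a₁ < charSpeed p 0 ul ∧ D₁ = production η Q a₁ ul um)) ∧
      (D₂ = 0 ∨ (flux p ur - flux p up = a₂ • (ur - up) ∧ charSpeed p 1 ur < a₂ ∧
        a₂ < charSpeed p 1 up ∧ D₂ = production η Q a₂ up ur)) ∧
      ∀ φ, IsTest φ →
        ∫ t in Ioi (0 : ℝ), ∫ x, (η (kinkSolution ul ur W₁ W₂ t x) * dt φ t x +
          Q (kinkSolution ul ur W₁ W₂ t x) * dx φ t x) =
        ∫ t in Ioi (0 : ℝ), ((Q um - Q up) * φ (t, 0) + D₁ * φ (t, t * a₁) +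
          D₂ * φ (t, t * a₂)) := by
  obtain ⟨D₁, D₂, hD₁, hD₂, H⟩ := h.weak hp hE
  refine ⟨D₁, D₂, hD₁, hD₂, fun φ hφ => ?_⟩
  have hηc : ContinuousOn η {u | 0 < u.1} := fun u hu => by
    obtain ⟨L, h1, -⟩ := hE u hu
    exact h1.continuousAt.continuousWithinAt
  have hQc : ContinuousOn Q {u | 0 < u.1} := fun u hu => by
    obtain ⟨L, -, h1⟩ := hE u hu
    exact h1.continuousAt.continuousWithinAt
  obtain ⟨C₁, hC₁⟩ := h.exists_bound hηc
  obtain ⟨C₂, hC₂⟩ := h.exists_bound hQc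
  have hm : ∀ {f : ℝ × ℝ → ℝ}, ContinuousOn f {u | 0 < u.1} →
      AEStronglyMeasurable (fun ξ => f (kinkProfile W₁ W₂ ξ)) volume := fun hf =>
    aestronglyMeasurable_comp_of_continuousOn hf h.measurable.aestronglyMeasurable
      (Eventually.of_forall fun ξ => (h.mem_subsonic ξ).1)
  have i₀ : Integrable fun t => φ (t, 0) := by simpa using hφ.integrable_ray 0
  have := integral_selfSimilar (C := max C₁ C₂) (hm hηc) (hm hQc)
    (fun ξ => (hC₁ ξ).trans (le_max_left _ _)) (fun ξ => (hC₂ ξ).trans (le_max_right _ _)) H hφ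
    (by
      simp only [mul_zero]
      exact (((i₀.const_mul _).add ((hφ.integrable_ray a₁).const_mul _)).add
        ((hφ.integrable_ray a₂).const_mul _)).integrableOn)
  simp only [mul_zero] at this
  rw [← this]
  refine setIntegral_congr_fun measurableSet_Ioi fun t ht => ?_
  simp only [kinkSolution, if_pos (show 0 < t from ht)]

end IsKinkFan

/-! ### Verification that the constructed function is a solution -/

theorem measurable_riemannDatum (ul ur : ℝ × ℝ) : Measurable (riemannDatum ul ur) :=
  Measurable.ite measurableSet_Iio measurable_const measurable_const

theorem norm_riemannDatum_le (ul ur : ℝ × ℝ) (x : ℝ) : ‖riemannDatum ul ur x‖ ≤ max ‖ul‖ ‖ur‖ := by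
  rw [riemannDatum]
  split_ifs
  exacts [le_max_left _ _, le_max_right _ _]

theorem kinkSolution_apply {ul ur : ℝ × ℝ} {W₁ W₂ : ℝ → ℝ × ℝ} {t : ℝ} (ht : 0 < t) (x : ℝ) :
    kinkSolution ul ur W₁ W₂ t x = kinkProfile W₁ W₂ (x / t) := if_pos ht

theorem kinkSolution_zero (ul ur : ℝ × ℝ) (W₁ W₂ : ℝ → ℝ × ℝ) :
    kinkSolution ul ur W₁ W₂ 0 = riemannDatum ul ur :=
  funext fun _ => if_neg (lt_irrefl 0)

theorem isSelfSimilar_kinkSolution (ul ur : ℝ × ℝ) (W₁ W₂ : ℝ → ℝ × ℝ) :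
    IsSelfSimilar (kinkSolution ul ur W₁ W₂) :=
  ⟨kinkProfile W₁ W₂, fun _ ht => Eventually.of_forall fun x => kinkSolution_apply ht x⟩

namespace IsKinkFan

variable {p : ℝ → ℝ} {c : ℝ} {ul um up ur : ℝ × ℝ} {a₁ b₁ a₂ b₂ : ℝ} {W₁ W₂ : ℝ → ℝ × ℝ}

theorem measurable_slice (h : IsKinkFan p c ul um up ur a₁ b₁ a₂ b₂ W₁ W₂) (t : ℝ) :
    Measurable (kinkSolution ul ur W₁ W₂ t) :=
  Measurable.ite (MeasurableSet.const _) (h.measurable.comp (measurable_id.div_const t))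
    (measurable_riemannDatum ul ur)

theorem exists_norm_le (h : IsKinkFan p c ul um up ur a₁ b₁ a₂ b₂ W₁ W₂) :
    ∃ M, ∀ t x, ‖kinkSolution ul ur W₁ W₂ t x‖ ≤ M := by
  obtain ⟨M, hM⟩ := BoundedVariationOn.exists_norm_le h.boundedVariation
  refine ⟨max M (max ‖ul‖ ‖ur‖), fun t x => ?_⟩
  rw [kinkSolution]
  split_ifs
  exacts [(hM _).trans (le_max_left _ _), (norm_riemannDatum_le _ _ _).trans (le_max_right _ _)]

/-- The solution propagates with finite speed. -/
theorem exists_eq_datum (hp : PressureLaw p) (h : IsKinkFan p c ul um up ur a₁ b₁ a₂ b₂ W₁ W₂) :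
    ∃ R > 0, ∀ t x, 0 ≤ t → t * R < |x| →
      kinkSolution ul ur W₁ W₂ t x = riemannDatum ul ur x := by
  have h1 : a₁ < 0 := (h.speed_le_left hp).trans_lt h.left_neg
  have h2 : 0 < b₂ := h.right_pos.trans_le (h.speed_le_right hp)
  refine ⟨max (-a₁) b₂, lt_max_of_lt_right h2, fun t x ht hx => ?_⟩
  rcases ht.eq_or_lt with rfl | ht
  · rw [kinkSolution_zero]
  rw [kinkSolution_apply ht, riemannDatum, kinkProfile]
  have hx' : max (-a₁) b₂ < |x| / t := by rwa [lt_div_iff₀' ht]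
  rcases lt_or_ge x 0 with h0 | h0
  · rw [if_pos h0, if_pos (div_nonpos_of_nonpos_of_nonneg h0.le ht.le)]
    refine h.left.isWave.1 _ ?_
    rw [abs_of_neg h0, neg_div] at hx'
    linarith [le_max_left (-a₁) b₂]
  · have h3 : 0 < x := lt_of_le_of_ne h0 fun hcon => by
      rw [← hcon, abs_zero] at hx
      exact absurd hx (not_lt.2 (mul_nonneg ht.le (h2.le.trans (le_max_right _ _))))
    rw [if_neg (not_lt.2 h0), if_neg (not_le.2 (div_pos h3 ht))]
    refine h.right.isWave.2.1 _ ?_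
    rw [abs_of_pos h3] at hx'
    exact (le_max_right _ _).trans_lt hx'

theorem exists_dominating (hp : PressureLaw p)
    (h : IsKinkFan p c ul um up ur a₁ b₁ a₂ b₂ W₁ W₂) (T : ℝ) :
    ∃ B : ℝ → ℝ, Integrable B ∧ ∀ s t, 0 ≤ s → s ≤ T → 0 ≤ t → t ≤ T → ∀ x,
      ‖kinkSolution ul ur W₁ W₂ t x - kinkSolution ul ur W₁ W₂ s x‖ ≤ B x := by
  obtain ⟨M, hM⟩ := h.exists_norm_le
  obtain ⟨R, hR, hd⟩ := h.exists_eq_datum hp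
  refine ⟨(Icc (-(T * R)) (T * R)).indicator fun _ => M + M,
    (integrable_indicator_iff measurableSet_Icc).2 (integrableOn_const (by simp)), ?_⟩
  intro s t hs hsT ht htT x
  by_cases hx : x ∈ Icc (-(T * R)) (T * R)
  · rw [indicator_of_mem hx]
    exact (norm_sub_le _ _).trans (add_le_add (hM t x) (hM s x))
  · rw [indicator_of_notMem hx]
    have hx' : T * R < |x| := by
      by_contra! hcon
      exact hx (abs_le.1 hcon)
    rw [hd t x ht ((mul_le_mul_of_nonneg_right htT hR.le).trans_lt hx'),
      hd s x hs ((mul_le_mul_of_nonneg_right hsT hR.le).trans_lt hx'), sub_self, norm_zero]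

/-- Dominated convergence. For `t₀ > 0` the integrand converges because the profile is continuous
almost everywhere; for `t₀ = 0` finite speed of propagation makes it vanish at each `x ≠ 0` for
small times. -/
theorem tendsto_L1 (hp : PressureLaw p) (h : IsKinkFan p c ul um up ur a₁ b₁ a₂ b₂ W₁ W₂)
    {t₀ : ℝ} (ht₀ : 0 ≤ t₀) :
    Tendsto (fun t => ∫ x, ‖kinkSolution ul ur W₁ W₂ t x - kinkSolution ul ur W₁ W₂ t₀ x‖)
      (𝓝[Ici 0] t₀) (𝓝 0) := by
  obtain ⟨B, hB, hdom⟩ := h.exists_dominating hp (t₀ + 1)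
  have hT : ∀ᶠ t in 𝓝[Ici 0] t₀, t < t₀ + 1 :=
    nhdsWithin_le_nhds (eventually_lt_nhds (lt_add_one t₀))
  have h0 : ∀ᶠ t in 𝓝[Ici 0] t₀, 0 ≤ t := self_mem_nhdsWithin
  rw [show 𝓝 (0 : ℝ) = 𝓝 (∫ _ : ℝ, (0 : ℝ)) by simp]
  refine tendsto_integral_filter_of_dominated_convergence B
    (Eventually.of_forall fun t =>
      ((h.measurable_slice t).sub (h.measurable_slice t₀)).norm.aestronglyMeasurable)
    ?_ hB ?_
  · filter_upwards [hT, h0] with t h1 h2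
    refine Eventually.of_forall fun x => ?_
    rw [norm_norm]
    exact hdom t₀ t ht₀ (lt_add_one t₀).le h2 h1.le x
  · rcases ht₀.eq_or_lt with rfl | hpos
    · obtain ⟨R, hR, hd⟩ := h.exists_eq_datum hp
      have hne : ∀ᵐ x : ℝ, x ≠ 0 := by simp [ae_iff, measure_singleton]
      filter_upwards [hne] with x hx
      refine tendsto_const_nhds.congr' ?_
      have h3 : ∀ᶠ t in 𝓝[Ici 0] (0 : ℝ), t * R < |x| := by
        have : Tendsto (fun t : ℝ => t * R) (𝓝[Ici 0] 0) (𝓝 (0 * R)) :=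
          (tendsto_id.mul_const R).mono_left nhdsWithin_le_nhds
        refine this.eventually (eventually_lt_nhds ?_)
        rw [zero_mul]
        exact abs_pos.2 hx
      filter_upwards [h3, h0] with t h4 h5
      rw [hd t x h5 h4, kinkSolution_zero, sub_self, norm_zero]
    · have hc : ∀ᵐ ξ, ContinuousAt (kinkProfile W₁ W₂) ξ := by
        filter_upwards [h.boundedVariation.locallyBoundedVariationOn.ae_differentiableAt] with ξ hξ
        exact hξ.continuousAt
      filter_upwards [ae_comp_div hc hpos] with x hx
      have h1 : Tendsto (fun t => kinkProfile W₁ W₂ (x / t)) (𝓝 t₀)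
          (𝓝 (kinkProfile W₁ W₂ (x / t₀))) :=
        hx.tendsto.comp (tendsto_const_nhds.div tendsto_id hpos.ne')
      have h2 := ((h1.sub_const (kinkProfile W₁ W₂ (x / t₀))).norm).mono_left
        (nhdsWithin_le_nhds (s := Ici (0 : ℝ)))
      rw [sub_self, norm_zero] at h2
      refine h2.congr' ?_
      filter_upwards [nhdsWithin_le_nhds (eventually_gt_nhds hpos)] with t ht
      rw [kinkSolution_apply ht, kinkSolution_apply hpos]

theorem boundedVariation_slice (h : IsKinkFan p c ul um up ur a₁ b₁ a₂ b₂ W₁ W₂) {t : ℝ}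
    (ht : 0 ≤ t) : ∃ g : ℝ → ℝ × ℝ, BoundedVariationOn g univ ∧
      kinkSolution ul ur W₁ W₂ t =ᵐ[volume] g := by
  rcases ht.eq_or_lt with rfl | ht
  · refine ⟨_, boundedVariationOn_step ul ur, ?_⟩
    have hne : ∀ᵐ x : ℝ, x ≠ 0 := by simp [ae_iff, measure_singleton]
    filter_upwards [hne] with x hx
    rw [kinkSolution_zero, riemannDatum]
    rcases lt_or_gt_of_ne hx with h1 | h1
    · rw [if_pos h1, if_pos h1.le]
    · rw [if_neg (not_lt.2 h1.le), if_neg (not_le.2 h1)]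
  · refine ⟨_, ne_top_of_le_ne_top h.boundedVariation
      (eVariationOn.comp_le_of_monotoneOn (kinkProfile W₁ W₂) (t := univ) (fun x : ℝ => x / t)
        (fun x _ y _ hxy => div_le_div_of_nonneg_right hxy ht.le) (mapsTo_univ _ univ)),
      Eventually.of_forall fun x => ?_⟩
    rw [kinkSolution_apply ht]
    rfl

theorem leftTrace (h : IsKinkFan p c ul um up ur a₁ b₁ a₂ b₂ W₁ W₂) {t : ℝ} (ht : 0 < t)
    (f : ℝ × ℝ → ℝ) : LeftTrace (fun x => f (kinkSolution ul ur W₁ W₂ t x)) (f um) := by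
  refine tendsto_const_nhds.congr' (inf_le_left (a := 𝓝[<] (0 : ℝ)) ?_)
  have h1 : b₁ * t < 0 := mul_neg_of_neg_of_pos h.left_neg ht
  filter_upwards [Ioo_mem_nhdsLT h1] with x hx
  rw [kinkSolution_apply ht, kinkProfile, if_pos (div_nonpos_of_nonpos_of_nonneg hx.2.le ht.le),
    h.left.isWave.2.1 _ ((lt_div_iff₀ ht).2 hx.1)]

theorem rightTrace (h : IsKinkFan p c ul um up ur a₁ b₁ a₂ b₂ W₁ W₂) {t : ℝ} (ht : 0 < t)
    (f : ℝ × ℝ → ℝ) : RightTrace (fun x => f (kinkSolution ul ur W₁ W₂ t x)) (f up) := by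
  refine tendsto_const_nhds.congr' (inf_le_left (a := 𝓝[>] (0 : ℝ)) ?_)
  have h1 : 0 < a₂ * t := mul_pos h.right_pos ht
  filter_upwards [Ioo_mem_nhdsGT h1] with x hx
  rw [kinkSolution_apply ht, kinkProfile, if_neg (not_le.2 (div_pos hx.1 ht)),
    h.right.isWave.1 _ ((div_lt_iff₀ ht).2 hx.2)]

theorem isWeakEntropySolution (hp : PressureLaw p) {ρref : ℝ} (hr : 0 < ρref) (hc : 0 ≤ c)
    (h : IsKinkFan p c ul um up ur a₁ b₁ a₂ b₂ W₁ W₂) :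
    IsWeakEntropySolution p ρref c (riemannDatum ul ur) (kinkSolution ul ur W₁ W₂) where
  measurable := by
    have : Measurable fun z : ℝ × ℝ => kinkSolution ul ur W₁ W₂ z.1 z.2 :=
      Measurable.ite (measurableSet_lt measurable_const measurable_fst)
        (h.measurable.comp (measurable_snd.div measurable_fst))
        ((measurable_riemannDatum ul ur).comp measurable_snd)
    exact this.aestronglyMeasurable
  bounded := by
    obtain ⟨M, hM⟩ := h.exists_norm_le
    exact ⟨M, fun t _ => Eventually.of_forall (hM t)⟩
  boundedVariation := fun t ht => h.boundedVariation_slice ht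
  initial := by rw [kinkSolution_zero]
  integrable := fun t ht => by
    obtain ⟨B, hB, hdom⟩ := h.exists_dominating hp t
    refine hB.mono' ((h.measurable_slice t).sub
      (measurable_riemannDatum ul ur)).aestronglyMeasurable (Eventually.of_forall fun x => ?_)
    have := hdom 0 t le_rfl ht ht le_rfl x
    rwa [kinkSolution_zero] at this
  continuous := fun t₀ ht₀ => h.tendsto_L1 hp ht₀
  mass := fun φ hφ => by
    obtain ⟨D₁, D₂, hD₁, hD₂, H⟩ := h.weak_time hp (isEntropyPair_mass p)
    have e₁ : D₁ = 0 := hD₁.elim id fun hcon => hcon.2.2.2.trans (production_mass hcon.1)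
    have e₂ : D₂ = 0 := hD₂.elim id fun hcon => hcon.2.2.2.trans (production_mass hcon.1)
    rw [H φ hφ, e₁, e₂, h.kink.1]
    simp
  momentum := by
    refine ⟨fun _ => up.2, fun t ht => ⟨?_, h.rightTrace ht Prod.snd, dynPressure p um,
      dynPressure p up, h.leftTrace ht _, h.rightTrace ht _, h.kink.2⟩, fun φ hφ => ?_⟩
    · rw [h.kink.1]
      exact h.leftTrace ht Prod.snd
    obtain ⟨D₁, D₂, hD₁, hD₂, H⟩ := h.weak_time hp (isEntropyPair_momentum hp)
    have e₁ : D₁ = 0 := hD₁.elim id fun hcon => hcon.2.2.2.trans (production_momentum hcon.1)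
    have e₂ : D₂ = 0 := hD₂.elim id fun hcon => hcon.2.2.2.trans (production_momentum hcon.1)
    have e₃ : dynPressure p um - dynPressure p up = c * up.2 := by linarith [h.kink.2]
    rw [H φ hφ, e₁, e₂, e₃]
    simp
  entropy_ineq := fun φ hφ hpos => by
    obtain ⟨D₁, D₂, hD₁, hD₂, H⟩ := h.weak_time hp (isEntropyPair_entropy hp hr)
    have e₁ : 0 ≤ D₁ := hD₁.elim ge_of_eq fun hcon => by
      rw [hcon.2.2.2]
      exact production_entropy_nonneg hp hr h.ul_mem.1 h.um_mem.1 hcon.1 hcon.2.1 hcon.2.2.1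
    have e₂ : 0 ≤ D₂ := hD₂.elim ge_of_eq fun hcon => by
      rw [hcon.2.2.2]
      exact production_entropy_nonneg hp hr h.up_mem.1 h.ur_mem.1 hcon.1 hcon.2.1 hcon.2.2.1
    have e₃ := h.kink.entropyFlux_le hp hr hc h.um_mem h.up_mem
    rw [H φ hφ]
    refine integral_nonneg fun t => add_nonneg (add_nonneg ?_ (mul_nonneg e₁ (hpos _)))
      (mul_nonneg e₂ (hpos _))
    exact mul_nonneg (sub_nonneg.2 e₃) (hpos _)

theorem isSubsonicValued (h : IsKinkFan p c ul um up ur a₁ b₁ a₂ b₂ W₁ W₂) :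
    IsSubsonicValued p (kinkSolution ul ur W₁ W₂) := fun t ht =>
  Eventually.of_forall fun x => by
    rw [kinkSolution_apply ht]
    exact h.mem_subsonic _

theorem hasKinkStructure (h : IsKinkFan p c ul um up ur a₁ b₁ a₂ b₂ W₁ W₂) :
    HasKinkStructure p c ul ur (kinkSolution ul ur W₁ W₂) := by
  refine ⟨um, h.um_mem, up, h.up_mem, a₁, b₁, a₂, b₂, W₁, W₂, h.left.isWave, h.left_neg, h.kink,
    h.right.isWave, h.right_pos, fun t ht => ⟨fun x hx => ?_, fun x hx => ?_⟩⟩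
  · rw [kinkSolution_apply ht, kinkProfile, if_pos (div_neg_of_neg_of_pos hx ht).le]
  · rw [kinkSolution_apply ht, kinkProfile, if_neg (not_le.2 (div_pos hx ht))]

end IsKinkFan

/-! ### Conclusion -/

theorem norm_sub_lt_of_eLpNorm_lt {ul ur um up : ℝ × ℝ} {ubar : ℝ → ℝ × ℝ} {δ : ℝ}
    (hl : ∀ x, x < 0 → ubar x = um) (hr : ∀ x, 0 < x → ubar x = up)
    (h : eLpNorm (fun x => riemannDatum ul ur x - ubar x) ⊤ volume < ENNReal.ofReal δ) :
    dist ul um < δ ∧ dist ur up < δ := by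
  rw [eLpNorm_exponent_top] at h
  have hae := ae_lt_of_essSup_lt h
  have key : ∀ x, ‖riemannDatum ul ur x - ubar x‖ₑ < ENNReal.ofReal δ →
      dist (riemannDatum ul ur x) (ubar x) < δ := fun x hx => by
    rw [← ofReal_norm, ENNReal.ofReal_lt_ofReal_iff'] at hx
    rw [dist_eq_norm]
    exact hx.1
  constructor
  · have e₁ : ∀ᶠ x in 𝓝[<] (0 : ℝ) ⊓ ae volume, x < 0 :=
      (inf_le_left : 𝓝[<] (0 : ℝ) ⊓ ae volume ≤ _) self_mem_nhdsWithin
    have e₂ := hae.filter_mono (inf_le_right : 𝓝[<] (0 : ℝ) ⊓ ae volume ≤ _)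
    obtain ⟨x, h1, h2⟩ := (e₁.and e₂).exists
    have := key x h2
    rwa [hl x h1, riemannDatum, if_pos h1] at this
  · have e₁ : ∀ᶠ x in 𝓝[>] (0 : ℝ) ⊓ ae volume, 0 < x :=
      (inf_le_left : 𝓝[>] (0 : ℝ) ⊓ ae volume ≤ _) self_mem_nhdsWithin
    have e₂ := hae.filter_mono (inf_le_right : 𝓝[>] (0 : ℝ) ⊓ ae volume ≤ _)
    obtain ⟨x, h1, h2⟩ := (e₁.and e₂).exists
    have := key x h2
    rwa [hr x h1, riemannDatum, if_neg (not_lt.2 h1.le)] at this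

end KinkedPipe

end

open KinkedPipe in
theorem proposition1 (p κ : ℝ → ℝ) (hp : PressureLaw p) (hκ : KinkLaw κ)
    (ρref : ℝ) (hρref : 0 < ρref) (θ : ℝ) (hθ : θ ∈ Ioo (-Real.pi) Real.pi)
    (f : ℝ) (hf : 0 < f) (ubar : ℝ → ℝ × ℝ)
    (hstat : IsStationary p (kinkCoeff f κ θ) ubar)
    (hsub : ∀ x, x ≠ 0 → ubar x ∈ subsonic p) :
    ∃ δ : ℝ, 0 < δ ∧ ∀ ul ∈ subsonic p, ∀ ur ∈ subsonic p,
      eLpNorm (fun x => riemannDatum ul ur x - ubar x) ⊤ volume < ENNReal.ofReal δ →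
      ∃ u : ℝ → ℝ → ℝ × ℝ,
        IsWeakEntropySolution p ρref (kinkCoeff f κ θ) (riemannDatum ul ur) u ∧
        IsSelfSimilar u ∧ IsSubsonicValued p u ∧
        HasKinkStructure p (kinkCoeff f κ θ) ul ur u ∧
        ∀ w : ℝ → ℝ → ℝ × ℝ,
          IsWeakEntropySolution p ρref (kinkCoeff f κ θ) (riemannDatum ul ur) w →
          IsSelfSimilar w → IsSubsonicValued p w →
          ∀ t, 0 < t → w t =ᵐ[volume] u t := by
  have hc : 0 ≤ kinkCoeff f κ θ := mul_nonneg hf.le (hκ.nonneg _)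
  obtain ⟨vl, vr, -, -, hk, hl, hr⟩ := hstat
  have hvl : vl ∈ subsonic p := by
    have := hsub (-1) (by norm_num)
    rwa [hl _ (by norm_num)] at this
  have hvr : vr ∈ subsonic p := by
    have := hsub 1 one_ne_zero
    rwa [hr _ one_pos] at this
  -- The radius `δ` comes from existence alone; uniqueness holds for all subsonic data.
  obtain ⟨δ, hδ, H⟩ := Metric.eventually_nhds_iff.1 (eventually_exists_waves hp hc hvl hvr hk)
  refine ⟨δ, hδ, fun ul hul ur hur hd => ?_⟩
  obtain ⟨d₁, d₂⟩ := norm_sub_lt_of_eLpNorm_lt hl hr hd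
  obtain ⟨um, hum, up, hup, a₁, b₁, a₂, b₂, W₁, W₂, w₁, n₁, hkink, w₂, n₂⟩ :=
    H (y := (ul, ur)) (max_lt d₁ d₂) hul hur
  have hfan : IsKinkFan p (kinkCoeff f κ θ) ul um up ur a₁ b₁ a₂ b₂ W₁ W₂ :=
    ⟨hul, hum, hup, hur, w₁, n₁, hkink, w₂, n₂⟩
  have hsol := hfan.isWeakEntropySolution hp hρref hc
  exact ⟨_, hsol, isSelfSimilar_kinkSolution .., hfan.isSubsonicValued, hfan.hasKinkStructure,
    fun w hw hws hw' t ht => hsol.ae_eq hp hρref hc hul hur (isSelfSimilar_kinkSolution ..)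
      hfan.isSubsonicValued hw hws hw' ht⟩
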